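/- Let $m\ge 1$ be an integer. For a commutative ring $k$ and a $k$-algebra $R$, a Hilbert scheme $\mathrm{Hilb}_m(R/k)$ is a $k$-scheme representing the functor that sends a $k$-algebra $S$ to the set of ideals $I\subset S\otimes_k R$ such that $(S\otimes_k R)/I$ is a finite locally free $S$-module of rank $m$. For a field-valued point of $k$, $k\to\kappa$, an ideal $J$ of $R$ with $\dim_\kappa(\kappa\otimes_k R)/J(\kappa\otimes_k R)=m$ defines a $\kappa$-point of $\mathrm{Hilb}_m(R/k)$, denoted by the same letter $J$. A $\mathbb C$-scheme is called smooth at a point if its local ring there is regular and formally smooth over $\mathbb C$ (the schemes below are localizations of schemes of finite type). **(1) The node.** Let $R$ be the localization of $\mathbb C[x,y]/(xy)$ at $(x,y)$. Put $Q^m_i=(x^{m-i+1},y^i)\subset R$ for $1\le i\le m$ and $I^m_i(a)=(y^i+ax^{m-i})\subset R$ for $1\le i\le m-1$, $a\in\mathbb C\setminus\{0\}$. Then the Hilbert scheme $H=\mathrm{Hilb}_m(R/\mathbb C)$ exists, and there are integral closed subschemes $D^m_0,\dots,D^m_m$ of $H$ with the following properties. * $H$ is the scheme-theoretic union of $D^m_0,\dots,D^m_m$.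 * Each $D^m_i$ is smooth at all its points, and has dimension $m$ at each of its $\mathbb C$-points. * For $1\le i\le m-1$, the $\mathbb C$-points of $D^m_i$ are the $\mathbb C$-points of the closure $C^m_i$ in $H$ of the set of points $I^m_i(a)$, $a\ne0$. The only $\mathbb C$-point of $D^m_0$ is $Q^m_1$, and the only $\mathbb C$-point of $D^m_m$ is $Q^m_m$. * $D^m_i\cap D^m_j=\emptyset$ if $|i-j|\ge 2$. * For $0\le i\le m-1$, the scheme-theoretic intersection $D^m_i\cap D^m_{i+1}$ is smooth at all its points, its only $\mathbb C$-point is $Q^m_{i+1}$, and it has dimension $m-1$ there. * For $0\le i\le m-1$, the local ring of $H$ at $Q^m_{i+1}$ is isomorphic, as a $\mathbb C$-algebra, to the local ring at the origin of the hypersurface $bc=0$ in $\mathbb A^{m+1}$ (with $b,c$ two of the $m+1$ coordinates), in such a way that $D^m_i$ and $D^m_{i+1}$ correspond to the hyperplanes $c=0$ and $b=0$. In particular they meet transversely. **(2) The versal family.** Let $B=\mathbb C[t]_{(t)}$ and let $\tilde R=\mathbb C[x,y]_{(x,y)}$ be the $B$-algebra with $t\mapsto xy$. Then the relative Hilbert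 scheme $\tilde H=\mathrm{Hilb}_m(\tilde R/B)$ exists. Its total space is smooth over $\mathbb C$ at all its points and has dimension $m+1$ at each of its points with values in the residue field $B/(t)=\mathbb C$. For $1\le i\le m$, the local ring of $\tilde H$ at the point $(x^{m-i+1},y^i)$ of the special fibre is isomorphic, as a $\mathbb C[t]$-algebra, to the local ring at the origin of the hypersurface $bc=t$ in $\mathbb A^{m+2}$ (with $b,c,t$ three of the $m+2$ coordinates). -/

import Mathlib

open CategoryTheory AlgebraicGeometry TensorProduct

namespace NodeHilb

noncomputable section

/-! ### The germs -/

/-- The ideal of the origin in `ℂ[z₀, …, z_{n-1}]`: the polynomials without constant term. -/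
abbrev originIdeal (n : ℕ) : Ideal (MvPolynomial (Fin n) ℂ) :=
  RingHom.ker (MvPolynomial.constantCoeff (R := ℂ) (σ := Fin n))

instance originIdeal_isPrime (n : ℕ) : (originIdeal n).IsPrime := RingHom.ker_isPrime _

/-- The local ring at the origin of the hypersurface `f = 0` in affine `n`-space (for `f` vanishing
at the origin): the ring `ℂ[z₀, …, z_{n-1}] / (f)`, localized at the classes of the polynomials
that do not vanish at the origin. -/
abbrev HypersurfaceGerm (n : ℕ) (f : MvPolynomial (Fin n) ℂ) : Type :=
  Localization ((originIdeal n).primeCompl.map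
    (Ideal.Quotient.mk (Ideal.span ({f} : Set (MvPolynomial (Fin n) ℂ)))))

/-- The `j`-th coordinate, as an element of the local ring of the hypersurface `f = 0`. -/
def coord {n : ℕ} (f : MvPolynomial (Fin n) ℂ) (j : Fin n) : HypersurfaceGerm n f :=
  algebraMap (MvPolynomial (Fin n) ℂ ⧸ Ideal.span ({f} : Set (MvPolynomial (Fin n) ℂ)))
    (HypersurfaceGerm n f) (Ideal.Quotient.mk _ (MvPolynomial.X j))

/-- The equation `x y` of the node. -/
abbrev nodeEq : MvPolynomial (Fin 2) ℂ := MvPolynomial.X 0 * MvPolynomial.X 1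

/-- The germ `R` of the node: `ℂ[x, y] / (x y)` localized at `(x, y)`. -/
abbrev NodeGerm : Type := HypersurfaceGerm 2 nodeEq

/-- The ideal `(t)` of `ℂ[t]`: the polynomials without constant term. -/
abbrev baseIdeal : Ideal (Polynomial ℂ) := RingHom.ker (Polynomial.constantCoeff (R := ℂ))

instance baseIdeal_isPrime : baseIdeal.IsPrime := RingHom.ker_isPrime _

/-- The germ `B` of the affine line: `ℂ[t]` localized at `(t)`. -/
abbrev BaseGerm : Type := Localization.AtPrime baseIdeal

/-- The germ of the affine plane: `ℂ[x, y]` localized at `(x, y)`. -/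
def PlaneGerm : Type := Localization.AtPrime (originIdeal 2)

instance : CommRing PlaneGerm := inferInstanceAs (CommRing (Localization.AtPrime (originIdeal 2)))

instance : Algebra (MvPolynomial (Fin 2) ℂ) PlaneGerm :=
  inferInstanceAs (Algebra _ (Localization.AtPrime (originIdeal 2)))

/-- A polynomial in `t` vanishes at `0` iff its pullback along `t = x y` vanishes at the origin. -/
theorem baseIdeal_eq_comap :
    baseIdeal =
      (originIdeal 2).comap (Polynomial.aeval nodeEq : Polynomial ℂ →ₐ[ℂ] _).toRingHom := by
  ext p
  have h : MvPolynomial.constantCoeff (Polynomial.aeval nodeEq p) = p.coeff 0 := by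
    rw [Polynomial.aeval_def, Polynomial.hom_eval₂]
    simp [Polynomial.eval₂_at_zero]
  simp only [RingHom.mem_ker, Ideal.mem_comap, Polynomial.constantCoeff_apply]
  exact (iff_of_eq (congrArg (· = 0) h)).symm

/-- The structure of the versal family `x y = t`: the local homomorphism
`ℂ[t]_(t) → ℂ[x, y]_(x, y)`, `t ↦ x y`. -/
def versalHom : BaseGerm →+* PlaneGerm :=
  Localization.localRingHom baseIdeal (originIdeal 2)
    (Polynomial.aeval nodeEq : Polynomial ℂ →ₐ[ℂ] _).toRingHom baseIdeal_eq_comap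

instance : Algebra BaseGerm PlaneGerm := versalHom.toAlgebra

/-- The ideal `Q^m_i = (x^{m-i+1}, y^i)`, for `1 ≤ i ≤ m`. -/
def idealQ {R : Type} [CommRing R] (x y : R) (m i : ℕ) : Ideal R :=
  Ideal.span {x ^ (m - i + 1), y ^ i}

/-- The ideal `I^m_i(a) = (y^i + a x^{m-i})` of the node germ, for `1 ≤ i ≤ m - 1`. -/
def idealI (m i : ℕ) (a : ℂ) : Ideal NodeGerm :=
  Ideal.span {coord nodeEq 1 ^ i + algebraMap ℂ NodeGerm a * coord nodeEq 0 ^ (m - i)}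

/-! ### Hilbert schemes of points -/

/-- A flat family of length-`m` subschemes of `Spec R` (over `Spec k`) parametrized by `Spec S`:
an ideal of `S ⊗ R` whose quotient is finite locally free of rank `m` over `S`. -/
structure HilbFamily (k R S : Type) [CommRing k] [CommRing R] [Algebra k R] [CommRing S]
    [Algebra k S] (m : ℕ) where
  ideal : Ideal (S ⊗[k] R)
  finite : Module.Finite S ((S ⊗[k] R) ⧸ ideal)
  projective : Module.Projective S ((S ⊗[k] R) ⧸ ideal)
  rank_eq : ∀ p : PrimeSpectrum S, Module.rankAtStalk (R := S) ((S ⊗[k] R) ⧸ ideal) p = m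

/-- The `S`-valued points of a `k`-scheme `s : X ⟶ Spec k`. -/
abbrev SPoint {k : Type} [CommRing k] {X : Scheme.{0}} (s : X ⟶ Spec (CommRingCat.of k))
    (S : Type) [CommRing S] [Algebra k S] : Type :=
  {p : Spec (CommRingCat.of S) ⟶ X // p ≫ s = Spec.map (CommRingCat.ofHom (algebraMap k S))}

/-- A (relative) Hilbert scheme `Hilb_m(R / k)`: a `k`-scheme together with a bijection, natural in
the `k`-algebra `S`, between its `S`-valued points and the flat families of length-`m` subschemes of
`Spec R` parametrized by `Spec S`. Base change of a family along `S → S'` is extension of its ideal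
along `S ⊗ R → S' ⊗ R`. As schemes and the Hilbert functor are Zariski sheaves, the values on affine
test schemes determine the Hilbert scheme up to unique isomorphism. -/
structure HilbertScheme (k R : Type) [CommRing k] [CommRing R] [Algebra k R] (m : ℕ) where
  carrier : Scheme.{0}
  str : carrier ⟶ Spec (CommRingCat.of k)
  family : ∀ (S : Type) [CommRing S] [Algebra k S], SPoint str S ≃ HilbFamily k R S m
  natural : ∀ (S S' : Type) [CommRing S] [Algebra k S] [CommRing S'] [Algebra k S']
    (f : S →ₐ[k] S') (p : SPoint str S) (p' : SPoint str S'),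
    p'.1 = Spec.map (CommRingCat.ofHom f.toRingHom) ≫ p.1 →
      (family S' p').ideal =
        (family S p).ideal.map (Algebra.TensorProduct.map f (AlgHom.id k R)).toRingHom

section Points

variable {k R : Type} [CommRing k] [CommRing R] [Algebra k R] {m : ℕ}

/-- `x` is the image of a point of the Hilbert scheme with values in the field `κ`. -/
def HilbertScheme.IsRationalPoint (H : HilbertScheme k R m) (κ : Type) [Field κ] [Algebra k κ]
    (x : H.carrier) : Prop :=
  ∃ p : SPoint H.str κ, p.1 (IsLocalRing.closedPoint κ) = x

/-- `x` is the `κ`-valued point of the Hilbert scheme that corresponds to the subscheme of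
`Spec (κ ⊗ R)` defined by the extension of the ideal `J` of `R`. -/
def HilbertScheme.IsPoint (H : HilbertScheme k R m) (κ : Type) [Field κ] [Algebra k κ]
    (J : Ideal R) (x : H.carrier) : Prop :=
  ∃ p : SPoint H.str κ, p.1 (IsLocalRing.closedPoint κ) = x ∧
    (H.family κ p).ideal =
      J.map (Algebra.TensorProduct.includeRight : R →ₐ[k] κ ⊗[k] R).toRingHom

end Points

/-! ### Local notions on schemes -/

/-- The homomorphism `k → 𝒪_{X, x}` for a scheme `X` over `Spec k`. -/
def stalkHom {k : Type} [CommRing k] {X : Scheme.{0}} (s : X ⟶ Spec (CommRingCat.of k)) (x : X) :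
    k →+* X.presheaf.stalk x :=
  ((Scheme.ΓSpecIso (CommRingCat.of k)).inv ≫ s.appTop ≫
    X.presheaf.germ ⊤ x trivial).hom

/-- The stalk at `x` of an ideal sheaf, as an ideal of `𝒪_{X, x}`. -/
def stalkIdeal {X : Scheme.{0}} (D : X.IdealSheafData) (x : X) : Ideal (X.presheaf.stalk x) :=
  ⨆ (U : X.affineOpens) (hx : x ∈ U.1), (D.ideal U).map (X.presheaf.germ U.1 x hx).hom

/-- Smoothness of a germ of a `ℂ`-scheme, without a finiteness condition because the germs that
occur here are only localizations of schemes of finite type: the local ring at `x` is regular and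
formally smooth over `ℂ`. -/
def SmoothAt {X : Scheme.{0}} (s : X ⟶ Spec (CommRingCat.of ℂ)) (x : X) : Prop :=
  IsRegularLocalRing (X.presheaf.stalk x) ∧ (stalkHom s x).FormallySmooth

/-- The structure morphism `Spec ℂ[t]_(t) ⟶ Spec ℂ`. -/
def baseStr : Spec (CommRingCat.of BaseGerm) ⟶ Spec (CommRingCat.of ℂ) :=
  Spec.map (CommRingCat.ofHom (algebraMap ℂ BaseGerm))

/-- The equation `b c = 0` in affine `(m+1)`-space, with `b = z₀` and `c = z₁`. -/
abbrev eqBC (m : ℕ) : MvPolynomial (Fin (m + 1)) ℂ := MvPolynomial.X 0 * MvPolynomial.X 1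

/-- The equation `b c = t` in affine `(m+2)`-space, with `b = z₀`, `c = z₁` and `t` the last
coordinate. -/
abbrev eqBCT (m : ℕ) : MvPolynomial (Fin (m + 2)) ℂ :=
  MvPolynomial.X 0 * MvPolynomial.X 1 - MvPolynomial.X (Fin.last (m + 1))

/-! ### The two parts of the result -/

/-- `D 0, …, D m` are closed subschemes of `H = Hilb_m(R)` (given by their ideal sheaves) that form
a chain of smooth `m`-dimensional germs as described in the fields. -/
structure IsSmoothChain {m : ℕ} (H : HilbertScheme ℂ NodeGerm m)
    (D : Fin (m + 1) → H.carrier.IdealSheafData) : Prop where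
  /-- `H` is the scheme-theoretic union of the `D i`. -/
  union : ⨅ i, D i = ⊥
  integral : ∀ i, IsIntegral (D i).subscheme
  smooth : ∀ i (y : (D i).subscheme), SmoothAt ((D i).subschemeι ≫ H.str) y
  /-- Each `D i` has dimension `m` at each of its `ℂ`-points. -/
  dim : ∀ i (y : (D i).subscheme), H.IsRationalPoint ℂ ((D i).subschemeι y) →
    ringKrullDim ((D i).subscheme.presheaf.stalk y) = m
  /-- For `0 < i < m`, `D i` is supported on the closure of the set of the ideals `I^m_i(a)`. -/
  supp_mid : ∀ i : Fin (m + 1), 0 < i.1 → i.1 < m → ∀ x, H.IsRationalPoint ℂ x →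
    (x ∈ (D i).support ↔ x ∈ closure {z | ∃ a : ℂ, a ≠ 0 ∧ H.IsPoint ℂ (idealI m i a) z})
  /-- `D 0` is supported on `Q^m_1 = (x^m, y)`. -/
  supp_zero : ∀ x, H.IsRationalPoint ℂ x →
    (x ∈ (D 0).support ↔ H.IsPoint ℂ (idealQ (coord nodeEq 0) (coord nodeEq 1) m 1) x)
  /-- `D m` is supported on `Q^m_m = (x, y^m)`. -/
  supp_last : ∀ x, H.IsRationalPoint ℂ x →
    (x ∈ (D (Fin.last m)).support ↔
      H.IsPoint ℂ (idealQ (coord nodeEq 0) (coord nodeEq 1) m m) x)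
  /-- Non-consecutive members do not meet. -/
  disjoint : ∀ i j : Fin (m + 1), i.1 + 1 < j.1 → D i ⊔ D j = ⊤
  /-- Consecutive members meet, scheme-theoretically, in a smooth germ … -/
  inter_smooth : ∀ (i : Fin m) (y : (D i.castSucc ⊔ D i.succ).subscheme),
    SmoothAt ((D i.castSucc ⊔ D i.succ).subschemeι ≫ H.str) y
  /-- … of dimension `m - 1` … -/
  inter_dim : ∀ (i : Fin m) (y : (D i.castSucc ⊔ D i.succ).subscheme),
    H.IsRationalPoint ℂ ((D i.castSucc ⊔ D i.succ).subschemeι y) →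
      ringKrullDim ((D i.castSucc ⊔ D i.succ).subscheme.presheaf.stalk y) = ((m - 1 : ℕ) : ℕ∞)
  /-- … supported on the single point `Q^m_{i+1}`. -/
  inter_supp : ∀ (i : Fin m) (x : H.carrier), H.IsRationalPoint ℂ x →
    (x ∈ (D i.castSucc ⊔ D i.succ).support ↔
      H.IsPoint ℂ (idealQ (coord nodeEq 0) (coord nodeEq 1) m (i.1 + 1)) x)
  /-- Near `Q^m_{i+1}`, the Hilbert scheme is `b c = 0` in affine `(m+1)`-space, and `D i`,
  `D (i+1)` are the coordinate hyperplanes `c = 0`, `b = 0`; so they meet transversely. -/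
  local_eq : ∀ i : Fin m, ∃ x : H.carrier,
    H.IsPoint ℂ (idealQ (coord nodeEq 0) (coord nodeEq 1) m (i.1 + 1)) x ∧
    ∃ φ : H.carrier.presheaf.stalk x ≃+* HypersurfaceGerm (m + 1) (eqBC m),
      (∀ a : ℂ, φ (stalkHom H.str x a) = algebraMap ℂ _ a) ∧
      (stalkIdeal (D i.castSucc) x).map (φ : _ →+* _) = Ideal.span {coord (eqBC m) 1} ∧
      (stalkIdeal (D i.succ) x).map (φ : _ →+* _) = Ideal.span {coord (eqBC m) 0}

/-- The total space of the relative Hilbert scheme `H` of the family `x y = t` is smooth of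
dimension `m + 1`, and it is `b c = t` near the points `Q^m_i`. -/
structure IsSmoothTotalSpace {m : ℕ} (H : HilbertScheme BaseGerm PlaneGerm m) : Prop where
  smooth : ∀ x : H.carrier, SmoothAt (H.str ≫ baseStr) x
  /-- The residue field of the base `ℂ[t]_(t)` is `ℂ`, with `t ↦ 0`. -/
  dim : ∀ x : H.carrier, H.IsRationalPoint (IsLocalRing.ResidueField BaseGerm) x →
    ringKrullDim (H.carrier.presheaf.stalk x) = ((m + 1 : ℕ) : ℕ∞)
  /-- The isomorphism of local rings is one over `ℂ[t]`. -/
  local_eq : ∀ i : Fin m, ∃ x : H.carrier,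
    H.IsPoint (IsLocalRing.ResidueField BaseGerm)
      (idealQ (algebraMap _ PlaneGerm (MvPolynomial.X 0 : MvPolynomial (Fin 2) ℂ))
        (algebraMap _ PlaneGerm (MvPolynomial.X 1 : MvPolynomial (Fin 2) ℂ)) m (i.1 + 1)) x ∧
    ∃ φ : H.carrier.presheaf.stalk x ≃+* HypersurfaceGerm (m + 2) (eqBCT m),
      ∀ p : Polynomial ℂ, φ (stalkHom H.str x (algebraMap (Polynomial ℂ) BaseGerm p)) =
        Polynomial.aeval (coord (eqBCT m) (Fin.last (m + 1))) p

end

end NodeHilb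

namespace NodeHilb

noncomputable section

/-! ### The standard charts: monic polynomials and the two equations -/

/-! A length-`m` family over `x y = t` is studied through its possible monomial bases `1, x, …, x^n,
y, …, y^r` with `n + 1 + r = m`; there are `m` of them, and each defines an open chart of the
Hilbert functor. In a chart, expand `y^(r+1)` and `x^(n+1)` in the basis, multiply each expansion by
the other variable and use `x y = t`. Comparing coefficients forces the shape `y P(y) = b Q(x)`, `x
Q(x) = c P(y)`, with `P` and `Q` monic of degrees `r` and `n` and with `b c = t`
(`exists_chartCoord`, `chartCoord_unique`). Conversely, for arbitrary `b, c, P, Q` the algebra with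
these equations and `x y = b c` is free on the monomials, because an explicit module of pairs of
polynomials carries the required action (`linearIndependent_chartAlg`). Hence a chart is the
hypersurface `b c = t`, the remaining coordinates being the `m - 1` coefficients of `P` and `Q`. It
has to be localized at the norms of the polynomials with nonzero constant term, since those are
invertible in the germ (`isUniversal_of_isLocalization`). Over the node this is a localization of `b
c = 0` in affine `(m+1)`-space; for the versal family `t` is eliminated and a localization of affine
`(m+1)`-space remains.

The charts cover: over a field, if `x` is a unit then powers of `x` suffice, and otherwise `t = 0`,
powers of `y` span the quotient by `(x)`, and powers of `x` span `(x)` (`exists_top_le_span_mon`). A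
basis of a fibre spreads out to a neighbourhood (`HilbFamily.exists_isChart`). The locus where a
family of one chart lies in another is where a determinant is invertible (`exists_isChart_iff`), so
the charts glue to a scheme (`exists_hilbAtlas`). Families and morphisms are both Zariski local, and
the glued scheme represents the functor (`HilbAtlas.hilbertScheme`).

For the node, chart `i` (with `r = i`) consists of the hyperplanes `b = 0` and `c = 0`. Distinct
charts meet only if they are adjacent, and at a common point of the charts `i` and `i + 1` the
function `b` of the first and the function `c` of the second do not vanish (`overlap`). So `c = 0`
in chart `i` continues as `b = 0` in chart `i + 1`, and the hyperplanes glue to the closed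
subschemes `strata`. Their chart rings are localizations of polynomial rings (`IsPolyLoc`), which
gives regularity, formal smoothness, dimension and, with the connectedness of the gluing,
integrality. A `ℂ`-point is a subscheme supported at the origin, which forces `P = y^r` and `Q =
x^n` (`eq_axisCoord_of_isChartPoint`). Only the two coordinate axes `b` and `c` are left; their
origin is the point `Q^m_{i+1}` and their other points are the `I^m_i(a)`. -/

/-- The monic polynomial of degree `r` with the given lower coefficients. -/
def monicPoly {S : Type} [CommRing S] {r : ℕ} (p : Fin r → S) : Polynomial S :=
  Polynomial.X ^ r + ∑ k : Fin r, Polynomial.C (p k) * Polynomial.X ^ (k : ℕ)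

/-- The coordinates of the chart of the Hilbert scheme in which the quotient has the basis
`1, x, …, x ^ n, y, …, y ^ r`. -/
@[ext] structure ChartCoord (S : Type) (n r : ℕ) where
  b : S
  c : S
  p : Fin r → S
  q : Fin n → S

/-- The image of chart coordinates under a ring homomorphism. -/
@[simps] def ChartCoord.map {S S' : Type} [CommRing S] [CommRing S'] {n r : ℕ}
    (z : ChartCoord S n r) (f : S →+* S') : ChartCoord S' n r where
  b := f z.b
  c := f z.c
  p := fun k ↦ f (z.p k)
  q := fun k ↦ f (z.q k)

/-- Exchange of the two branches. -/
@[simps] def ChartCoord.swap {S : Type} {n r : ℕ} (z : ChartCoord S n r) : ChartCoord S r n where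
  b := z.c
  c := z.b
  p := z.q
  q := z.p

section Poly

variable {S S' : Type} [CommRing S] [CommRing S'] {n r : ℕ}

lemma degree_fin_sum_lt (p : Fin r → S) :
    (∑ k : Fin r, Polynomial.C (p k) * Polynomial.X ^ (k : ℕ)).degree < (r : WithBot ℕ) :=
  Polynomial.degree_sum_fin_lt p

lemma degree_C_mul_lt {d : Polynomial S} {N : WithBot ℕ} (a : S) (h : d.degree < N) :
    (Polynomial.C a * d).degree < N := by
  rw [← Polynomial.smul_eq_C_mul]
  exact (Polynomial.degree_smul_le a d).trans_lt h

lemma monicPoly_coeff_of_lt (p : Fin r → S) (k : Fin r) : (monicPoly p).coeff k = p k := by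
  have h : (k : ℕ) ≠ r := k.2.ne
  simp [monicPoly, Polynomial.coeff_X_pow, h, Fin.val_inj]

lemma monicPoly_coeff_self (p : Fin r → S) : (monicPoly p).coeff r = 1 := by
  rw [monicPoly, Polynomial.coeff_add, Polynomial.coeff_X_pow_self,
    Polynomial.coeff_eq_zero_of_degree_lt (degree_fin_sum_lt p), add_zero]

lemma degree_monicPoly_lt (p : Fin r → S) : (monicPoly p).degree < ((r + 1 : ℕ) : WithBot ℕ) := by
  refine (Polynomial.degree_add_le _ _).trans_lt (max_lt ?_ ?_)
  · exact (Polynomial.degree_X_pow_le r).trans_lt (by exact_mod_cast Nat.lt_succ_self r)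
  · exact (degree_fin_sum_lt p).trans (by exact_mod_cast Nat.lt_succ_self r)

lemma monicPoly_sub_X_pow (p : Fin r → S) : (monicPoly p - Polynomial.X ^ r).degree < (r : WithBot ℕ) := by
  rw [monicPoly, add_sub_cancel_left]
  exact degree_fin_sum_lt p

lemma monicPoly_injective : Function.Injective (monicPoly : (Fin r → S) → Polynomial S) := by
  intro p p' h
  ext k
  rw [← monicPoly_coeff_of_lt p, h, monicPoly_coeff_of_lt]

/-- Fixes the sign convention: a relation `y^(r+1) = … + y β(y)` is stored through `P = X^r - β`, so
the coordinates are the negatives of the coefficients of `β`. -/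
lemma eq_monicPoly {d : Polynomial S} (hd : d.degree < (r : WithBot ℕ)) :
    Polynomial.X ^ r - d = monicPoly (fun k : Fin r ↦ - d.coeff k) := by
  rw [monicPoly, sub_eq_add_neg]
  congr 1
  ext j
  simp only [Polynomial.coeff_neg, Polynomial.finsetSum_coeff, Polynomial.coeff_C_mul,
    Polynomial.coeff_X_pow]
  by_cases hj : j < r
  · rw [Finset.sum_eq_single (⟨j, hj⟩ : Fin r)]
    · simp
    · intro k _ hk
      have : j ≠ k := fun h ↦ hk (Fin.ext h.symm)
      simp [this]
    · simp
  · rw [Polynomial.coeff_eq_zero_of_degree_lt (hd.trans_le (by exact_mod_cast not_lt.mp hj)),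
      Finset.sum_eq_zero, neg_zero]
    intro k _
    have : j ≠ k := fun h ↦ hj (h ▸ k.2)
    simp [this]

lemma monicPoly_map (f : S →+* S') (p : Fin r → S) :
    (monicPoly p).map f = monicPoly (fun k ↦ f (p k)) := by
  simp [monicPoly, Polynomial.map_sum]

end Poly

/-! ### The two equations of a chart and the span of its monomials. -/

section Relations

variable {S : Type} [CommRing S] {n r : ℕ} {C : Type} [CommRing C] [Algebra S C]

/-- The equation `y P(y) = b Q(x)`. -/
def relF (z : ChartCoord S n r) (X Y : C) : C :=
  Y * Polynomial.aeval Y (monicPoly z.p) - z.b • Polynomial.aeval X (monicPoly z.q)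

/-- The equation `x Q(x) = c P(y)`. -/
def relG (z : ChartCoord S n r) (X Y : C) : C :=
  X * Polynomial.aeval X (monicPoly z.q) - z.c • Polynomial.aeval Y (monicPoly z.p)

lemma map_relF {S' C' : Type} [CommRing S'] [CommRing C'] [Algebra S' C'] (f : S →+* S')
    (g : C →+* C') (h : ∀ s, g (algebraMap S C s) = algebraMap S' C' (f s))
    (z : ChartCoord S n r) (X Y : C) : g (relF z X Y) = relF (z.map f) (g X) (g Y) := by
  have hp (p : Polynomial S) (c : C) :
      g (Polynomial.aeval c p) = Polynomial.aeval (g c) (p.map f) := by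
    rw [Polynomial.aeval_def, Polynomial.aeval_def, Polynomial.eval₂_map, Polynomial.hom_eval₂]
    congr 1
    ext s
    exact h s
  simp only [relF, map_sub, map_mul, hp, monicPoly_map, Algebra.smul_def, h]
  rfl

/-- The equation `relG` for `z` is `relF` for `z.swap` with `x` and `y` exchanged. This symmetry is
used throughout to halve the work. -/
lemma map_relG {S' C' : Type} [CommRing S'] [CommRing C'] [Algebra S' C'] (f : S →+* S')
    (g : C →+* C') (h : ∀ s, g (algebraMap S C s) = algebraMap S' C' (f s))
    (z : ChartCoord S n r) (X Y : C) : g (relG z X Y) = relG (z.map f) (g X) (g Y) :=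
  map_relF f g h z.swap Y X

/-- The family `1, x, …, x ^ n, y, …, y ^ r`. -/
def mon (X Y : C) (n r : ℕ) : Fin (n + 1) ⊕ Fin r → C :=
  Sum.elim (fun j ↦ X ^ (j : ℕ)) (fun k ↦ Y ^ ((k : ℕ) + 1))

/-- The reindexing that exchanges the two branches. -/
def monSwap (n r : ℕ) : Fin (n + 1) ⊕ Fin r → Fin (r + 1) ⊕ Fin n :=
  Sum.elim (Fin.cases (Sum.inl 0) Sum.inr) (fun k ↦ Sum.inl k.succ)

lemma monSwap_monSwap (i : Fin (n + 1) ⊕ Fin r) : monSwap r n (monSwap n r i) = i := by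
  rcases i with j | k
  · refine Fin.cases ?_ (fun j ↦ ?_) j <;> simp [monSwap]
  · simp [monSwap]

lemma mon_monSwap (X Y : C) (i : Fin (n + 1) ⊕ Fin r) :
    mon Y X r n (monSwap n r i) = mon X Y n r i := by
  rcases i with j | k
  · refine Fin.cases ?_ (fun j ↦ ?_) j <;> simp [monSwap, mon]
  · simp [monSwap, mon]

/-- `monSwap` as an equivalence. -/
def monSwapEquiv (n r : ℕ) : Fin (n + 1) ⊕ Fin r ≃ Fin (r + 1) ⊕ Fin n where
  toFun := monSwap n r
  invFun := monSwap r n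
  left_inv := monSwap_monSwap
  right_inv := monSwap_monSwap

lemma linearIndependent_mon_swap {X Y : C} (h : LinearIndependent S (mon X Y n r)) :
    LinearIndependent S (mon Y X r n) := by
  rw [← linearIndependent_equiv (monSwapEquiv n r)]
  convert h using 1
  ext i
  exact mon_monSwap X Y i

lemma range_mon_swap (X Y : C) : Set.range (mon Y X r n) = Set.range (mon X Y n r) := by
  rw [← (monSwapEquiv n r).surjective.range_comp]
  congr 1
  ext i
  exact mon_monSwap X Y i

lemma aeval_eq_sum_fin {d : Polynomial S} (hd : d.degree < (r : WithBot ℕ)) (c : C) :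
    Polynomial.aeval c d = ∑ k : Fin r, d.coeff k • c ^ (k : ℕ) := by
  rw [Polynomial.aeval_def, Polynomial.eval₂_eq_sum,
    ← Polynomial.sum_fin (fun i a ↦ algebraMap S C a * c ^ i) (by simp) hd]
  simp [Algebra.smul_def]

/-- A combination of the monomials is written as `a(x) + y d(y)`, with the constant term kept in the
`x` part. In this form independence becomes a statement about polynomials of bounded degree, and
coefficients can be compared inside `Polynomial S`. -/
lemma eq_zero_of_linearIndependent_mon {X Y : C} (h : LinearIndependent S (mon X Y n r))
    {a d : Polynomial S} (ha : a.degree < ((n + 1 : ℕ) : WithBot ℕ)) (hd : d.degree < (r : WithBot ℕ))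
    (h0 : Polynomial.aeval X a + Y * Polynomial.aeval Y d = 0) : a = 0 ∧ d = 0 := by
  rw [Fintype.linearIndependent_iff] at h
  have := h (Sum.elim (fun j ↦ a.coeff j) (fun k ↦ d.coeff k)) (by
    rw [Fintype.sum_sum_type, ← h0, aeval_eq_sum_fin ha, aeval_eq_sum_fin hd, Finset.mul_sum]
    simp [mon, pow_succ'])
  constructor
  · ext j
    by_cases hj : j < n + 1
    · exact this (Sum.inl ⟨j, hj⟩)
    · exact Polynomial.coeff_eq_zero_of_degree_lt (ha.trans_le (by exact_mod_cast not_lt.mp hj))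
  · ext j
    by_cases hj : j < r
    · exact this (Sum.inr ⟨j, hj⟩)
    · exact Polynomial.coeff_eq_zero_of_degree_lt (hd.trans_le (by exact_mod_cast not_lt.mp hj))

lemma mem_span_mon {X Y : C} {v : C} : v ∈ Submodule.span S (Set.range (mon X Y n r)) ↔
    ∃ a d : Polynomial S, a.degree < ((n + 1 : ℕ) : WithBot ℕ) ∧ d.degree < (r : WithBot ℕ) ∧
      v = Polynomial.aeval X a + Y * Polynomial.aeval Y d := by
  constructor
  · intro h
    obtain ⟨g, rfl⟩ := (Submodule.mem_span_range_iff_exists_fun S).mp h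
    refine ⟨_, _, degree_fin_sum_lt (fun j ↦ g (Sum.inl j)),
      degree_fin_sum_lt (fun k ↦ g (Sum.inr k)), ?_⟩
    rw [Fintype.sum_sum_type]
    simp [mon, map_sum, Finset.mul_sum, Algebra.smul_def, pow_succ', mul_left_comm]
  · rintro ⟨a, d, ha, hd, rfl⟩
    rw [aeval_eq_sum_fin ha, aeval_eq_sum_fin hd, Finset.mul_sum]
    refine add_mem (sum_mem fun j _ ↦ Submodule.smul_mem _ _ (Submodule.subset_span
      ⟨Sum.inl j, rfl⟩)) (sum_mem fun k _ ↦ ?_)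
    rw [mul_smul_comm, ← pow_succ']
    exact Submodule.smul_mem _ _ (Submodule.subset_span ⟨Sum.inr k, rfl⟩)

/-- Write `α = b X^n + α'` and multiply the expansion of `y^(r+1)` by `x`. With `x y = t` and the
expansion of `x^(n+1)` this becomes `b γ(y) + t β(y) - t y^r + x (b δ(x) + α'(x)) = 0`, a relation
among the monomials. Its `y^r` coefficient gives `b c = t`, where `c` is the top coefficient of `γ`,
and its `x` part gives `α = b (X^n - δ)`. -/
lemma chart_relation_aux {t : S} {X Y : C} (hXY : X * Y = algebraMap S C t)
    (h : LinearIndependent S (mon X Y n r)) {α β γ δ : Polynomial S}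
    (hα : α.degree < ((n + 1 : ℕ) : WithBot ℕ)) (hβ : β.degree < (r : WithBot ℕ))
    (hγ : γ.degree < ((r + 1 : ℕ) : WithBot ℕ)) (hδ : δ.degree < (n : WithBot ℕ))
    (hY : Y ^ (r + 1) = Polynomial.aeval X α + Y * Polynomial.aeval Y β)
    (hX : X ^ (n + 1) = Polynomial.aeval Y γ + X * Polynomial.aeval X δ) :
    α.coeff n * γ.coeff r = t ∧
      α = Polynomial.C (α.coeff n) * (Polynomial.X ^ n - δ) := by
  set b := α.coeff n with hb
  set α' := α - Polynomial.C b * Polynomial.X ^ n with hα'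
  have dα' : α'.degree < n := by
    rw [Polynomial.degree_lt_iff_coeff_zero]
    intro j hj
    rcases hj.eq_or_lt with rfl | hj
    · simp [hα', hb]
    · have : α.coeff j = 0 := Polynomial.coeff_eq_zero_of_degree_lt
        (hα.trans_le (by exact_mod_cast hj))
      simp [hα', this, Polynomial.coeff_X_pow, hj.ne']
  have key : Polynomial.aeval Y (Polynomial.C b * γ + Polynomial.C t * β
      - Polynomial.C t * Polynomial.X ^ r) +
      X * Polynomial.aeval X (Polynomial.C b * δ + α') = 0 := by
    have h1 : X * Y ^ (r + 1) = algebraMap S C t * Y ^ r := by rw [pow_succ', ← mul_assoc, hXY]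
    have h2 : Polynomial.aeval X α = algebraMap S C b * X ^ n + Polynomial.aeval X α' := by
      simp [hα']
    rw [hY, h2] at h1
    simp only [map_add, map_sub, map_mul, Polynomial.aeval_C, map_pow, Polynomial.aeval_X]
    have h3 : algebraMap S C b * X ^ (n + 1) = algebraMap S C b * (Polynomial.aeval Y γ +
      X * Polynomial.aeval X δ) := by rw [hX]
    rw [pow_succ] at h3
    linear_combination h1 - h3 - (Polynomial.aeval Y β) * hXY
  have d1 : (Polynomial.C b * γ + Polynomial.C t * β - Polynomial.C t * Polynomial.X ^ r).degree <
      ((r + 1 : ℕ) : WithBot ℕ) := by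
    have hr : ((r : ℕ) : WithBot ℕ) < ((r + 1 : ℕ) : WithBot ℕ) := by
      exact_mod_cast Nat.lt_succ_self r
    refine (Polynomial.degree_sub_le _ _).trans_lt (max_lt
      ((Polynomial.degree_add_le _ _).trans_lt (max_lt ?_ ?_)) ?_)
    · exact degree_C_mul_lt _ hγ
    · exact degree_C_mul_lt _ (hβ.trans hr)
    · exact (Polynomial.degree_C_mul_X_pow_le _ _).trans_lt hr
  have d2 : (Polynomial.C b * δ + α').degree < n :=
    (Polynomial.degree_add_le _ _).trans_lt (max_lt
      (degree_C_mul_lt _ hδ) dα')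
  obtain ⟨e1, e2⟩ := eq_zero_of_linearIndependent_mon (linearIndependent_mon_swap h) d1 d2 key
  constructor
  · have := congrArg (fun p ↦ Polynomial.coeff p r) e1
    simp only [Polynomial.coeff_sub, Polynomial.coeff_add, Polynomial.coeff_C_mul,
      Polynomial.coeff_eq_zero_of_degree_lt hβ, Polynomial.coeff_X_pow_self,
      Polynomial.coeff_zero] at this
    linear_combination this
  · linear_combination e2 + hα'

/-- If the monomials are independent and span `x ^ (n + 1)` and `y ^ (r + 1)`, then the algebra
satisfies the equations of the chart. -/
theorem exists_chartCoord {t : S} {X Y : C} (hXY : X * Y = algebraMap S C t)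
    (h : LinearIndependent S (mon X Y n r))
    (hX : X ^ (n + 1) ∈ Submodule.span S (Set.range (mon X Y n r)))
    (hY : Y ^ (r + 1) ∈ Submodule.span S (Set.range (mon X Y n r))) :
    ∃ z : ChartCoord S n r, z.b * z.c = t ∧ relF z X Y = 0 ∧ relG z X Y = 0 := by
  obtain ⟨α, β, hα, hβ, eY⟩ := mem_span_mon.mp hY
  rw [← range_mon_swap] at hX
  obtain ⟨γ, δ, hγ, hδ, eX⟩ := mem_span_mon.mp hX
  obtain ⟨ht, e1⟩ := chart_relation_aux hXY h hα hβ hγ hδ eY eX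
  -- With the branches exchanged, the same computation identifies `γ` as `c (X^r - β)`; the product
  -- formula is already known.
  obtain ⟨-, e2⟩ := chart_relation_aux (by rw [mul_comm, hXY]) (linearIndependent_mon_swap h)
    hγ hδ hα hβ eX eY
  refine ⟨⟨α.coeff n, γ.coeff r, fun k ↦ -β.coeff k, fun k ↦ -δ.coeff k⟩, ht, ?_, ?_⟩
  · rw [relF, ← eq_monicPoly hβ, ← eq_monicPoly hδ]
    have := congrArg (Polynomial.aeval X) e1
    simp only [map_sub, map_mul, map_pow, Polynomial.aeval_C, Polynomial.aeval_X] at this ⊢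
    rw [Algebra.smul_def]
    linear_combination eY + this
  · rw [relG, ← eq_monicPoly hβ, ← eq_monicPoly hδ]
    have := congrArg (Polynomial.aeval Y) e2
    simp only [map_sub, map_mul, map_pow, Polynomial.aeval_C, Polynomial.aeval_X] at this ⊢
    rw [Algebra.smul_def]
    linear_combination eX + this

/-- Subtracting the two equations gives `(b' Q' - b Q)(x) + y (P - P')(y) = 0`, and the leading
terms of `P` and `P'` cancel, so the degrees are those of basis monomials. Hence `P = P'` and `b Q =
b' Q'`, and leading coefficients give `b = b'`. Since `b` may vanish, `Q` has to be recovered from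
the other equation. -/
lemma chartCoord_unique_aux {X Y : C} (h : LinearIndependent S (mon X Y n r))
    {z z' : ChartCoord S n r} (hF : relF z X Y = 0) (hF' : relF z' X Y = 0) :
    z.b = z'.b ∧ z.p = z'.p := by
  have d1 : (Polynomial.C z'.b * monicPoly z'.q - Polynomial.C z.b * monicPoly z.q).degree <
      ((n + 1 : ℕ) : WithBot ℕ) := by
    refine (Polynomial.degree_sub_le _ _).trans_lt (max_lt ?_ ?_) <;>
    exact degree_C_mul_lt _ (degree_monicPoly_lt _)
  have d2 : (monicPoly z.p - monicPoly z'.p).degree < r := by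
    rw [← sub_sub_sub_cancel_right _ _ (Polynomial.X ^ r)]
    exact (Polynomial.degree_sub_le _ _).trans_lt (max_lt (monicPoly_sub_X_pow _)
      (monicPoly_sub_X_pow _))
  obtain ⟨e1, e2⟩ := eq_zero_of_linearIndependent_mon h d1 d2 (by
    simp only [relF, Algebra.smul_def] at hF hF'
    simp only [map_sub, map_mul, Polynomial.aeval_C]
    linear_combination hF - hF')
  refine ⟨?_, monicPoly_injective (sub_eq_zero.mp e2)⟩
  have := congrArg (fun p ↦ Polynomial.coeff p n) e1
  simp only [Polynomial.coeff_sub, Polynomial.coeff_C_mul, monicPoly_coeff_self,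
    Polynomial.coeff_zero] at this
  linear_combination -this

theorem chartCoord_unique {X Y : C} (h : LinearIndependent S (mon X Y n r))
    {z z' : ChartCoord S n r} (hF : relF z X Y = 0) (hF' : relF z' X Y = 0)
    (hG : relG z X Y = 0) (hG' : relG z' X Y = 0) : z = z' := by
  obtain ⟨h1, h2⟩ := chartCoord_unique_aux h hF hF'
  obtain ⟨h3, h4⟩ := chartCoord_unique_aux (linearIndependent_mon_swap h)
    (z := z.swap) (z' := z'.swap) hG hG'
  exact ChartCoord.ext h1 h3 h2 h4

/-- Multiplication by `x` shifts `x^j` for `j < n`, sends `y^(k+1)` to `t y^k`, and on `x^n` the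
second equation replaces `x^(n+1)` by `c P(y) + x (x^n - Q(x))`. -/
lemma mul_mem_span_mon {t : S} {X Y : C} (hXY : X * Y = algebraMap S C t) {z : ChartCoord S n r}
    (hG : relG z X Y = 0) {v : C} (hv : v ∈ Submodule.span S (Set.range (mon X Y n r))) :
    X * v ∈ Submodule.span S (Set.range (mon X Y n r)) := by
  refine Submodule.span_induction ?_ (by simp) (fun u w _ _ hu hw ↦ ?_) (fun a u _ hu ↦ ?_) hv
  · rintro _ ⟨j | k, rfl⟩
    · by_cases hj : (j : ℕ) < n
      · exact Submodule.subset_span ⟨Sum.inl ⟨j + 1, by omega⟩, by simp [mon, pow_succ']⟩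
      · have hj : (j : ℕ) = n := by omega
        rw [← range_mon_swap, mem_span_mon]
        refine ⟨Polynomial.C z.c * monicPoly z.p, Polynomial.X ^ n - monicPoly z.q,
          degree_C_mul_lt _ (degree_monicPoly_lt _), ?_, ?_⟩
        · rw [← Polynomial.degree_neg, neg_sub]
          exact monicPoly_sub_X_pow _
        · simp only [mon, Sum.elim_inl, hj, map_mul, map_sub, Polynomial.aeval_C, map_pow,
            Polynomial.aeval_X]
          rw [relG, Algebra.smul_def] at hG
          linear_combination hG
    · have : X * mon X Y n r (Sum.inr k) = t • Y ^ (k : ℕ) := by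
        simp only [mon, Sum.elim_inr]
        rw [pow_succ', ← mul_assoc, hXY, Algebra.smul_def]
      rw [this]
      refine Submodule.smul_mem _ _ ?_
      rw [← range_mon_swap]
      exact Submodule.subset_span ⟨Sum.inl k.castSucc, by simp [mon]⟩
  · rw [mul_add]
    exact add_mem hu hw
  · rw [mul_smul_comm]
    exact Submodule.smul_mem _ _ hu

/-- In an algebra that satisfies the equations of the chart, the monomials span the subalgebra
generated by `x` and `y`. -/
theorem adjoin_le_span_mon {t : S} {X Y : C} (hXY : X * Y = algebraMap S C t)
    {z : ChartCoord S n r} (hF : relF z X Y = 0) (hG : relG z X Y = 0) :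
    Subalgebra.toSubmodule (Algebra.adjoin S {X, Y}) ≤
      Submodule.span S (Set.range (mon X Y n r)) := by
  have key : ∀ a ∈ Algebra.adjoin S {X, Y}, ∀ v ∈ Submodule.span S (Set.range (mon X Y n r)),
      a * v ∈ Submodule.span S (Set.range (mon X Y n r)) := by
    intro a ha
    refine Algebra.adjoin_induction ?_ (fun s v hv ↦ ?_) (fun a b _ _ ha hb v hv ↦ ?_)
      (fun a b _ _ ha hb v hv ↦ ?_) ha
    · rintro _ (rfl | rfl) v hv
      · exact mul_mem_span_mon hXY hG hv
      · rw [← range_mon_swap] at hv ⊢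
        exact mul_mem_span_mon (z := z.swap) (by rw [mul_comm, hXY]) hF hv
    · rw [← Algebra.smul_def]
      exact Submodule.smul_mem _ _ hv
    · rw [add_mul]
      exact add_mem (ha v hv) (hb v hv)
    · rw [mul_assoc]
      exact ha _ (hb v hv)
  intro a ha
  rw [← mul_one a]
  exact key a ha 1 (Submodule.subset_span ⟨Sum.inl 0, by simp [mon]⟩)

end Relations

end

end NodeHilb


namespace NodeHilb

noncomputable section

/-! ### The standard module of a chart -/

section StandardModule

variable {S : Type} [CommRing S]

/-- Multiplication by `x` on the standard module of a chart; its elements are pairs of polynomials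
in `x` and in `y` with the same constant term. -/
def opX (n : ℕ) (c t : S) (P Q : Polynomial S) :
    Module.End S (Polynomial S × Polynomial S) where
  -- The top coefficient of the `x` part would produce `x^(n+1)`, which is replaced by `x (x^n - Q)
  -- + c P`; a term `y^(k+1)` goes to `t y^k`, which is `divX`. The constant added to the first
  -- entry restores the equality of the two constant terms.
  toFun v := (Polynomial.X * (v.1 - Polynomial.C (v.1.coeff n) * Q) +
      Polynomial.C (v.1.coeff n * c * P.coeff 0 + t * v.2.coeff 1),
    Polynomial.C (v.1.coeff n * c) * P + Polynomial.C t * v.2.divX)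
  map_add' v w := by
    ext1
    · simp only [Prod.fst_add, Prod.snd_add, Polynomial.coeff_add, map_add, map_mul]
      ring
    · simp only [Prod.fst_add, Prod.snd_add, Polynomial.coeff_add, map_add, map_mul,
        Polynomial.divX_add]
      ring
  map_smul' s v := by
    ext1
    · simp only [Prod.smul_fst, Prod.smul_snd, map_add, map_mul, RingHom.id_apply,
        Polynomial.smul_eq_C_mul, Polynomial.coeff_C_mul]
      ring
    · simp only [Prod.smul_fst, Prod.smul_snd, map_mul, RingHom.id_apply,
        Polynomial.smul_eq_C_mul, Polynomial.divX_C_mul, Polynomial.coeff_C_mul]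
      ring

/-- The standard module of a chart. -/
def stdModule (S : Type) [CommRing S] (n r : ℕ) : Submodule S (Polynomial S × Polynomial S) where
  carrier := {v | v.1.degree < ((n + 1 : ℕ) : WithBot ℕ) ∧ v.2.degree < ((r + 1 : ℕ) : WithBot ℕ) ∧
    v.1.coeff 0 = v.2.coeff 0}
  add_mem' := fun {v w} hv hw ↦ ⟨(Polynomial.degree_add_le _ _).trans_lt (max_lt hv.1 hw.1),
    (Polynomial.degree_add_le _ _).trans_lt (max_lt hv.2.1 hw.2.1), by
      simp [hv.2.2, hw.2.2]⟩
  zero_mem' := ⟨by simp, by simp, by simp⟩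
  smul_mem' := fun s v hv ↦ ⟨(Polynomial.degree_smul_le _ _).trans_lt hv.1,
    (Polynomial.degree_smul_le _ _).trans_lt hv.2.1, by simp [hv.2.2]⟩

lemma swap_mem_stdModule {n r : ℕ} {v : Polynomial S × Polynomial S} (hv : v ∈ stdModule S n r) :
    v.swap ∈ stdModule S r n := ⟨hv.2.1, hv.1, hv.2.2.symm⟩

/-- As `Q` is monic of degree `n`, subtracting the multiple of `Q` removes the `x^n` term, so that
multiplication by `x` stays within degree `n`. -/
lemma opX_mem {n r : ℕ} (z : ChartCoord S n r) {v : Polynomial S × Polynomial S}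
    (hv : v ∈ stdModule S n r) :
    opX n z.c (z.b * z.c) (monicPoly z.p) (monicPoly z.q) v ∈ stdModule S n r := by
  obtain ⟨h1, h2, h3⟩ := hv
  have h0 (N : ℕ) : ((0 : ℕ) : WithBot ℕ) < ((N + 1 : ℕ) : WithBot ℕ) := by
    exact_mod_cast Nat.succ_pos N
  refine ⟨?_, ?_, ?_⟩
  · refine (Polynomial.degree_add_le _ _).trans_lt (max_lt ?_
      (Polynomial.degree_C_le.trans_lt (h0 n)))
    rw [Polynomial.degree_lt_iff_coeff_zero]
    intro j hj
    obtain ⟨j, rfl⟩ := Nat.exists_eq_succ_of_ne_zero (by omega : j ≠ 0)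
    rw [Polynomial.coeff_X_mul, Polynomial.coeff_sub, Polynomial.coeff_C_mul]
    rcases (Nat.succ_le_succ_iff.mp hj).eq_or_lt with rfl | hj
    · rw [monicPoly_coeff_self, mul_one, sub_self]
    · rw [Polynomial.coeff_eq_zero_of_degree_lt (h1.trans_le (by exact_mod_cast hj)),
        Polynomial.coeff_eq_zero_of_degree_lt ((degree_monicPoly_lt z.q).trans_le
          (by exact_mod_cast hj)), mul_zero, sub_zero]
  · refine (Polynomial.degree_add_le _ _).trans_lt (max_lt
      (degree_C_mul_lt _ (degree_monicPoly_lt _)) (degree_C_mul_lt _ ?_))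
    rw [Polynomial.degree_lt_iff_coeff_zero] at h2 ⊢
    intro j hj
    rw [Polynomial.coeff_divX]
    exact h2 _ (by omega)
  · simp [opX, Polynomial.coeff_divX]

/-- Multiplication by `x` as an endomorphism of the standard module. -/
def stdX {n r : ℕ} (z : ChartCoord S n r) : Module.End S (stdModule S n r) :=
  (opX n z.c (z.b * z.c) (monicPoly z.p) (monicPoly z.q)).restrict fun _ ↦ opX_mem z

/-- The exchange of the two branches on the standard module. -/
def stdSwap (S : Type) [CommRing S] (n r : ℕ) : stdModule S n r →ₗ[S] stdModule S r n :=
  ((LinearEquiv.prodComm S (Polynomial S) (Polynomial S)).toLinearMap).restrict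
    fun _ ↦ swap_mem_stdModule

lemma stdSwap_coe {n r : ℕ} (v : stdModule S n r) : (stdSwap S n r v).1 = v.1.swap := rfl

/-- Multiplication by `y` as an endomorphism of the standard module. -/
def stdY {n r : ℕ} (z : ChartCoord S n r) : Module.End S (stdModule S n r) :=
  stdSwap S r n ∘ₗ stdX z.swap ∘ₗ stdSwap S n r

lemma stdX_coe {n r : ℕ} (z : ChartCoord S n r) (v : stdModule S n r) :
    (stdX z v).1 = opX n z.c (z.b * z.c) (monicPoly z.p) (monicPoly z.q) v.1 := rfl

lemma stdY_coe {n r : ℕ} (z : ChartCoord S n r) (v : stdModule S n r) :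
    (stdY z v).1 = (opX r z.b (z.c * z.b) (monicPoly z.q) (monicPoly z.p) v.1.swap).swap := rfl

lemma divX_X_mul (d : Polynomial S) : (Polynomial.X * d).divX = d := by
  ext j
  rw [Polynomial.coeff_divX, Polynomial.coeff_X_mul]

/-- This is the whole commutation check: `y x` acts as the scalar `b c`, and exchanging the branches
turns this into the same statement for `x y`. -/
lemma stdY_stdX {n r : ℕ} (z : ChartCoord S n r) (v : stdModule S n r) :
    stdY z (stdX z v) = (z.b * z.c) • v := by
  obtain ⟨⟨a, e⟩, h1, h2, h3⟩ := v
  simp only at h1 h2 h3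
  have hr : e.coeff (r + 1) = 0 := Polynomial.coeff_eq_zero_of_degree_lt h2
  have key : (monicPoly z.p).coeff r = 1 := monicPoly_coeff_self _
  ext1
  rw [stdY_coe, stdX_coe]
  simp only [opX, LinearMap.coe_mk, AddHom.coe_mk, Prod.swap, Submodule.coe_smul_of_tower,
    Prod.smul_mk, Polynomial.coeff_add, Polynomial.coeff_C_mul, Polynomial.coeff_divX, key, hr,
    mul_one, mul_zero, add_zero, Polynomial.divX_add, divX_X_mul, Polynomial.divX_C]
  ext1
  · simp only [Polynomial.smul_eq_C_mul, map_mul]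
    ring
  · have he : Polynomial.X * e.divX = e - Polynomial.C (a.coeff 0) := by
      rw [h3, eq_sub_iff_add_eq]
      exact Polynomial.X_mul_divX_add e
    have c2 : (Polynomial.X * (a - Polynomial.C (a.coeff n) * monicPoly z.q)).coeff 1 =
        a.coeff 0 - a.coeff n * (monicPoly z.q).coeff 0 := by
      rw [← zero_add 1, Polynomial.coeff_X_mul]
      simp
    have c3 (s : S) : (Polynomial.C s).coeff 1 = 0 := Polynomial.coeff_C_of_ne_zero one_ne_zero
    simp only [Polynomial.smul_eq_C_mul, c2, c3]
    simp only [map_mul, map_add, map_sub, map_zero]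
    linear_combination Polynomial.C z.b * Polynomial.C z.c * he

lemma stdX_stdY {n r : ℕ} (z : ChartCoord S n r) (v : stdModule S n r) :
    stdX z (stdY z v) = (z.b * z.c) • v := by
  have h := stdY_stdX z.swap (stdSwap S n r v)
  have h2 : stdSwap S r n (stdY z.swap (stdX z.swap (stdSwap S n r v))) = stdX z (stdY z v) := rfl
  rw [← h2, h, map_smul, mul_comm]
  rfl

/-- The unit of the standard module. -/
def stdOne (S : Type) [CommRing S] (n r : ℕ) : stdModule S n r :=
  ⟨(1, 1), by
    have h0 (N : ℕ) : ((0 : ℕ) : WithBot ℕ) < ((N + 1 : ℕ) : WithBot ℕ) := by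
      exact_mod_cast Nat.succ_pos N
    exact ⟨Polynomial.degree_one_le.trans_lt (h0 n), Polynomial.degree_one_le.trans_lt (h0 r),
      rfl⟩⟩

/-- The entry `0 ^ j` is the constant term shared by the two branches: `1` for `j = 0` and `0`
otherwise. Up to exponent `n` no reduction takes place. -/
lemma stdX_pow_stdOne {n r : ℕ} (z : ChartCoord S n r) {j : ℕ} (hj : j ≤ n) :
    ((stdX z ^ j) (stdOne S n r)).1 = (Polynomial.X ^ j, Polynomial.C (0 ^ j)) := by
  induction j with
  | zero => simp [stdOne]
  | succ j ih =>
    rw [pow_succ', Module.End.mul_apply, stdX_coe, ih (by omega)]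
    have h1 : (Polynomial.X ^ j : Polynomial S).coeff n = 0 := by
      rw [Polynomial.coeff_X_pow, if_neg (by omega)]
    have h2 : (Polynomial.C ((0 : S) ^ j)).coeff 1 = 0 := Polynomial.coeff_C_of_ne_zero one_ne_zero
    simp only [opX, LinearMap.coe_mk, AddHom.coe_mk, h1, h2, Polynomial.divX_C]
    simp [pow_succ']

lemma aeval_stdX_stdOne {n r : ℕ} (z : ChartCoord S n r) {d : Polynomial S}
    (hd : d.degree < ((n + 1 : ℕ) : WithBot ℕ)) :
    (Polynomial.aeval (stdX z) d (stdOne S n r)).1 = (d, Polynomial.C (d.coeff 0)) := by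
  have h1 : Polynomial.aeval (stdX z) d = ∑ k : Fin (n + 1), d.coeff k • stdX z ^ (k : ℕ) := by
    rw [Polynomial.aeval_def, Polynomial.eval₂_eq_sum,
      ← Polynomial.sum_fin (fun i a ↦ algebraMap S _ a * stdX z ^ i) (by simp) hd]
    simp [Algebra.smul_def]
  have h2 : d = ∑ k : Fin (n + 1), Polynomial.monomial k (d.coeff k) := by
    conv_lhs => rw [← Polynomial.sum_monomial_eq d]
    exact (Polynomial.sum_fin (fun i a ↦ Polynomial.monomial i a) (by simp) hd).symm
  rw [h1, LinearMap.sum_apply, Submodule.coe_sum]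
  ext1
  · rw [Prod.fst_sum]
    conv_rhs => rw [h2]
    refine Finset.sum_congr rfl fun k _ ↦ ?_
    rw [LinearMap.smul_apply, Submodule.coe_smul, stdX_pow_stdOne z (by omega), Prod.smul_fst,
      Polynomial.smul_eq_C_mul, Polynomial.C_mul_X_pow_eq_monomial]
  · rw [Prod.snd_sum, Finset.sum_eq_single 0]
    · rw [LinearMap.smul_apply, Submodule.coe_smul, stdX_pow_stdOne z (by omega)]
      simp [Polynomial.smul_eq_C_mul]
    · intro k _ hk
      have : (k : ℕ) ≠ 0 := fun h ↦ hk (Fin.ext h)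
      rw [LinearMap.smul_apply, Submodule.coe_smul, stdX_pow_stdOne z (by omega)]
      simp [this]
    · simp

lemma stdSwap_stdOne (n r : ℕ) : stdSwap S n r (stdOne S n r) = stdOne S r n := rfl

lemma stdY_pow {n r : ℕ} (z : ChartCoord S n r) (j : ℕ) (v : stdModule S n r) :
    (stdY z ^ j) v = stdSwap S r n ((stdX z.swap ^ j) (stdSwap S n r v)) := by
  induction j with
  | zero => rfl
  | succ j ih =>
    rw [pow_succ', pow_succ', Module.End.mul_apply, ih]
    rfl

lemma aeval_stdY {n r : ℕ} (z : ChartCoord S n r) (d : Polynomial S) (v : stdModule S n r) :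
    Polynomial.aeval (stdY z) d v =
      stdSwap S r n (Polynomial.aeval (stdX z.swap) d (stdSwap S n r v)) := by
  induction d using Polynomial.induction_on' with
  | add p q hp hq => simp [hp, hq]
  | monomial j a => simp [Polynomial.aeval_monomial, Module.algebraMap_end_apply, stdY_pow]

/-- Only the unit vector matters: a multiple of an equation acts as the equation followed by another
operator, so evaluation at the unit kills the whole ideal of the chart as soon as it kills its
generators. -/
lemma stdY_relation {n r : ℕ} (z : ChartCoord S n r) :
    stdY z (Polynomial.aeval (stdY z) (monicPoly z.p) (stdOne S n r)) =
      z.b • Polynomial.aeval (stdX z) (monicPoly z.q) (stdOne S n r) := by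
  ext1
  rw [stdY_coe, aeval_stdY, stdSwap_stdOne, stdSwap_coe,
    aeval_stdX_stdOne (n := r) z.swap (degree_monicPoly_lt _), Submodule.coe_smul,
    aeval_stdX_stdOne (n := n) z (degree_monicPoly_lt _)]
  have h2 (s : S) : (Polynomial.C s).coeff 1 = 0 := Polynomial.coeff_C_of_ne_zero one_ne_zero
  simp only [opX, LinearMap.coe_mk, AddHom.coe_mk, Prod.swap, h2, Polynomial.divX_C,
    monicPoly_coeff_self]
  ext1
  · simp [Polynomial.smul_eq_C_mul]
  · simp [Polynomial.smul_eq_C_mul]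

lemma stdX_relation {n r : ℕ} (z : ChartCoord S n r) :
    stdX z (Polynomial.aeval (stdX z) (monicPoly z.q) (stdOne S n r)) =
      z.c • Polynomial.aeval (stdY z) (monicPoly z.p) (stdOne S n r) := by
  have h := congrArg (stdSwap S r n) (stdY_relation z.swap)
  rw [map_smul, aeval_stdY] at h
  rw [aeval_stdY z]
  exact h

end StandardModule

/-! ### The algebra of a chart -/

section ChartAlg

variable {S : Type} [CommRing S] {n r : ℕ}

/-- The ideal of the equations of a chart in `S[x, y]`. -/
def chartIdeal (z : ChartCoord S n r) : Ideal (MvPolynomial (Fin 2) S) :=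
  Ideal.span {MvPolynomial.X 0 * MvPolynomial.X 1 - MvPolynomial.C (z.b * z.c),
    relF z (MvPolynomial.X 0) (MvPolynomial.X 1), relG z (MvPolynomial.X 0) (MvPolynomial.X 1)}

/-- The `S`-algebra `S[x, y] / (x y - b c, y P(y) - b Q(x), x Q(x) - c P(y))`. -/
abbrev ChartAlg (z : ChartCoord S n r) : Type := MvPolynomial (Fin 2) S ⧸ chartIdeal z

/-- The class of `x`. -/
def ChartAlg.x (z : ChartCoord S n r) : ChartAlg z := Ideal.Quotient.mk _ (MvPolynomial.X 0)

/-- The class of `y`. -/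
def ChartAlg.y (z : ChartCoord S n r) : ChartAlg z := Ideal.Quotient.mk _ (MvPolynomial.X 1)

lemma ChartAlg.x_mul_y (z : ChartCoord S n r) :
    ChartAlg.x z * ChartAlg.y z = algebraMap S _ (z.b * z.c) := by
  have h : MvPolynomial.X 0 * MvPolynomial.X 1 - MvPolynomial.C (z.b * z.c) ∈ chartIdeal z :=
    Ideal.subset_span (by simp)
  exact Ideal.Quotient.eq.mpr h

lemma ChartAlg.relF_eq (z : ChartCoord S n r) : relF z (ChartAlg.x z) (ChartAlg.y z) = 0 := by
  have h : relF z (MvPolynomial.X 0) (MvPolynomial.X 1) ∈ chartIdeal z :=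
    Ideal.subset_span (by simp)
  rw [← Ideal.Quotient.eq_zero_iff_mem, map_relF (RingHom.id S)
    (Ideal.Quotient.mk (chartIdeal z)) (fun s ↦ rfl)] at h
  exact h

lemma ChartAlg.relG_eq (z : ChartCoord S n r) : relG z (ChartAlg.x z) (ChartAlg.y z) = 0 := by
  have h : relG z (MvPolynomial.X 0) (MvPolynomial.X 1) ∈ chartIdeal z :=
    Ideal.subset_span (by simp)
  rw [← Ideal.Quotient.eq_zero_iff_mem, map_relG (RingHom.id S)
    (Ideal.Quotient.mk (chartIdeal z)) (fun s ↦ rfl)] at h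
  exact h

lemma ChartAlg.adjoin_eq_top (z : ChartCoord S n r) :
    Algebra.adjoin S {ChartAlg.x z, ChartAlg.y z} = ⊤ := by
  rw [eq_top_iff]
  rintro a -
  obtain ⟨f, rfl⟩ := Ideal.Quotient.mk_surjective a
  induction f using MvPolynomial.induction_on with
  | C s => exact Subalgebra.algebraMap_mem _ s
  | add p q hp hq => rw [map_add]; exact add_mem hp hq
  | mul_X p i hp =>
    rw [map_mul]
    refine mul_mem hp (Algebra.subset_adjoin ?_)
    fin_cases i
    · exact Or.inl rfl
    · exact Or.inr rfl

-- Polynomial evaluation needs a commutative target. Two commuting elements generate a commutative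
-- subalgebra, and the evaluation takes place there.
open scoped IsMulCommutative in
lemma exists_aeval_of_commute {A : Type} [Ring A] [Algebra S A] {x y : A} (hc : x * y = y * x) :
    ∃ g : MvPolynomial (Fin 2) S →ₐ[S] A, g (MvPolynomial.X 0) = x ∧ g (MvPolynomial.X 1) = y := by
  have : IsMulCommutative (Algebra.adjoin S ({x, y} : Set A)) :=
    Algebra.isMulCommutative_adjoin S (by
      rintro _ (rfl | rfl) _ (rfl | rfl)
      · rfl
      · exact hc
      · exact hc.symm
      · rfl)
  let g : MvPolynomial (Fin 2) S →ₐ[S] Algebra.adjoin S ({x, y} : Set A) := MvPolynomial.aeval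
    ![(⟨x, Algebra.subset_adjoin (Or.inl rfl)⟩ : Algebra.adjoin S ({x, y} : Set A)),
      ⟨y, Algebra.subset_adjoin (Or.inr rfl)⟩]
  exact ⟨(Algebra.adjoin S ({x, y} : Set A)).val.comp g, by simp [g], by simp [g]⟩

lemma linearIndependent_mon_of {C : Type} [CommRing C] [Algebra S C] {X Y : C}
    (h : ∀ a d : Polynomial S, a.degree < ((n + 1 : ℕ) : WithBot ℕ) →
      d.degree < (r : WithBot ℕ) → Polynomial.aeval X a + Y * Polynomial.aeval Y d = 0 →
      a = 0 ∧ d = 0) : LinearIndependent S (mon X Y n r) := by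
  rw [Fintype.linearIndependent_iff]
  intro w hw
  have hsum {N : ℕ} (u : Fin N → S)
      (h0 : ∑ k : Fin N, Polynomial.C (u k) * Polynomial.X ^ (k : ℕ) = 0) (k : Fin N) :
      u k = 0 := by
    have := congrArg (fun p ↦ Polynomial.coeff p k) h0
    simpa [Polynomial.coeff_X_pow, Fin.val_inj] using this
  obtain ⟨h1, h2⟩ := h _ _ (degree_fin_sum_lt (fun j ↦ w (Sum.inl j)))
    (degree_fin_sum_lt (fun k ↦ w (Sum.inr k))) (by
      rw [← hw, Fintype.sum_sum_type]
      simp [mon, map_sum, Finset.mul_sum, Algebra.smul_def, pow_succ', mul_left_comm])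
  rintro (j | k)
  · exact hsum _ h1 j
  · exact hsum _ h2 k

/-- The point is that the equations impose no hidden relation. Acting on the unit of the standard
module kills the ideal of the chart, and it sends `a(x) + y d(y)` to the pair `(a, a(0) + y d)`,
from which `a` and `d` can be read off. -/
theorem linearIndependent_chartAlg (z : ChartCoord S n r) :
    LinearIndependent S (mon (ChartAlg.x z) (ChartAlg.y z) n r) := by
  obtain ⟨g, gx, gy⟩ := exists_aeval_of_commute (S := S) (x := stdX z) (y := stdY z) (by
    ext1 v
    rw [Module.End.mul_apply, Module.End.mul_apply, stdX_stdY, stdY_stdX])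
  let φ : MvPolynomial (Fin 2) S →ₗ[S] stdModule S n r :=
    (LinearMap.applyₗ (stdOne S n r)).comp g.toLinearMap
  have hφ (f) : φ f = g f (stdOne S n r) := rfl
  have hx (d : Polynomial S) : g (Polynomial.aeval (MvPolynomial.X 0) d) =
      Polynomial.aeval (stdX z) d := by rw [← gx, Polynomial.aeval_algHom_apply]
  have hy (d : Polynomial S) : g (Polynomial.aeval (MvPolynomial.X 1) d) =
      Polynomial.aeval (stdY z) d := by rw [← gy, Polynomial.aeval_algHom_apply]
  have hker : (chartIdeal z).restrictScalars S ≤ LinearMap.ker φ := by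
    intro f hf
    rw [LinearMap.mem_ker]
    refine Submodule.span_induction ?_ (map_zero φ) (fun u w _ _ hu hw ↦ ?_) (fun a u _ hu ↦ ?_)
      (show f ∈ Submodule.span _ _ from hf)
    · rintro _ (rfl | rfl | rfl)
      · rw [hφ, map_sub, map_mul, gx, gy, LinearMap.sub_apply, Module.End.mul_apply, stdX_stdY,
          ← MvPolynomial.algebraMap_eq, AlgHom.commutes, Module.algebraMap_end_apply, sub_self]
      · rw [hφ, relF, map_sub, map_mul, map_smul, gy, hx, hy, LinearMap.sub_apply,
          Module.End.mul_apply, stdY_relation, LinearMap.smul_apply, sub_self]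
      · rw [hφ, relG, map_sub, map_mul, map_smul, gx, hx, hy, LinearMap.sub_apply,
          Module.End.mul_apply, stdX_relation, LinearMap.smul_apply, sub_self]
    · rw [map_add, hu, hw, add_zero]
    · rw [smul_eq_mul, hφ, map_mul, Module.End.mul_apply, ← hφ, hu, map_zero]
  refine linearIndependent_mon_of fun a d ha hd h0 ↦ ?_
  have hmk : Ideal.Quotient.mk (chartIdeal z) (Polynomial.aeval (MvPolynomial.X 0) a +
      MvPolynomial.X 1 * Polynomial.aeval (MvPolynomial.X 1) d) = 0 := by
    rw [← h0, map_add, map_mul, ← Ideal.Quotient.mkₐ_eq_mk S, ← Polynomial.aeval_algHom_apply,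
      ← Polynomial.aeval_algHom_apply]
    rfl
  have h1 : φ _ = 0 := hker (Ideal.Quotient.eq_zero_iff_mem.mp hmk)
  rw [hφ, map_add, map_mul, gy, hx, hy, LinearMap.add_apply, Module.End.mul_apply] at h1
  have h2 : stdY z (Polynomial.aeval (stdY z) d (stdOne S n r)) =
      Polynomial.aeval (stdY z) (Polynomial.X * d) (stdOne S n r) := by
    rw [map_mul, Polynomial.aeval_X, Module.End.mul_apply]
  have hd' : (Polynomial.X * d).degree < ((r + 1 : ℕ) : WithBot ℕ) := by
    rw [Polynomial.degree_lt_iff_coeff_zero] at hd ⊢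
    intro j hj
    obtain ⟨j, rfl⟩ := Nat.exists_eq_succ_of_ne_zero (by omega : j ≠ 0)
    rw [Polynomial.coeff_X_mul]
    exact hd j (by omega)
  rw [h2, aeval_stdY, stdSwap_stdOne] at h1
  have h3 := congrArg Subtype.val h1
  rw [Submodule.coe_add, stdSwap_coe, aeval_stdX_stdOne (n := n) z ha,
    aeval_stdX_stdOne (n := r) z.swap hd'] at h3
  simp only [Prod.swap, Prod.mk_add_mk, Polynomial.coeff_X_mul_zero, map_zero, add_zero,
    ZeroMemClass.coe_zero, Prod.mk_eq_zero] at h3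
  obtain ⟨rfl, h4⟩ := h3
  refine ⟨rfl, ?_⟩
  rw [Polynomial.coeff_zero, map_zero, zero_add] at h4
  rw [← divX_X_mul d, h4, Polynomial.divX_zero]

/-- The monomial basis of the algebra of a chart. -/
def chartBasis (z : ChartCoord S n r) : Module.Basis (Fin (n + 1) ⊕ Fin r) S (ChartAlg z) :=
  Module.Basis.mk (linearIndependent_chartAlg z) (by
    rw [← Algebra.top_toSubmodule, ← ChartAlg.adjoin_eq_top z]
    exact adjoin_le_span_mon (ChartAlg.x_mul_y z) (ChartAlg.relF_eq z) (ChartAlg.relG_eq z))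

lemma chartBasis_apply (z : ChartCoord S n r) (i) :
    chartBasis z i = mon (ChartAlg.x z) (ChartAlg.y z) n r i := by
  rw [chartBasis, Module.Basis.mk_apply]

end ChartAlg

end

end NodeHilb


namespace NodeHilb

noncomputable section

/-! ### Germs of the family `x y = t` and the families over a chart -/

/-- `R` is the localization of `k[x, y] / (x y - t)` at the polynomials in `W`, expressed through
its universal property. -/
structure IsGerm {k R : Type} [CommRing k] [CommRing R] [Algebra k R] (t : k)
    (W : Set (MvPolynomial (Fin 2) k)) (x y : R) : Prop where
  mul_eq : x * y = algebraMap k R t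
  isUnit : ∀ w ∈ W, IsUnit (MvPolynomial.aeval ![x, y] w)
  exists_lift : ∀ (C : Type) [CommRing C] [Algebra k C] (X Y : C), X * Y = algebraMap k C t →
    (∀ w ∈ W, IsUnit (MvPolynomial.aeval ![X, Y] w)) → ∃ φ : R →ₐ[k] C, φ x = X ∧ φ y = Y
  hom_ext : ∀ (C : Type) [CommRing C] [Algebra k C] (φ ψ : R →ₐ[k] C), φ x = ψ x → φ y = ψ y →
    φ = ψ

lemma map_aeval_pair {k C C' : Type} [CommRing k] [CommRing C] [CommRing C'] [Algebra k C]
    [Algebra k C'] (f : C →ₐ[k] C') (X Y : C) (w : MvPolynomial (Fin 2) k) :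
    f (MvPolynomial.aeval ![X, Y] w) = MvPolynomial.aeval ![f X, f Y] w := by
  rw [← AlgHom.comp_apply, MvPolynomial.comp_aeval]
  congr 2
  ext i
  fin_cases i <;> rfl

/-! ### Homomorphisms out of the algebra of a chart. -/

section Lift

variable {S : Type} [CommRing S] {n r : ℕ} {C : Type} [CommRing C] [Algebra S C]

lemma algHom_relF {C' : Type} [CommRing C'] [Algebra S C'] (f : C →ₐ[S] C')
    (z : ChartCoord S n r) (X Y : C) : f (relF z X Y) = relF z (f X) (f Y) :=
  map_relF (RingHom.id S) (f : C →+* C') (fun s ↦ f.commutes s) z X Y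

lemma algHom_relG {C' : Type} [CommRing C'] [Algebra S C'] (f : C →ₐ[S] C')
    (z : ChartCoord S n r) (X Y : C) : f (relG z X Y) = relG z (f X) (f Y) :=
  algHom_relF f z.swap Y X

lemma mk_relF (I : Ideal C) (z : ChartCoord S n r) (X Y : C) :
    Ideal.Quotient.mk I (relF z X Y) = relF z (Ideal.Quotient.mk I X) (Ideal.Quotient.mk I Y) :=
  algHom_relF (Ideal.Quotient.mkₐ S I) z X Y

lemma mk_relG (I : Ideal C) (z : ChartCoord S n r) (X Y : C) :
    Ideal.Quotient.mk I (relG z X Y) = relG z (Ideal.Quotient.mk I X) (Ideal.Quotient.mk I Y) :=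
  algHom_relG (Ideal.Quotient.mkₐ S I) z X Y

/-- The universal property of the algebra of a chart. -/
def ChartAlg.lift (z : ChartCoord S n r) (X Y : C) (hXY : X * Y = algebraMap S C (z.b * z.c))
    (hF : relF z X Y = 0) (hG : relG z X Y = 0) : ChartAlg z →ₐ[S] C :=
  Ideal.Quotient.liftₐ (chartIdeal z) (MvPolynomial.aeval ![X, Y]) (by
    intro a ha
    have hle : chartIdeal z ≤ RingHom.ker (MvPolynomial.aeval ![X, Y] : _ →ₐ[S] C) := by
      rw [chartIdeal, Ideal.span_le]
      rintro _ (rfl | rfl | rfl)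
      · simp [hXY]
      · rw [SetLike.mem_coe, RingHom.mem_ker, algHom_relF]
        simpa using hF
      · rw [SetLike.mem_coe, RingHom.mem_ker, algHom_relG]
        simpa using hG
    exact hle ha)

lemma ChartAlg.lift_x (z : ChartCoord S n r) (X Y : C) (hXY hF hG) :
    ChartAlg.lift z X Y hXY hF hG (ChartAlg.x z) = X := by
  exact MvPolynomial.aeval_X _ _

lemma ChartAlg.lift_y (z : ChartCoord S n r) (X Y : C) (hXY hF hG) :
    ChartAlg.lift z X Y hXY hF hG (ChartAlg.y z) = Y := by
  exact MvPolynomial.aeval_X _ _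

lemma ChartAlg.hom_ext {z : ChartCoord S n r} {f g : ChartAlg z →ₐ[S] C}
    (hx : f (ChartAlg.x z) = g (ChartAlg.x z)) (hy : f (ChartAlg.y z) = g (ChartAlg.y z)) :
    f = g := by
  refine AlgHom.ext fun a ↦ ?_
  have ha : a ∈ Algebra.adjoin S {ChartAlg.x z, ChartAlg.y z} := by
    rw [ChartAlg.adjoin_eq_top]; trivial
  have : Algebra.adjoin S {ChartAlg.x z, ChartAlg.y z} ≤ AlgHom.equalizer f g := by
    rw [Algebra.adjoin_le_iff]
    rintro _ (rfl | rfl)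
    · exact hx
    · exact hy
  exact this ha

end Lift

/-! ### Families with a prescribed monomial basis and their coordinates. -/

section Families

variable {k R : Type} [CommRing k] [CommRing R] [Algebra k R] {t : k}
  {W : Set (MvPolynomial (Fin 2) k)} {x y : R}
  {S : Type} [CommRing S] [Algebra k S] {n r : ℕ}

/-- Chart coordinates that define a family of subschemes of the germ. -/
structure IsChartPoint (t : k) (W : Set (MvPolynomial (Fin 2) k)) (z : ChartCoord S n r) :
    Prop where
  mul_eq : z.b * z.c = algebraMap k S t
  isUnit : ∀ w ∈ W, IsUnit (MvPolynomial.aeval ![ChartAlg.x z, ChartAlg.y z] w)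

variable (S) in
/-- An element of `R` as an element of `S ⊗ R`. -/
abbrev incl (k : Type) [CommRing k] [Algebra k R] [Algebra k S] (a : R) : S ⊗[k] R :=
  (Algebra.TensorProduct.includeRight : R →ₐ[k] S ⊗[k] R) a

/-- The ideal of the family with the given chart coordinates. -/
def familyIdeal (k : Type) [CommRing k] [Algebra k R] [Algebra k S] (x y : R)
    (z : ChartCoord S n r) : Ideal (S ⊗[k] R) :=
  Ideal.span {relF z (incl S k x) (incl S k y), relG z (incl S k x) (incl S k y)}

/-- The quotient of `S ⊗ R` by `I` has the monomial basis `1, x, …, x ^ n, y, …, y ^ r`. -/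
def IsChart (x y : R) (n r : ℕ) (I : Ideal (S ⊗[k] R)) : Prop :=
  LinearIndependent S (mon (Ideal.Quotient.mk I (incl S k x)) (Ideal.Quotient.mk I (incl S k y))
    n r) ∧
  ⊤ ≤ Submodule.span S (Set.range (mon (Ideal.Quotient.mk I (incl S k x))
    (Ideal.Quotient.mk I (incl S k y)) n r))

lemma incl_mul (h : IsGerm t W x y) : incl S k x * incl S k y =
    algebraMap S (S ⊗[k] R) (algebraMap k S t) := by
  rw [incl, incl, ← map_mul, h.mul_eq, AlgHom.commutes, ← IsScalarTower.algebraMap_apply]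

/-- The quotient by the ideal of a family is the algebra of the chart. -/
theorem exists_quotient_equiv (h : IsGerm t W x y) {z : ChartCoord S n r}
    (hz : IsChartPoint t W z) :
    ∃ e : (S ⊗[k] R ⧸ familyIdeal k x y z) ≃ₐ[S] ChartAlg z,
      e (Ideal.Quotient.mk _ (incl S k x)) = ChartAlg.x z ∧
      e (Ideal.Quotient.mk _ (incl S k y)) = ChartAlg.y z := by
  -- The elements of `W` are invertible in the chart algebra, so the assignment of `x` and `y`
  -- extends to the localization `R`.
  obtain ⟨φ, φx, φy⟩ := h.exists_lift (ChartAlg z) (ChartAlg.x z) (ChartAlg.y z)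
    (by rw [ChartAlg.x_mul_y, hz.mul_eq, ← IsScalarTower.algebraMap_apply]) hz.isUnit
  let f : S ⊗[k] R →ₐ[S] ChartAlg z := Algebra.TensorProduct.lift (Algebra.ofId S _) φ
    (fun _ _ ↦ Commute.all _ _)
  have fx : f (incl S k x) = ChartAlg.x z := by simp [f, φx]
  have fy : f (incl S k y) = ChartAlg.y z := by simp [f, φy]
  have hle : familyIdeal k x y z ≤ RingHom.ker f := by
    rw [familyIdeal, Ideal.span_le]
    rintro _ (rfl | rfl)
    · rw [SetLike.mem_coe, RingHom.mem_ker, algHom_relF, fx, fy]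
      exact ChartAlg.relF_eq z
    · rw [SetLike.mem_coe, RingHom.mem_ker, algHom_relG, fx, fy]
      exact ChartAlg.relG_eq z
  let F : (S ⊗[k] R ⧸ familyIdeal k x y z) →ₐ[S] ChartAlg z :=
    Ideal.Quotient.liftₐ _ f (fun a ha ↦ hle ha)
  have hF : relF z (Ideal.Quotient.mk (familyIdeal k x y z) (incl S k x))
      (Ideal.Quotient.mk _ (incl S k y)) = 0 := by
    rw [← mk_relF, Ideal.Quotient.eq_zero_iff_mem]
    exact Ideal.subset_span (by simp)
  have hG : relG z (Ideal.Quotient.mk (familyIdeal k x y z) (incl S k x))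
      (Ideal.Quotient.mk _ (incl S k y)) = 0 := by
    rw [← mk_relG, Ideal.Quotient.eq_zero_iff_mem]
    exact Ideal.subset_span (by simp)
  let G : ChartAlg z →ₐ[S] (S ⊗[k] R ⧸ familyIdeal k x y z) := ChartAlg.lift z _ _ (by
    rw [← map_mul, incl_mul h, hz.mul_eq]; rfl) hF hG
  have Fx : F (Ideal.Quotient.mk _ (incl S k x)) = ChartAlg.x z := fx
  have Fy : F (Ideal.Quotient.mk _ (incl S k y)) = ChartAlg.y z := fy
  have Gx : G (ChartAlg.x z) = _ := ChartAlg.lift_x z _ _ _ hF hG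
  have Gy : G (ChartAlg.y z) = _ := ChartAlg.lift_y z _ _ _ hF hG
  refine ⟨AlgEquiv.ofAlgHom F G ?_ ?_, Fx, Fy⟩
  · refine ChartAlg.hom_ext ?_ ?_
    · rw [AlgHom.comp_apply, Gx, Fx]; rfl
    · rw [AlgHom.comp_apply, Gy, Fy]; rfl
  · refine Ideal.Quotient.algHom_ext _ ?_
    refine Algebra.TensorProduct.ext ?_ ?_
    · ext
    · refine h.hom_ext _ _ _ ?_ ?_
      · change G (F (Ideal.Quotient.mk _ (incl S k x))) = _
        rw [Fx, Gx]; rfl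
      · change G (F (Ideal.Quotient.mk _ (incl S k y))) = _
        rw [Fy, Gy]; rfl

lemma algEquiv_mon {C C' : Type} [CommRing C] [CommRing C'] [Algebra S C] [Algebra S C']
    (e : C →ₐ[S] C') (X Y : C) (i) : e (mon X Y n r i) = mon (e X) (e Y) n r i := by
  rcases i with j | j <;> simp [mon]

theorem isChart_familyIdeal (h : IsGerm t W x y) {z : ChartCoord S n r}
    (hz : IsChartPoint t W z) : IsChart x y n r (familyIdeal k x y z) := by
  obtain ⟨e, ex, ey⟩ := exists_quotient_equiv h hz
  let b := (chartBasis z).map e.symm.toLinearEquiv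
  have hb : ⇑b = mon (Ideal.Quotient.mk (familyIdeal k x y z) (incl S k x))
      (Ideal.Quotient.mk _ (incl S k y)) n r := by
    ext i
    rw [Module.Basis.map_apply, chartBasis_apply]
    have := algEquiv_mon (n := n) (r := r) e.symm.toAlgHom (ChartAlg.x z) (ChartAlg.y z) i
    rw [← ex, ← ey] at this ⊢
    simpa using this
  rw [IsChart, ← hb]
  exact ⟨b.linearIndependent, b.span_eq.ge⟩

/-- A family whose quotient has the monomial basis is given by chart coordinates. -/
theorem exists_isChartPoint (h : IsGerm t W x y) {I : Ideal (S ⊗[k] R)} (hI : IsChart x y n r I) :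
    ∃ z : ChartCoord S n r, IsChartPoint t W z ∧ I = familyIdeal k x y z := by
  set X := Ideal.Quotient.mk I (incl S k x) with hX
  set Y := Ideal.Quotient.mk I (incl S k y) with hY
  have hXY : X * Y = algebraMap S _ (algebraMap k S t) := by
    rw [hX, hY, ← map_mul, incl_mul h]; rfl
  obtain ⟨z, hbc, hF, hG⟩ := exists_chartCoord hXY hI.1 (hI.2 trivial) (hI.2 trivial)
  let f : ChartAlg z →ₐ[S] (S ⊗[k] R ⧸ I) := ChartAlg.lift z X Y (by rw [hXY, hbc]) hF hG
  have fx : f (ChartAlg.x z) = X := ChartAlg.lift_x z X Y _ hF hG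
  have fy : f (ChartAlg.y z) = Y := ChartAlg.lift_y z X Y _ hF hG
  let b : Module.Basis (Fin (n + 1) ⊕ Fin r) S (S ⊗[k] R ⧸ I) := Module.Basis.mk hI.1 hI.2
  have hf : ∀ i, f (chartBasis z i) = b i := fun i ↦ by
    rw [chartBasis_apply, algEquiv_mon, fx, fy, Module.Basis.mk_apply]
  have hfe : f.toLinearMap = ((chartBasis z).equiv b (Equiv.refl _)).toLinearMap := by
    refine (chartBasis z).ext fun i ↦ ?_
    simpa using hf i
  have hbij : Function.Bijective f := by
    have := ((chartBasis z).equiv b (Equiv.refl _)).bijective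
    rwa [← LinearEquiv.coe_coe, ← hfe] at this
  have hz : IsChartPoint t W z := by
    refine ⟨hbc, fun w hw ↦ ?_⟩
    have h1 : IsUnit (f (MvPolynomial.aeval ![ChartAlg.x z, ChartAlg.y z] w)) := by
      have h2 := (h.isUnit w hw).map (((Ideal.Quotient.mkₐ k I).comp
        (Algebra.TensorProduct.includeRight : R →ₐ[k] S ⊗[k] R)))
      rw [map_aeval_pair] at h2
      have h3 := map_aeval_pair (f.restrictScalars k) (ChartAlg.x z) (ChartAlg.y z) w
      simp only [AlgHom.coe_restrictScalars'] at h3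
      rw [h3, fx, fy]
      exact h2
    exact (MulEquiv.isUnit_map (AlgEquiv.ofBijective f hbij)).mp h1
  refine ⟨z, hz, ?_⟩
  have hle : familyIdeal k x y z ≤ I := by
    rw [familyIdeal, Ideal.span_le]
    rintro _ (rfl | rfl)
    · rw [SetLike.mem_coe, ← Ideal.Quotient.eq_zero_iff_mem,
        mk_relF]
      exact hF
    · rw [SetLike.mem_coe, ← Ideal.Quotient.eq_zero_iff_mem,
        mk_relG]
      exact hG
  -- The quotient by the chart ideal is isomorphic to the chart algebra, which maps bijectively onto
  -- the quotient by `I`. The composite is the factor map between the two quotients, so that map is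
  -- injective and `I` is no larger.
  refine le_antisymm (fun a ha ↦ ?_) hle
  obtain ⟨e, ex, ey⟩ := exists_quotient_equiv h hz
  have key : (f.comp e.toAlgHom) = Ideal.Quotient.factorₐ S hle := by
    refine Ideal.Quotient.algHom_ext _ ?_
    refine Algebra.TensorProduct.ext ?_ ?_
    · ext
    · refine h.hom_ext _ _ _ ?_ ?_
      · change f (e (Ideal.Quotient.mk _ (incl S k x))) = _
        rw [ex, fx]; rfl
      · change f (e (Ideal.Quotient.mk _ (incl S k y))) = _
        rw [ey, fy]; rfl
  have h1 := DFunLike.congr_fun key (Ideal.Quotient.mk _ a)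
  have h2 : Ideal.Quotient.factorₐ S hle (Ideal.Quotient.mk _ a) = 0 :=
    Ideal.Quotient.eq_zero_iff_mem.mpr ha
  rw [h2, AlgHom.comp_apply] at h1
  have h3 := hbij.1 (h1.trans (map_zero f).symm)
  exact Ideal.Quotient.eq_zero_iff_mem.mp (e.injective (h3.trans (map_zero e).symm))

/-- Both sets of coordinates satisfy their equations in one and the same quotient, where the
monomials are independent. -/
theorem familyIdeal_injective (h : IsGerm t W x y) {z z' : ChartCoord S n r}
    (hz : IsChartPoint t W z) (heq : familyIdeal k x y z = familyIdeal k x y z') : z = z' := by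
  have hI := isChart_familyIdeal h hz
  have hmem {z : ChartCoord S n r} {I : Ideal (S ⊗[k] R)} (hI : familyIdeal k x y z ≤ I) :
      relF z (Ideal.Quotient.mk I (incl S k x)) (Ideal.Quotient.mk I (incl S k y)) = 0 ∧
      relG z (Ideal.Quotient.mk I (incl S k x)) (Ideal.Quotient.mk I (incl S k y)) = 0 := by
    rw [← mk_relF, ← mk_relG, Ideal.Quotient.eq_zero_iff_mem, Ideal.Quotient.eq_zero_iff_mem]
    exact ⟨hI (Ideal.subset_span (by simp)), hI (Ideal.subset_span (by simp))⟩
  exact chartCoord_unique hI.1 (hmem le_rfl).1 (hmem heq.ge).1 (hmem le_rfl).2 (hmem heq.ge).2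

end Families

/-! ### Base change of the ideals and of the chart algebras. -/

section BaseChange

variable {k R : Type} [CommRing k] [CommRing R] [Algebra k R] {t : k}
  {W : Set (MvPolynomial (Fin 2) k)} {x y : R}
  {S S' : Type} [CommRing S] [Algebra k S] [CommRing S'] [Algebra k S'] {n r : ℕ}

/-- The homomorphism `S ⊗ R → S' ⊗ R` induced by `S → S'`. -/
abbrev tmap (R : Type) [CommRing R] [Algebra k R] (f : S →ₐ[k] S') : S ⊗[k] R →+* S' ⊗[k] R :=
  (Algebra.TensorProduct.map f (AlgHom.id k R)).toRingHom

lemma tmap_comp {S'' : Type} [CommRing S''] [Algebra k S''] (g : S' →ₐ[k] S'') (f : S →ₐ[k] S') :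
    tmap R (g.comp f) = (tmap R g).comp (tmap R f) := by
  have := Algebra.TensorProduct.map_comp g f (AlgHom.id k R) (AlgHom.id k R)
  rw [AlgHom.comp_id] at this
  rw [tmap, this]
  rfl

lemma tmap_id : tmap R (AlgHom.id k S) = RingHom.id _ := by
  rw [tmap, Algebra.TensorProduct.map_id]
  rfl

lemma tmap_incl (f : S →ₐ[k] S') (a : R) : tmap R f (incl S k a) = incl S' k a := by
  simp [tmap, incl]

lemma tmap_algebraMap (f : S →ₐ[k] S') (s : S) :
    tmap R f (algebraMap S _ s) = algebraMap S' _ (f s) := by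
  simp [tmap, Algebra.TensorProduct.algebraMap_apply]

lemma familyIdeal_map (f : S →ₐ[k] S') (z : ChartCoord S n r) :
    (familyIdeal k x y z).map (tmap R f) = familyIdeal k x y (z.map (f : S →+* S')) := by
  rw [familyIdeal, Ideal.map_span, Set.image_pair,
    map_relF (f : S →+* S') _ (fun s ↦ tmap_algebraMap f s),
    map_relG (f : S →+* S') _ (fun s ↦ tmap_algebraMap f s), tmap_incl, tmap_incl]
  rfl

/-- The homomorphism of chart algebras over a homomorphism of the base. -/
def ChartAlg.map (z : ChartCoord S n r) (f : S →+* S') : ChartAlg z →+* ChartAlg (z.map f) :=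
  letI := f.toAlgebra
  letI : Algebra S (ChartAlg (z.map f)) := ((algebraMap S' (ChartAlg (z.map f))).comp f).toAlgebra
  (ChartAlg.lift z (ChartAlg.x (z.map f)) (ChartAlg.y (z.map f))
    (by rw [ChartAlg.x_mul_y]; simp [RingHom.algebraMap_toAlgebra])
    (by
      have := map_relF f (RingHom.id (ChartAlg (z.map f))) (fun s ↦ rfl) z
        (ChartAlg.x (z.map f)) (ChartAlg.y (z.map f))
      rw [RingHom.id_apply] at this
      rw [this]
      exact ChartAlg.relF_eq _)
    (by
      have := map_relG f (RingHom.id (ChartAlg (z.map f))) (fun s ↦ rfl) z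
        (ChartAlg.x (z.map f)) (ChartAlg.y (z.map f))
      rw [RingHom.id_apply] at this
      rw [this]
      exact ChartAlg.relG_eq _)).toRingHom

lemma ChartAlg.map_x (z : ChartCoord S n r) (f : S →+* S') :
    ChartAlg.map z f (ChartAlg.x z) = ChartAlg.x _ := by
  let := f.toAlgebra
  let : Algebra S (ChartAlg (z.map f)) := ((algebraMap S' (ChartAlg (z.map f))).comp f).toAlgebra
  exact ChartAlg.lift_x z _ _ _ _ _

lemma ChartAlg.map_y (z : ChartCoord S n r) (f : S →+* S') :
    ChartAlg.map z f (ChartAlg.y z) = ChartAlg.y _ := by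
  let := f.toAlgebra
  let : Algebra S (ChartAlg (z.map f)) := ((algebraMap S' (ChartAlg (z.map f))).comp f).toAlgebra
  exact ChartAlg.lift_y z _ _ _ _ _

lemma ChartAlg.map_algebraMap (z : ChartCoord S n r) (f : S →+* S') (s : S) :
    ChartAlg.map z f (algebraMap S _ s) = algebraMap S' _ (f s) := by
  let := f.toAlgebra
  let : Algebra S (ChartAlg (z.map f)) := ((algebraMap S' (ChartAlg (z.map f))).comp f).toAlgebra
  exact AlgHom.commutes (ChartAlg.lift z _ _ _ _ _) s

end BaseChange

end

end NodeHilb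


namespace NodeHilb

noncomputable section

/-! ### Base change of families -/

section QuotientBaseChange

variable {k R : Type} [CommRing k] [CommRing R] [Algebra k R]
  {S S' : Type} [CommRing S] [Algebra k S] [CommRing S'] [Algebra k S']

/-- The quotient of a base-changed ideal is the base change of the quotient. -/
lemma exists_quotient_baseChange [Algebra S S'] [IsScalarTower k S S'] (I : Ideal (S ⊗[k] R)) :
    ∃ e : S' ⊗[S] (S ⊗[k] R ⧸ I) ≃ₗ[S']
      (S' ⊗[k] R ⧸ I.map (tmap R (IsScalarTower.toAlgHom k S S'))),
      ∀ a, e (1 ⊗ₜ Ideal.Quotient.mk I a) =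
        Ideal.Quotient.mk _ (tmap R (IsScalarTower.toAlgHom k S S') a) := by
  let e1 := Algebra.TensorProduct.tensorQuotientEquiv (R := S) S' (S ⊗[k] R) S' I
  let c := Algebra.TensorProduct.cancelBaseChange k S S' S' R
  have hc (a : S ⊗[k] R) : c (1 ⊗ₜ a) = tmap R (IsScalarTower.toAlgHom k S S') a := by
    induction a with
    | zero => rw [TensorProduct.tmul_zero, map_zero, map_zero]
    | add a b ha hb => rw [TensorProduct.tmul_add, map_add, map_add, ha, hb]
    | tmul s r => simp [c, tmap, Algebra.smul_def]
  have hI : I.map (tmap R (IsScalarTower.toAlgHom k S S')) =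
      (I.map (Algebra.TensorProduct.includeRight : S ⊗[k] R →ₐ[S] S' ⊗[S] (S ⊗[k] R))).map
        (c : S' ⊗[S] (S ⊗[k] R) →+* S' ⊗[k] R) := by
    have : (tmap R (IsScalarTower.toAlgHom k S S')) = (c : S' ⊗[S] (S ⊗[k] R) →+* S' ⊗[k] R).comp
        (Algebra.TensorProduct.includeRight :
          S ⊗[k] R →ₐ[S] S' ⊗[S] (S ⊗[k] R)).toRingHom := RingHom.ext fun a ↦ (hc a).symm
    rw [this, ← Ideal.map_map]
    rfl
  let e2 := Ideal.quotientEquivAlg _ _ c hI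
  refine ⟨(e1.trans e2).toLinearEquiv, fun a ↦ ?_⟩
  have : e2 (e1 (1 ⊗ₜ Ideal.Quotient.mk I a)) = Ideal.Quotient.mk _ (c (1 ⊗ₜ a)) := rfl
  rw [← hc]
  exact this

lemma HilbFamily.ext {m : ℕ} {g g' : HilbFamily k R S m} (h : g.ideal = g'.ideal) : g = g' := by
  cases g
  cases g'
  cases h
  rfl

/-- The base change of a family. -/
lemma HilbFamily.exists_baseChange {m : ℕ} (g : HilbFamily k R S m) (f : S →ₐ[k] S') :
    ∃ g' : HilbFamily k R S' m, g'.ideal = g.ideal.map (tmap R f) := by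
  let := f.toRingHom.toAlgebra
  have : IsScalarTower k S S' := IsScalarTower.of_algebraMap_eq fun a ↦ (f.commutes a).symm
  have hf : IsScalarTower.toAlgHom k S S' = f := by ext; rfl
  obtain ⟨e, -⟩ := exists_quotient_baseChange (S' := S') g.ideal
  rw [hf] at e
  have := g.finite
  have := g.projective
  refine ⟨⟨g.ideal.map (tmap R f), Module.Finite.equiv e, Module.Projective.of_equiv e,
    fun p ↦ ?_⟩, rfl⟩
  rw [← Module.rankAtStalk_eq_of_equiv e, Module.rankAtStalk_baseChange, g.rank_eq]

end QuotientBaseChange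

/-! ### Charts of a family -/

section Charts

variable {k R : Type} [CommRing k] [CommRing R] [Algebra k R] {t : k}
  {W : Set (MvPolynomial (Fin 2) k)} {x y : R}
  {S S' : Type} [CommRing S] [Algebra k S] [CommRing S'] [Algebra k S'] {n r m : ℕ}

/-- A surjection from a free module of rank `m` onto a finite projective module of rank `m` is
bijective, so for a family spanning is enough. -/
lemma HilbFamily.isChart (g : HilbFamily k R S m) (hm : n + 1 + r = m)
    (h : ⊤ ≤ Submodule.span S (Set.range (mon (Ideal.Quotient.mk g.ideal (incl S k x))
      (Ideal.Quotient.mk g.ideal (incl S k y)) n r))) : IsChart x y n r g.ideal := by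
  have := g.finite
  have := g.projective
  refine ⟨?_, h⟩
  let φ := Fintype.linearCombination S (mon (Ideal.Quotient.mk g.ideal (incl S k x))
      (Ideal.Quotient.mk g.ideal (incl S k y)) n r)
  have hs : Function.Surjective φ := by
    rw [← LinearMap.range_eq_top, Fintype.range_linearCombination]
    exact top_le_iff.mp h
  have hb := Module.bijective_of_surjective_of_rankAtStalk_eq hs (fun p hp ↦ by
    have : Nontrivial S := ⟨0, 1, fun h ↦ hp.ne_top ((Ideal.eq_top_iff_one p).mpr
      (h ▸ p.zero_mem))⟩
    rw [g.rank_eq, Module.rankAtStalk_eq_finrank_of_free]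
    simp [hm])
  exact linearIndependent_iff_injective_fintypeLinearCombination.mpr hb.1

/-- The family with given chart coordinates. -/
lemma exists_hilbFamily (h : IsGerm t W x y) {z : ChartCoord S n r} (hz : IsChartPoint t W z)
    (hm : n + 1 + r = m) : ∃ g : HilbFamily k R S m, g.ideal = familyIdeal k x y z := by
  have hI := isChart_familyIdeal h hz
  let b := Module.Basis.mk hI.1 hI.2
  have := Module.Free.of_basis b
  have := Module.Finite.of_basis b
  refine ⟨⟨familyIdeal k x y z, inferInstance, inferInstance, fun p ↦ ?_⟩, rfl⟩
  have : Nontrivial S := ⟨0, 1, fun h ↦ p.2.ne_top ((Ideal.eq_top_iff_one _).mpr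
      (h ▸ p.asIdeal.zero_mem))⟩
  rw [Module.rankAtStalk_eq_finrank_of_free, Module.finrank_eq_card_basis b]
  simp [hm]

lemma map_mon {C C' : Type} [CommRing C] [CommRing C'] (f : C →+* C') (X Y : C) (i) :
    f (mon X Y n r i) = mon (f X) (f Y) n r i := by
  rcases i with j | j <;> simp [mon]

lemma chartBasis_map (z : ChartCoord S n r) (f : S →+* S') (i) :
    ChartAlg.map z f (chartBasis z i) = chartBasis (z.map f) i := by
  rw [chartBasis_apply, chartBasis_apply, map_mon, ChartAlg.map_x, ChartAlg.map_y]

lemma chartBasis_repr_map (z : ChartCoord S n r) (f : S →+* S') (a : ChartAlg z) (i) :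
    (chartBasis (z.map f)).repr (ChartAlg.map z f a) i = f ((chartBasis z).repr a i) := by
  have h : ChartAlg.map z f a = ∑ j, f ((chartBasis z).repr a j) • chartBasis (z.map f) j := by
    conv_lhs => rw [← (chartBasis z).sum_repr a]
    rw [map_sum]
    refine Finset.sum_congr rfl fun j _ ↦ ?_
    refine (congrArg (ChartAlg.map z f) (Algebra.smul_def ((chartBasis z).repr a j)
      (chartBasis z j))).trans ?_
    rw [map_mul, ChartAlg.map_algebraMap, chartBasis_map]
    exact (Algebra.smul_def _ _).symm
  rw [h, Module.Basis.repr_sum_self]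

lemma chartBasis_det_map (z : ChartCoord S n r) (f : S →+* S')
    (v : Fin (n + 1) ⊕ Fin r → ChartAlg z) :
    (chartBasis (z.map f)).det (fun i ↦ ChartAlg.map z f (v i)) = f ((chartBasis z).det v) := by
  rw [Module.Basis.det_apply, Module.Basis.det_apply, RingHom.map_det]
  congr 1
  ext i j
  rw [RingHom.mapMatrix_apply, Matrix.map_apply, Module.Basis.toMatrix_apply,
    Module.Basis.toMatrix_apply, chartBasis_repr_map]

/-- The monomial bases correspond under base change, and so do the matrices of multiplication. Norms
can therefore be treated as functions on the chart. -/
lemma norm_chartAlg_map (z : ChartCoord S n r) (f : S →+* S') (a : ChartAlg z) :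
    Algebra.norm S' (ChartAlg.map z f a) = f (Algebra.norm S a) := by
  rw [Algebra.norm_eq_matrix_det (chartBasis z), Algebra.norm_eq_matrix_det (chartBasis (z.map f)),
    RingHom.map_det]
  congr 1
  ext i j
  rw [RingHom.mapMatrix_apply, Matrix.map_apply, Algebra.leftMulMatrix_eq_repr_mul,
    Algebra.leftMulMatrix_eq_repr_mul, ← chartBasis_map, ← map_mul, chartBasis_repr_map]

/-- Invertibility of an element of the algebra is invertibility of multiplication by it, hence of a
determinant. Thus the condition that `w` be a unit on a family is the invertibility of one function
on the base. -/
lemma isUnit_norm_chartAlg (z : ChartCoord S n r) (a : ChartAlg z) :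
    IsUnit (Algebra.norm S a) ↔ IsUnit a := by
  refine ⟨fun h ↦ ?_, fun h ↦ h.map _⟩
  have := Module.Finite.of_basis (chartBasis z)
  have := Module.Free.of_basis (chartBasis z)
  rw [Algebra.norm_apply, ← LinearMap.isUnit_iff_isUnit_det, Module.End.isUnit_iff] at h
  obtain ⟨b, hb⟩ := h.2 1
  exact IsUnit.of_mul_eq_one b hb

lemma isChartPoint_map {z : ChartCoord S n r} (hz : IsChartPoint t W z) (f : S →ₐ[k] S') :
    IsChartPoint t W (z.map (f : S →+* S')) := by
  refine ⟨?_, fun w hw ↦ ?_⟩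
  · simp [← map_mul, hz.mul_eq]
  · let F : ChartAlg z →ₐ[k] ChartAlg (z.map (f : S →+* S')) :=
      { ChartAlg.map z (f : S →+* S') with
        commutes' := fun a ↦ by
          rw [IsScalarTower.algebraMap_apply k S (ChartAlg z)]
          refine (ChartAlg.map_algebraMap z (f : S →+* S') _).trans ?_
          rw [IsScalarTower.algebraMap_apply k S' (ChartAlg _)]
          congr 1
          exact f.commutes a }
    have h := (hz.isUnit w hw).map F
    rw [map_aeval_pair] at h
    have hx : F (ChartAlg.x z) = _ := ChartAlg.map_x z (f : S →+* S')
    have hy : F (ChartAlg.y z) = _ := ChartAlg.map_y z (f : S →+* S')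
    rwa [hx, hy] at h

/-- The locus where another set of monomials is also a basis is the non-vanishing locus of a
function. -/
theorem exists_isChart_iff (h : IsGerm t W x y) {z : ChartCoord S n r} (hz : IsChartPoint t W z)
    {n' r' : ℕ} (hm : n' + 1 + r' = n + 1 + r) :
    ∃ δ : S, ∀ (S' : Type) [CommRing S'] [Algebra k S'] (f : S →ₐ[k] S'),
      IsChart x y n' r' ((familyIdeal k x y z).map (tmap R f)) ↔ IsUnit (f δ) := by
  -- Both families of monomials have the same number of members. Any matching of the indices will
  -- do, as it changes the determinant only by a sign.
  let e : Fin (n' + 1) ⊕ Fin r' ≃ Fin (n + 1) ⊕ Fin r := Fintype.equivOfCardEq (by simp [hm])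
  refine ⟨(chartBasis z).det (mon (ChartAlg.x z) (ChartAlg.y z) n' r' ∘ e.symm),
    fun S' _ _ f ↦ ?_⟩
  have hz' := isChartPoint_map hz f
  obtain ⟨E, Ex, Ey⟩ := exists_quotient_equiv h hz'
  rw [familyIdeal_map]
  have h1 := chartBasis_det_map z (f : S →+* S')
    (mon (ChartAlg.x z) (ChartAlg.y z) n' r' ∘ e.symm)
  rw [RingHom.coe_coe] at h1
  rw [← h1, ← Module.Basis.is_basis_iff_det]
  have h2 : (fun i ↦ ChartAlg.map z (f : S →+* S')
      ((mon (ChartAlg.x z) (ChartAlg.y z) n' r' ∘ e.symm) i)) =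
      (E.toLinearEquiv.toLinearMap ∘ mon (Ideal.Quotient.mk _ (incl S' k x)) (Ideal.Quotient.mk _ (incl S' k y))
        n' r') ∘ e.symm := by
    funext i
    simp only [Function.comp_apply]
    rw [map_mon, ChartAlg.map_x, ChartAlg.map_y]
    have := map_mon (n := n') (r := r') E.toRingEquiv.toRingHom
      (Ideal.Quotient.mk _ (incl S' k x))
      (Ideal.Quotient.mk _ (incl S' k y)) (e.symm i)
    refine Eq.trans ?_ this.symm
    exact congrArg₂ (fun u v ↦ mon u v n' r' (e.symm i)) Ex.symm Ey.symm
  rw [h2, linearIndependent_equiv, e.symm.surjective.range_comp, Set.range_comp,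
    LinearMap.linearIndependent_iff _ (LinearEquiv.ker _), ← Submodule.map_span, IsChart, top_le_iff,
    ← (Submodule.map_injective_of_injective E.toLinearEquiv.injective).eq_iff (b := ⊤),
    Submodule.map_top, LinearEquiv.range]

end Charts

end

end NodeHilb


namespace NodeHilb

noncomputable section

/-! ### Charts over a field -/

section Field

variable {κ A : Type} [Field κ] [CommRing A] [Algebra κ A] [Module.Finite κ A]

/-- Cayley–Hamilton for multiplication by `X` on the cyclic module `κ[X] v`: its characteristic
polynomial kills `v` and has degree at most `d`, because the cyclic module lies in `U`. Division
with remainder then lowers the degree. -/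
lemma exists_aeval_mul_eq_of_finrank (X v : A) (q : Polynomial κ) {d : ℕ}
    (U : Submodule κ A) (hU : ∀ p : Polynomial κ, Polynomial.aeval X p * v ∈ U)
    (hd : Module.finrank κ U = d) :
    ∃ q' : Polynomial κ, q'.degree < (d : WithBot ℕ) ∧
      Polynomial.aeval X q * v = Polynomial.aeval X q' * v := by
  let φ : Polynomial κ →ₗ[κ] A :=
    (LinearMap.mulRight κ v).comp (Polynomial.aeval X).toLinearMap
  have hφ (p : Polynomial κ) : φ p = Polynomial.aeval X p * v := rfl
  let V := LinearMap.range φ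
  have hVU : V ≤ U := by
    rintro _ ⟨p, rfl⟩
    exact hU p
  let T : Module.End κ V := (LinearMap.mulLeft κ X).restrict (p := V) (q := V) (by
    rintro _ ⟨p, rfl⟩
    exact ⟨Polynomial.X * p, by simp [hφ, mul_assoc]⟩)
  have hT (p : Polynomial κ) (w : V) : ((Polynomial.aeval T p w : V) : A) =
      Polynomial.aeval X p * w := by
    induction p using Polynomial.induction_on' with
    | add p q hp hq => simp [add_mul, hp, hq]
    | monomial n a =>
      simp only [Polynomial.aeval_monomial, Algebra.algebraMap_eq_smul_one, smul_mul_assoc,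
        one_mul, LinearMap.smul_apply, Submodule.coe_smul]
      congr 1
      induction n with
      | zero => simp
      | succ n ih =>
        rw [pow_succ', pow_succ', Module.End.mul_apply, mul_assoc, ← ih]
        rfl
  let χ := T.charpoly
  have hχ : Polynomial.aeval X χ * v = 0 := by
    have h1 := hT χ ⟨v, ⟨1, by simp [hφ]⟩⟩
    rw [LinearMap.aeval_self_charpoly] at h1
    simpa using h1.symm
  refine ⟨q %ₘ χ, ?_, ?_⟩
  · refine (Polynomial.degree_modByMonic_lt _ T.charpoly_monic).trans_le ?_
    rw [Polynomial.degree_eq_natDegree T.charpoly_monic.ne_zero, LinearMap.charpoly_natDegree]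
    exact_mod_cast hd ▸ Submodule.finrank_mono hVU
  · conv_lhs => rw [← Polynomial.modByMonic_add_div q χ]
    rw [map_add, map_mul]
    linear_combination Polynomial.aeval X (q /ₘ χ) * hχ

/-- Multiplication by `a` is injective on the finite-dimensional space `M`, hence surjective, so the
inverse already lies in `M`. -/
lemma mem_subalgebra_of_mul_eq_one (M : Subalgebra κ A) {a b : A} (ha : a ∈ M) (hab : a * b = 1) :
    b ∈ M := by
  let T : M →ₗ[κ] M := LinearMap.mulLeft κ ⟨a, ha⟩
  have hT : Function.Injective T := fun u v huv ↦ by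
    have h1 : a * (u : A) = a * v := congrArg Subtype.val huv
    refine Subtype.ext ?_
    linear_combination b * h1 + (v - u : A) * hab
  obtain ⟨u, hu⟩ := (LinearMap.injective_iff_surjective.mp hT) 1
  have h1 : a * (u : A) = 1 := congrArg Subtype.val hu
  have h2 : b = u := by
    calc b = b * (a * u) := by rw [h1, mul_one]
      _ = u := by rw [← mul_assoc, mul_comm b, hab, one_mul]
  rw [h2]
  exact u.2

/-- If `X` is a unit, then `Y = τ X⁻¹` and the algebra is generated by `X` alone, so that `r = 0`.
If not, then `τ = 0` and `X Y = 0`: modulo `(X)` everything is a polynomial in `Y`, while `(X)` is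
the cyclic `κ[X]`-module generated by `X`. The dimensions of these two pieces add up to `m`. -/
lemma exists_top_le_span_mon {X Y : A} {τ : κ} (hXY : X * Y = algebraMap κ A τ)
    (hA : Algebra.adjoin κ {X, Y} = ⊤) {m : ℕ} (hm : Module.finrank κ A = m) (h1 : 1 ≤ m) :
    ∃ n r, n + 1 + r = m ∧ ⊤ ≤ Submodule.span κ (Set.range (mon X Y n r)) := by
  by_cases hX : IsUnit X
  · obtain ⟨u, hu⟩ := hX.exists_right_inv
    have hY : Y = algebraMap κ A τ * u := by
      rw [← hXY]
      linear_combination (-Y) * hu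
    have hX' : ∀ a : A, a ∈ Algebra.adjoin κ {X} := by
      have hu' := mem_subalgebra_of_mul_eq_one (Algebra.adjoin κ {X}) (Algebra.subset_adjoin rfl) hu
      have : Algebra.adjoin κ {X, Y} ≤ Algebra.adjoin κ {X} := by
        rw [Algebra.adjoin_le_iff]
        rintro _ (rfl | rfl)
        · exact Algebra.subset_adjoin rfl
        · rw [hY]
          exact mul_mem (Subalgebra.algebraMap_mem _ _) hu'
      exact fun a ↦ this (hA ▸ trivial)
    refine ⟨m - 1, 0, by omega, fun a _ ↦ ?_⟩
    obtain ⟨p, rfl⟩ := Algebra.adjoin_mem_exists_aeval κ X (hX' a)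
    obtain ⟨q, hq, h⟩ := exists_aeval_mul_eq_of_finrank X 1 p ⊤ (fun _ ↦ trivial)
      (finrank_top κ A)
    rw [mem_span_mon]
    refine ⟨q, 0, ?_, by simp, by simpa using h⟩
    rw [hm] at hq
    rwa [Nat.sub_add_cancel h1]
  · have hτ : τ = 0 := by
      by_contra hτ
      refine hX (IsUnit.of_mul_eq_one (algebraMap κ A τ⁻¹ * Y) ?_)
      rw [mul_left_comm, hXY, ← map_mul, inv_mul_cancel₀ hτ, map_one]
    rw [hτ, map_zero] at hXY
    let J : Ideal A := Ideal.span {X}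
    have hJ : J ≠ ⊤ := by rwa [Ne, Ideal.span_singleton_eq_top]
    have : Nontrivial (A ⧸ J) := Ideal.Quotient.nontrivial_iff.mpr hJ
    let U : Submodule κ A := J.restrictScalars κ
    have hfin : Module.finrank κ (A ⧸ J) + Module.finrank κ U = m :=
      hm ▸ U.finrank_quotient_add_finrank
    have hpos : 0 < Module.finrank κ (A ⧸ J) := Module.finrank_pos
    have hYJ : ∀ a : A, ∃ q : Polynomial κ, a - Polynomial.aeval Y q ∈ J := by
      intro a
      have ha : a ∈ Algebra.adjoin κ {X, Y} := hA ▸ trivial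
      refine Algebra.adjoin_induction ?_ (fun s ↦ ⟨Polynomial.C s, by simp⟩) ?_ ?_ ha
      · rintro _ (rfl | rfl)
        · exact ⟨0, by rw [map_zero, sub_zero]; exact Ideal.subset_span rfl⟩
        · exact ⟨Polynomial.X, by simp⟩
      · rintro a b - - ⟨p, hp⟩ ⟨q, hq⟩
        refine ⟨p + q, ?_⟩
        rw [map_add, add_sub_add_comm]
        exact add_mem hp hq
      · rintro a b - - ⟨p, hp⟩ ⟨q, hq⟩
        refine ⟨p * q, ?_⟩
        have : a * b - Polynomial.aeval Y (p * q) = b * (a - Polynomial.aeval Y p) +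
            Polynomial.aeval Y p * (b - Polynomial.aeval Y q) := by rw [map_mul]; ring
        rw [this]
        exact add_mem (J.mul_mem_left _ hp) (J.mul_mem_left _ hq)
    have hX' : ∀ a : A, ∃ q : Polynomial κ, X * a = X * Polynomial.aeval X q := by
      intro a
      have ha : a ∈ Algebra.adjoin κ {X, Y} := hA ▸ trivial
      refine Algebra.adjoin_induction ?_ (fun s ↦ ⟨Polynomial.C s, by simp⟩) ?_ ?_ ha
      · rintro _ (rfl | rfl)
        · exact ⟨Polynomial.X, by simp⟩
        · exact ⟨0, by simpa using hXY⟩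
      · rintro a b - - ⟨p, hp⟩ ⟨q, hq⟩
        exact ⟨p + q, by rw [map_add, mul_add, hp, hq, mul_add]⟩
      · rintro a b - - ⟨p, hp⟩ ⟨q, hq⟩
        refine ⟨p * q, ?_⟩
        rw [map_mul]
        linear_combination b * hp + Polynomial.aeval X p * hq
    -- The ideal `(X)` is spanned by `X, …, X^n`, so `n` is its dimension; the quotient contributes
    -- `1, Y, …, Y^r`, one more than `r`.
    refine ⟨Module.finrank κ U, Module.finrank κ (A ⧸ J) - 1, by omega, fun a _ ↦ ?_⟩
    obtain ⟨q, hq⟩ := hYJ a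
    obtain ⟨q', hq', h⟩ := exists_aeval_mul_eq_of_finrank (A := A ⧸ J) (Ideal.Quotient.mk J Y) 1 q ⊤
      (fun _ ↦ trivial) (finrank_top κ (A ⧸ J))
    have hq2 : a - Polynomial.aeval Y q' ∈ J := by
      have h2 (p : Polynomial κ) : Polynomial.aeval (Ideal.Quotient.mk J Y) p =
          Ideal.Quotient.mk J (Polynomial.aeval Y p) :=
        Polynomial.aeval_algHom_apply (Ideal.Quotient.mkₐ κ J) Y p
      rw [mul_one, mul_one, h2, h2, Ideal.Quotient.eq] at h
      simpa using add_mem hq h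
    obtain ⟨u, hu⟩ := Ideal.mem_span_singleton'.mp hq2
    obtain ⟨p, hp⟩ := hX' u
    obtain ⟨p', hp', h'⟩ := exists_aeval_mul_eq_of_finrank X X p U
      (fun p ↦ J.mul_mem_left _ (Ideal.mem_span_singleton_self X)) rfl
    rw [mem_span_mon]
    -- The constant term of the representative in `Y` is moved to the `x` part.
    refine ⟨Polynomial.C (q'.coeff 0) + Polynomial.X * p', q'.divX, ?_, ?_, ?_⟩
    · refine (Polynomial.degree_add_le _ _).trans_lt (max_lt ?_ ?_)
      · exact Polynomial.degree_C_le.trans_lt (by exact_mod_cast Nat.succ_pos _)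
      · rw [Polynomial.degree_lt_iff_coeff_zero] at hp' ⊢
        intro k hk
        obtain ⟨k, rfl⟩ : ∃ l, k = l + 1 := ⟨k - 1, by omega⟩
        rw [Polynomial.coeff_X_mul]
        exact hp' k (by omega)
    · rw [Polynomial.degree_lt_iff_coeff_zero] at hq' ⊢
      intro k hk
      rw [Polynomial.coeff_divX]
      exact hq' _ (by omega)
    · have h3 : Polynomial.aeval Y q' = Y * Polynomial.aeval Y q'.divX +
          algebraMap κ A (q'.coeff 0) := by
        conv_lhs => rw [← Polynomial.X_mul_divX_add q']
        rw [map_add, map_mul, Polynomial.aeval_X, Polynomial.aeval_C]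
      simp only [map_add, map_mul, Polynomial.aeval_C, Polynomial.aeval_X]
      linear_combination h' + hp - hu + h3

end Field

/-! ### Families over a field. -/

section

variable {k R : Type} [CommRing k] [CommRing R] [Algebra k R] {t : k}
  {W : Set (MvPolynomial (Fin 2) k)} {x y : R} {m : ℕ}

/-- A family over a field lies in one of the charts. -/
theorem HilbFamily.exists_isChart_of_field (h : IsGerm t W x y) {κ : Type} [Field κ] [Algebra k κ]
    (g : HilbFamily k R κ m) (h1 : 1 ≤ m) :
    ∃ n r, n + 1 + r = m ∧ IsChart x y n r g.ideal := by
  have := g.finite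
  set X := Ideal.Quotient.mk g.ideal (incl κ k x) with hX
  set Y := Ideal.Quotient.mk g.ideal (incl κ k y) with hY
  have hXY : X * Y = algebraMap κ _ (algebraMap k κ t) := by
    rw [hX, hY, ← map_mul, incl_mul h]; rfl
  let M := Algebra.adjoin κ {X, Y}
  let q : R →ₐ[k] (κ ⊗[k] R ⧸ g.ideal) := (Ideal.Quotient.mkₐ k g.ideal).comp
    (Algebra.TensorProduct.includeRight : R →ₐ[k] κ ⊗[k] R)
  have hXM : X ∈ M := Algebra.subset_adjoin (Or.inl rfl)
  have hYM : Y ∈ M := Algebra.subset_adjoin (Or.inr rfl)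
  -- The elements of `W` are invertible in the quotient and, by finite dimension, already in the
  -- subalgebra `M` generated by `X` and `Y`. So the map from `R` lands in `M`, and `X` and `Y`
  -- generate the quotient although `R` is a localization.
  obtain ⟨φ, φx, φy⟩ := h.exists_lift M ⟨X, hXM⟩ ⟨Y, hYM⟩ (Subtype.ext (by
      rw [MulMemClass.mk_mul_mk]
      exact hXY)) (fun w hw ↦ by
    obtain ⟨b, hb⟩ := ((h.isUnit w hw).map q).exists_right_inv
    have hwM : ((MvPolynomial.aeval ![(⟨X, hXM⟩ : M), ⟨Y, hYM⟩] w : M) :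
        (κ ⊗[k] R ⧸ g.ideal)) = MvPolynomial.aeval ![X, Y] w :=
      map_aeval_pair (M.val.restrictScalars k) _ _ w
    rw [map_aeval_pair] at hb
    have hb' : ((MvPolynomial.aeval ![(⟨X, hXM⟩ : M), ⟨Y, hYM⟩] w : M) :
        (κ ⊗[k] R ⧸ g.ideal)) * b = 1 := by rw [hwM]; exact hb
    exact IsUnit.of_mul_eq_one
      (⟨b, mem_subalgebra_of_mul_eq_one M (Subtype.property _) hb'⟩ : M) (Subtype.ext hb'))
  have hq : (M.val.restrictScalars k).comp φ = q := h.hom_ext _ _ _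
    (by rw [AlgHom.comp_apply, φx]; rfl) (by rw [AlgHom.comp_apply, φy]; rfl)
  have hM : M = ⊤ := by
    refine top_le_iff.mp fun a _ ↦ ?_
    obtain ⟨a, rfl⟩ := Ideal.Quotient.mk_surjective a
    induction a with
    | zero => rw [map_zero]; exact zero_mem _
    | add a b ha hb => rw [map_add]; exact add_mem (ha trivial) (hb trivial)
    | tmul s b =>
      have : Ideal.Quotient.mk g.ideal (s ⊗ₜ[k] b) = s • q b := by
        refine Eq.trans ?_ (Algebra.smul_def s (q b)).symm
        change _ = Ideal.Quotient.mk g.ideal (algebraMap κ _ s) * Ideal.Quotient.mk g.ideal _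
        rw [← map_mul]
        simp [Algebra.TensorProduct.algebraMap_apply]
      rw [this, ← hq]
      exact M.smul_mem (Subtype.property _) _
  have hfin : Module.finrank κ (κ ⊗[k] R ⧸ g.ideal) = m := by
    have := g.rank_eq (⊥ : PrimeSpectrum κ)
    rw [Module.rankAtStalk_eq_finrank_of_free] at this
    exact this
  obtain ⟨n, r, hnr, hs⟩ := exists_top_le_span_mon hXY hM hfin h1
  exact ⟨n, r, hnr, g.isChart hnr hs⟩

end

end

end NodeHilb


namespace NodeHilb

noncomputable section

/-! ### Families are local on the base -/

section Local

variable {k R : Type} [CommRing k] [CommRing R] [Algebra k R]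
  {S : Type} [CommRing S] [Algebra k S]

variable (k) in
/-- The localization map as a homomorphism of `k`-algebras. -/
abbrev locHom (f : S) : S →ₐ[k] Localization.Away f := IsScalarTower.toAlgHom k S _

variable (k) in
lemma isUnit_locHom (f : S) : IsUnit (locHom k f f) :=
  IsLocalization.Away.algebraMap_isUnit (S := Localization.Away f) f

/-- Factorization of homomorphisms through a localization. -/
lemma exists_locHom_lift {S' : Type} [CommRing S'] [Algebra k S'] (f : S) (φ : S →ₐ[k] S')
    (h : IsUnit (φ f)) : ∃ ψ : Localization.Away f →ₐ[k] S', ψ.comp (locHom k f) = φ := by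
  let ψ : Localization.Away f →+* S' := IsLocalization.Away.lift (g := (φ : S →+* S')) f h
  have hψ (s : S) : ψ (algebraMap S _ s) = φ s := IsLocalization.Away.lift_eq f h s
  exact ⟨{ ψ with
    commutes' := fun a ↦ by
      change ψ _ = _
      rw [IsScalarTower.algebraMap_apply k S (Localization.Away f), hψ, φ.commutes] },
    AlgHom.ext hψ⟩

lemma locHom_hom_ext {S' : Type} [CommRing S'] [Algebra k S'] {f : S}
    {φ ψ : Localization.Away f →ₐ[k] S'} (h : φ.comp (locHom k f) = ψ.comp (locHom k f)) :
    φ = ψ := by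
  have : (φ : Localization.Away f →+* S') = ψ :=
    IsLocalization.ringHom_ext (Submonoid.powers f) (RingHom.ext fun s ↦ DFunLike.congr_fun h s)
  exact AlgHom.ext fun s ↦ DFunLike.congr_fun this s

lemma isLocalization_tmap (f : S) :
    letI := (tmap R (locHom k f)).toAlgebra
    IsLocalization.Away (algebraMap S (S ⊗[k] R) f) (Localization.Away f ⊗[k] R) := by
  let := (tmap R (locHom k f)).toAlgebra
  have : IsScalarTower S (S ⊗[k] R) (Localization.Away f ⊗[k] R) :=
    IsScalarTower.of_algebraMap_eq fun s ↦ (tmap_algebraMap (locHom k f) s).symm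
  have h := IsLocalization.tensorProduct_tensorProduct k R (Submonoid.powers f)
    (Localization.Away f) (RingHom.ext fun r ↦ tmap_incl (locHom k f) r)
  rwa [Algebra.algebraMapSubmonoid_powers] at h

lemma exists_pow_smul_mem (f : S) (I : Ideal (S ⊗[k] R)) {a : S ⊗[k] R}
    (ha : tmap R (locHom k f) a ∈ I.map (tmap R (locHom k f))) : ∃ n : ℕ, f ^ n • a ∈ I := by
  let := (tmap R (locHom k f)).toAlgebra
  have := isLocalization_tmap (k := k) (R := R) f
  obtain ⟨s, ⟨n, rfl⟩, hs⟩ := (IsLocalization.algebraMap_mem_map_algebraMap_iff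
    (Submonoid.powers (algebraMap S (S ⊗[k] R) f)) (Localization.Away f ⊗[k] R) I a).mp ha
  refine ⟨n, ?_⟩
  rw [Algebra.smul_def, map_pow]
  exact hs

lemma exists_pow_smul_eq_tmap (f : S) (e : Localization.Away f ⊗[k] R) :
    ∃ (n : ℕ) (a : S ⊗[k] R), algebraMap _ _ (locHom k f f) ^ n * e = tmap R (locHom k f) a := by
  let := (tmap R (locHom k f)).toAlgebra
  have := isLocalization_tmap (k := k) (R := R) f
  obtain ⟨n, a, h⟩ := IsLocalization.Away.surj (algebraMap S (S ⊗[k] R) f) e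
  refine ⟨n, a, ?_⟩
  rw [mul_comm, ← tmap_algebraMap]
  exact h

/-- A set of good functions that avoids all primes contains a finite covering. -/
lemma exists_finset_span_eq_top {P : S → Prop}
    (h : ∀ 𝔭 : PrimeSpectrum S, ∃ f ∉ 𝔭.asIdeal, P f) :
    ∃ T : Finset S, Ideal.span (T : Set S) = ⊤ ∧ ∀ f ∈ T, P f := by
  have : Ideal.span {f | P f} = ⊤ := by
    by_contra hne
    obtain ⟨𝔪, hm, hle⟩ := Ideal.exists_le_maximal _ hne
    obtain ⟨f, hf, hP⟩ := h ⟨𝔪, hm.isPrime⟩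
    exact hf (hle (Ideal.subset_span hP))
  obtain ⟨T, hT, h1⟩ := (Ideal.span_eq_top_iff_finite _).mp this
  exact ⟨T, h1, fun f hf ↦ hT hf⟩

lemma exists_mem_notMem {T : Finset S} (hT : Ideal.span (T : Set S) = ⊤) (𝔭 : PrimeSpectrum S) :
    ∃ f ∈ T, f ∉ 𝔭.asIdeal := by
  by_contra! h
  exact 𝔭.2.ne_top (top_le_iff.mp (hT ▸ Ideal.span_le.mpr h))

lemma ideal_le_of_local {I J : Ideal (S ⊗[k] R)}
    (h : ∀ 𝔭 : PrimeSpectrum S, ∃ f ∉ 𝔭.asIdeal,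
      I.map (tmap R (locHom k f)) ≤ J.map (tmap R (locHom k f))) : I ≤ J := by
  intro a ha
  -- The ideal of all `s` with `s • a ∈ J`. Near each prime some power of a function `f` outside the
  -- prime belongs to it, so it is contained in no maximal ideal.
  let K : Ideal S := (Submodule.comap (LinearMap.toSpanSingleton S _ a) (J.restrictScalars S))
  have hK : K = ⊤ := by
    by_contra hne
    obtain ⟨𝔪, hm, hle⟩ := Ideal.exists_le_maximal _ hne
    obtain ⟨f, hf, hP⟩ := h ⟨𝔪, hm.isPrime⟩
    obtain ⟨n, hn⟩ := exists_pow_smul_mem f J (hP (Ideal.mem_map_of_mem _ ha))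
    have h1 : f ^ n ∈ K := hn
    exact hf (hm.isPrime.mem_of_pow_mem n (hle h1))
  have h1 : (1 : S) ∈ K := hK ▸ trivial
  have h2 : (1 : S) • a ∈ J := h1
  rwa [one_smul] at h2

/-- Ideals that agree locally on the base are equal. -/
theorem ideal_eq_of_local {I J : Ideal (S ⊗[k] R)}
    (h : ∀ 𝔭 : PrimeSpectrum S, ∃ f ∉ 𝔭.asIdeal,
      I.map (tmap R (locHom k f)) = J.map (tmap R (locHom k f))) : I = J :=
  le_antisymm (ideal_le_of_local fun 𝔭 ↦ (h 𝔭).imp fun _ hf ↦ ⟨hf.1, hf.2.le⟩)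
    (ideal_le_of_local fun 𝔭 ↦ (h 𝔭).imp fun _ hf ↦ ⟨hf.1, hf.2.ge⟩)

lemma map_tmap_tmap {S' S'' : Type} [CommRing S'] [Algebra k S'] [CommRing S''] [Algebra k S'']
    (I : Ideal (S ⊗[k] R)) (φ : S →ₐ[k] S') (ψ : S' →ₐ[k] S'') :
    (I.map (tmap R φ)).map (tmap R ψ) = I.map (tmap R (ψ.comp φ)) := by
  rw [Ideal.map_map, tmap_comp]

/-- Ideals on a covering that agree on overlaps can be glued. -/
theorem exists_glued_ideal (T : Finset S) (I : ∀ f : S, Ideal (Localization.Away f ⊗[k] R))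
    (h : ∀ f ∈ T, ∀ g ∈ T, ∀ (S' : Type) [CommRing S'] [Algebra k S']
      (φ : Localization.Away f →ₐ[k] S') (ψ : Localization.Away g →ₐ[k] S'),
      φ.comp (locHom k f) = ψ.comp (locHom k g) →
      (I f).map (tmap R φ) = (I g).map (tmap R ψ)) :
    ∃ J : Ideal (S ⊗[k] R), ∀ f ∈ T, J.map (tmap R (locHom k f)) = I f := by
  -- The glued ideal is the intersection of the preimages. To see that it generates `I f`, clear the
  -- denominator of an element of `I f`; agreement on the overlap with each `g` puts a further
  -- multiple by a power of `f` into the preimage of `I g`, and as `T` is finite one exponent serves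
  -- for all `g`.
  refine ⟨⨅ f ∈ T, (I f).comap (tmap R (locHom k f)), fun f hf ↦ le_antisymm ?_ fun e he ↦ ?_⟩
  · rw [Ideal.map_le_iff_le_comap]
    exact iInf₂_le f hf
  obtain ⟨n, a, hna⟩ := exists_pow_smul_eq_tmap f e
  have ha : tmap R (locHom k f) a ∈ I f := hna ▸ Ideal.mul_mem_left _ _ he
  have key : ∀ g ∈ T, ∃ N : ℕ, (tmap R (locHom k g) (f ^ N • a)) ∈ I g := by
    intro g hg
    let ψ := locHom k (locHom k g f)
    obtain ⟨φ, hφ⟩ := exists_locHom_lift f (ψ.comp (locHom k g)) (isUnit_locHom k (locHom k g f))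
    have h1 : tmap R ψ (tmap R (locHom k g) a) ∈ (I g).map (tmap R ψ) := by
      rw [← h f hf g hg _ φ ψ hφ, ← RingHom.comp_apply, ← tmap_comp, ← hφ, tmap_comp]
      exact Ideal.mem_map_of_mem _ ha
    obtain ⟨N, hN⟩ := exists_pow_smul_mem _ _ h1
    refine ⟨N, ?_⟩
    rw [Algebra.smul_def] at hN ⊢
    rwa [map_mul, tmap_algebraMap, map_pow]
  choose! N hN using key
  let M := T.sup N
  have hM : f ^ M • a ∈ ⨅ g ∈ T, (I g).comap (tmap R (locHom k g)) := by
    simp only [Submodule.mem_iInf]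
    intro g hg
    rw [Ideal.mem_comap]
    have : M = (M - N g) + N g := (Nat.sub_add_cancel (Finset.le_sup hg)).symm
    rw [this, pow_add, mul_smul, Algebra.smul_def (f ^ (M - N g)), map_mul]
    exact Ideal.mul_mem_left _ _ (hN g hg)
  have h2 := Ideal.mem_map_of_mem (tmap R (locHom k f)) hM
  rw [Algebra.smul_def, map_mul, tmap_algebraMap, ← hna, map_pow, map_pow, ← mul_assoc,
    ← pow_add] at h2
  exact (Ideal.unit_mul_mem_iff_mem _ (((isUnit_locHom k f).map _).pow _)).mp h2

/-- Families on a covering that agree on overlaps can be glued. -/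
theorem exists_glued_family {m : ℕ} {T : Finset S} (hT : Ideal.span (T : Set S) = ⊤)
    (J : Ideal (S ⊗[k] R))
    (hJ : ∀ f ∈ T, ∃ g : HilbFamily k R (Localization.Away f) m,
      g.ideal = J.map (tmap R (locHom k f))) :
    ∃ g : HilbFamily k R S m, g.ideal = J := by
  choose g hg using hJ
  have fin (f : (T : Set S)) :
      Module.Finite (Localization.Away f.1) (Localization.Away f.1 ⊗[S] (S ⊗[k] R ⧸ J)) := by
    obtain ⟨e, -⟩ := exists_quotient_baseChange (S' := Localization.Away f.1) J
    have h1 := (g f f.2).finite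
    rw [hg f f.2] at h1
    exact Module.Finite.equiv e.symm
  have proj (f : (T : Set S)) :
      Module.Projective (Localization.Away f.1) (Localization.Away f.1 ⊗[S] (S ⊗[k] R ⧸ J)) := by
    obtain ⟨e, -⟩ := exists_quotient_baseChange (S' := Localization.Away f.1) J
    have h1 := (g f f.2).projective
    rw [hg f f.2] at h1
    exact Module.Projective.of_equiv e.symm
  -- Finite presentation and flatness are both local on the base, and together they give
  -- projectivity.
  have pres : Module.FinitePresentation S (S ⊗[k] R ⧸ J) :=
    Module.FinitePresentation.of_localizationSpan' (Rₚ := fun f : (T : Set S) ↦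
      Localization.Away f.1) (T : Set S) hT
      (fun f ↦ TensorProduct.mk S (Localization.Away f.1) (S ⊗[k] R ⧸ J) 1)
      (fun f ↦ Module.finitePresentation_of_projective _ _)
  have flat : Module.Flat S (S ⊗[k] R ⧸ J) :=
    Module.flat_of_isLocalized_span S (S ⊗[k] R ⧸ J) (T : Set S) hT
      (fun f ↦ Localization.Away f.1 ⊗[S] (S ⊗[k] R ⧸ J))
      (fun f ↦ TensorProduct.mk S (Localization.Away f.1) (S ⊗[k] R ⧸ J) 1)
      (fun f ↦ by
        have := proj f
        have : Module.Flat (Localization.Away f.1) (Localization.Away f.1 ⊗[S] (S ⊗[k] R ⧸ J)) :=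
          Module.Flat.of_projective
        exact Module.Flat.trans S (Localization.Away f.1) _)
  have projective : Module.Projective S (S ⊗[k] R ⧸ J) :=
    Module.Flat.projective_of_finitePresentation
  refine ⟨⟨J, inferInstance, projective, fun 𝔭 ↦ ?_⟩, rfl⟩
  obtain ⟨f, hf, hfp⟩ := exists_mem_notMem hT 𝔭
  obtain ⟨𝔮, h𝔮⟩ : 𝔭 ∈ Set.range (PrimeSpectrum.comap (algebraMap S (Localization.Away f))) := by
    rw [PrimeSpectrum.localization_away_comap_range (Localization.Away f) f]
    exact hfp
  obtain ⟨e, -⟩ := exists_quotient_baseChange (S' := Localization.Away f) J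
  have h1 := (g f hf).rank_eq 𝔮
  rw [hg f hf, ← Module.rankAtStalk_eq_of_equiv e, Module.rankAtStalk_baseChange, h𝔮] at h1
  exact h1

end Local

/-! ### A family is locally in a chart -/

section

variable {k R : Type} [CommRing k] [CommRing R] [Algebra k R] {t : k}
  {W : Set (MvPolynomial (Fin 2) k)} {x y : R} {m : ℕ} {S : Type} [CommRing S] [Algebra k S]

lemma IsChart.map {n r : ℕ} {S' : Type} [CommRing S'] [Algebra k S'] (h : IsGerm t W x y)
    {I : Ideal (S ⊗[k] R)} (hI : IsChart x y n r I) (φ : S →ₐ[k] S') :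
    IsChart x y n r (I.map (tmap R φ)) := by
  obtain ⟨z, hz, rfl⟩ := exists_isChartPoint h hI
  rw [familyIdeal_map]
  exact isChart_familyIdeal h (isChartPoint_map hz φ)

theorem HilbFamily.exists_isChart (h : IsGerm t W x y) (g : HilbFamily k R S m) (h1 : 1 ≤ m)
    (𝔭 : PrimeSpectrum S) : ∃ f ∉ 𝔭.asIdeal, ∃ n r, n + 1 + r = m ∧
      IsChart x y n r (g.ideal.map (tmap R (locHom k f))) := by
  -- Monomials that span the fibre at `𝔭` span near `𝔭`: the finite quotient by their span has zero
  -- fibre, so `𝔭` is not in its support and some `f` outside `𝔭` annihilates it. After inverting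
  -- `f` the monomials span, and the rank makes them a basis.
  let κ := 𝔭.asIdeal.ResidueField
  let φ : S →ₐ[k] κ := IsScalarTower.toAlgHom k S κ
  obtain ⟨gκ, hgκ⟩ := g.exists_baseChange φ
  obtain ⟨n, r, hnr, hc⟩ := gκ.exists_isChart_of_field h h1
  rw [hgκ] at hc
  have := g.finite
  let v := mon (Ideal.Quotient.mk g.ideal (incl S k x)) (Ideal.Quotient.mk g.ideal (incl S k y)) n r
  let N := Submodule.span S (Set.range v)
  have hv {S' : Type} [CommRing S'] [Algebra k S'] (φ : S →ₐ[k] S') (i) :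
      mon (Ideal.Quotient.mk (g.ideal.map (tmap R φ)) (incl S' k x))
        (Ideal.Quotient.mk (g.ideal.map (tmap R φ)) (incl S' k y)) n r i =
      Ideal.Quotient.mk _ (tmap R φ (mon (incl S k x) (incl S k y) n r i)) := by
    rw [map_mon, map_mon, tmap_incl, tmap_incl]
  have hv' (i) : v i = Ideal.Quotient.mk g.ideal (mon (incl S k x) (incl S k y) n r i) := by
    rw [map_mon]
  have hsub : Subsingleton (κ ⊗[S] ((S ⊗[k] R ⧸ g.ideal) ⧸ N)) := by
    obtain ⟨e, he⟩ := exists_quotient_baseChange (S' := κ) g.ideal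
    let q := N.mkQ.baseChange κ
    have hq : Function.Surjective q := LinearMap.lTensor_surjective κ N.mkQ_surjective
    have hker : ⊤ ≤ LinearMap.ker q := by
      have h2 : Submodule.map e.symm.toLinearMap ⊤ ≤ LinearMap.ker q := by
        rw [← top_le_iff.mp hc.2, Submodule.map_span, Submodule.span_le]
        rintro _ ⟨_, ⟨i, rfl⟩, rfl⟩
        rw [SetLike.mem_coe, LinearMap.mem_ker, hv φ i, ← he, LinearEquiv.coe_coe,
          LinearEquiv.symm_apply_apply, LinearMap.baseChange_tmul, ← hv', Submodule.mkQ_apply,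
          (Submodule.Quotient.mk_eq_zero N).mpr (Submodule.subset_span ⟨i, rfl⟩),
          TensorProduct.tmul_zero]
      rwa [Submodule.map_top, LinearEquiv.range] at h2
    refine ⟨fun a b ↦ ?_⟩
    obtain ⟨a, rfl⟩ := hq a
    obtain ⟨b, rfl⟩ := hq b
    rw [LinearMap.mem_ker.mp (hker (x := a) trivial), LinearMap.mem_ker.mp (hker (x := b) trivial)]
  have hsupp : 𝔭 ∉ Module.support S ((S ⊗[k] R ⧸ g.ideal) ⧸ N) := by
    rw [Module.mem_support_iff_nontrivial_residueField_tensorProduct]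
    exact not_nontrivial_iff_subsingleton.mpr hsub
  rw [Module.support_eq_zeroLocus, PrimeSpectrum.mem_zeroLocus, Set.not_subset] at hsupp
  obtain ⟨f, hf, hfp⟩ := hsupp
  refine ⟨f, hfp, n, r, hnr, ?_⟩
  obtain ⟨g', hg'⟩ := g.exists_baseChange (locHom k f)
  rw [← hg']
  refine g'.isChart hnr ?_
  rw [hg']
  obtain ⟨e, he⟩ := exists_quotient_baseChange (S' := Localization.Away f) g.ideal
  rw [← LinearEquiv.range e, ← Submodule.map_top, Submodule.map_le_iff_le_comap]
  rintro u -
  induction u with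
  | zero => exact zero_mem _
  | add a b ha hb => exact add_mem ha hb
  | tmul s b =>
    obtain ⟨c, hc⟩ : ∃ c : Localization.Away f, c * algebraMap S _ f = 1 :=
      (IsLocalization.Away.algebraMap_isUnit (S := Localization.Away f) f).exists_left_inv
    have h2 : s ⊗ₜ[S] b = (s * c) • (1 ⊗ₜ[S] (f • b)) := by
      rw [TensorProduct.tmul_smul, ← algebraMap_smul (Localization.Away f) f, smul_smul, mul_assoc,
        hc, mul_one, TensorProduct.smul_tmul', smul_eq_mul, mul_one]
    rw [h2]
    refine Submodule.smul_mem _ _ ?_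
    have h3 : f • b ∈ N := by
      have := Module.mem_annihilator.mp hf (Submodule.Quotient.mk b)
      rwa [← Submodule.Quotient.mk_smul, Submodule.Quotient.mk_eq_zero] at this
    refine Submodule.span_induction (p := fun b _ ↦ (1 : Localization.Away f) ⊗ₜ[S] b ∈ _)
      ?_ ?_ ?_ ?_ h3
    · rintro _ ⟨i, rfl⟩
      rw [Submodule.mem_comap, hv', LinearEquiv.coe_coe, he]
      exact Submodule.subset_span ⟨i, hv (locHom k f) i⟩
    · rw [TensorProduct.tmul_zero]
      exact zero_mem _
    · intro a b _ _ ha hb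
      rw [TensorProduct.tmul_add]
      exact add_mem ha hb
    · intro s b _ hb
      rw [TensorProduct.tmul_smul, ← algebraMap_smul (Localization.Away f) s]
      exact Submodule.smul_mem _ _ hb

end

end

end NodeHilb


namespace NodeHilb

noncomputable section

/-! ### Morphisms of affine schemes over the base -/

section SpecHom

variable {k A B C : Type} [CommRing k] [CommRing A] [Algebra k A] [CommRing B] [Algebra k B]
  [CommRing C] [Algebra k C]

/-- The morphism of spectra given by a homomorphism of algebras. -/
abbrev specHom (u : A →ₐ[k] B) : Spec (CommRingCat.of B) ⟶ Spec (CommRingCat.of A) :=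
  Spec.map (CommRingCat.ofHom u.toRingHom)

lemma specHom_comp (v : B →ₐ[k] C) (u : A →ₐ[k] B) :
    specHom (v.comp u) = specHom v ≫ specHom u := by
  rw [← Spec.map_comp, ← CommRingCat.ofHom_comp]
  rfl

lemma specHom_comp_assoc {X : Scheme.{0}} (v : B →ₐ[k] C) (u : A →ₐ[k] B)
    (f : Spec (CommRingCat.of A) ⟶ X) :
    specHom v ≫ specHom u ≫ f = specHom (v.comp u) ≫ f := by
  rw [specHom_comp, Category.assoc]

lemma specHom_id : specHom (AlgHom.id k A) = 𝟙 _ := Spec.map_id _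

lemma specHom_injective {u v : A →ₐ[k] B} (h : specHom u = specHom v) : u = v := by
  have h1 := CommRingCat.hom_ext_iff.mp (Spec.map_injective h)
  exact AlgHom.ext fun a ↦ DFunLike.congr_fun h1 a

lemma isIso_specHom (e : A ≃ₐ[k] B) : IsIso (specHom e.toAlgHom) := by
  refine ⟨specHom e.symm.toAlgHom, ?_, ?_⟩
  · rw [← specHom_comp, ← specHom_id (k := k)]
    congr 1
    ext a
    exact e.apply_symm_apply a
  · rw [← specHom_comp, ← specHom_id (k := k)]
    congr 1
    ext a
    exact e.symm_apply_apply a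

lemma specHom_structure (u : A →ₐ[k] B) :
    specHom u ≫ Spec.map (CommRingCat.ofHom (algebraMap k A)) =
      Spec.map (CommRingCat.ofHom (algebraMap k B)) := by
  rw [← Spec.map_comp, ← CommRingCat.ofHom_comp]
  congr 2
  exact u.comp_algebraMap

/-- A morphism of affine schemes over the base comes from a homomorphism of algebras. -/
lemma exists_specHom_eq (f : Spec (CommRingCat.of B) ⟶ Spec (CommRingCat.of A))
    (h : f ≫ Spec.map (CommRingCat.ofHom (algebraMap k A)) =
      Spec.map (CommRingCat.ofHom (algebraMap k B))) : ∃ u : A →ₐ[k] B, f = specHom u := by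
  obtain ⟨g, rfl⟩ := Spec.map_surjective f
  rw [← Spec.map_comp] at h
  have h1 := CommRingCat.hom_ext_iff.mp (Spec.map_injective h)
  exact ⟨{ g.hom with commutes' := fun a ↦ DFunLike.congr_fun h1 a }, rfl⟩

end SpecHom

/-! ### The rings of the intersections of charts -/

section

variable {k R : Type} [CommRing k] [CommRing R] [Algebra k R]

/-- The ideal has the monomial basis of each of the charts in `s`. -/
def IsChartOn {S : Type} [CommRing S] [Algebra k S] (x y : R) {m : ℕ} (s : Finset (Fin m))
    (I : Ideal (S ⊗[k] R)) : Prop :=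
  ∀ i ∈ s, IsChart x y (m - 1 - i) i I

/-- A ring that represents the families that lie in all the charts in `s`. -/
structure ChartRing (k : Type) {R : Type} [CommRing k] [CommRing R] [Algebra k R] (x y : R)
    {m : ℕ} (s : Finset (Fin m)) where
  ring : Type
  [commRing : CommRing ring]
  [algebra : Algebra k ring]
  ideal : Ideal (ring ⊗[k] R)
  isChartOn : IsChartOn x y s ideal
  exists_hom : ∀ (S : Type) [CommRing S] [Algebra k S] (I : Ideal (S ⊗[k] R)),
    IsChartOn x y s I → ∃ u : ring →ₐ[k] S, ideal.map (tmap R u) = I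
  hom_ext : ∀ (S : Type) [CommRing S] [Algebra k S] (u v : ring →ₐ[k] S),
    ideal.map (tmap R u) = ideal.map (tmap R v) → u = v

attribute [instance] ChartRing.commRing ChartRing.algebra

variable {t : k} {W : Set (MvPolynomial (Fin 2) k)} {x y : R} {m : ℕ}
  {S : Type} [CommRing S] [Algebra k S]

lemma IsChartOn.map {s : Finset (Fin m)} {S' : Type} [CommRing S'] [Algebra k S']
    (h : IsGerm t W x y) {I : Ideal (S ⊗[k] R)} (hI : IsChartOn x y s I) (φ : S →ₐ[k] S') :
    IsChartOn x y s (I.map (tmap R φ)) := fun i hi ↦ (hI i hi).map h φ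

/-- The locus where a family lies in further charts is the non-vanishing locus of a function. -/
lemma exists_isChartOn_iff (h : IsGerm t W x y) {s : Finset (Fin m)} (hs : s.Nonempty)
    {I : Ideal (S ⊗[k] R)} (hI : IsChartOn x y s I) (s' : Finset (Fin m)) :
    ∃ δ : S, ∀ (S' : Type) [CommRing S'] [Algebra k S'] (f : S →ₐ[k] S'),
      IsChartOn x y s' (I.map (tmap R f)) ↔ IsUnit (f δ) := by
  obtain ⟨i, hi⟩ := hs
  obtain ⟨z, hz, rfl⟩ := exists_isChartPoint h (hI i hi)
  have (j : Fin m) := exists_isChart_iff h hz (n' := m - 1 - j) (r' := j) (by omega)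
  choose δ hδ using this
  refine ⟨∏ j ∈ s', δ j, fun S' _ _ f ↦ ?_⟩
  rw [map_prod, IsUnit.prod_iff]
  exact forall₂_congr fun j _ ↦ hδ j S' f

/-- An intersection of charts is a basic open subset of any one of its members, so its ring is a
localization at one element. -/
lemma ChartRing.exists_extend (h : IsGerm t W x y) {i : Fin m} (C : ChartRing k x y {i})
    {s : Finset (Fin m)} (hi : i ∈ s) : Nonempty (ChartRing k x y s) := by
  obtain ⟨δ, hδ⟩ := exists_isChartOn_iff h (Finset.singleton_nonempty i) C.isChartOn s
  refine ⟨⟨Localization.Away δ, C.ideal.map (tmap R (locHom k δ)),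
    (hδ _ _).mpr (isUnit_locHom k δ), fun S _ _ I hI ↦ ?_, fun S _ _ u v huv ↦ ?_⟩⟩
  · obtain ⟨u, hu⟩ := C.exists_hom S I (fun j hj ↦ by
      rw [Finset.mem_singleton] at hj
      exact hI j (hj ▸ hi))
    obtain ⟨v, hv⟩ := exists_locHom_lift δ u ((hδ S u).mp (hu ▸ hI))
    exact ⟨v, by rw [map_tmap_tmap, hv, hu]⟩
  · rw [map_tmap_tmap, map_tmap_tmap] at huv
    exact locHom_hom_ext (C.hom_ext S _ _ huv)

lemma ChartRing.exists_res {s s' : Finset (Fin m)} (C : ChartRing k x y s)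
    (C' : ChartRing k x y s') (hs : s ⊆ s') :
    ∃ u : C.ring →ₐ[k] C'.ring, C.ideal.map (tmap R u) = C'.ideal :=
  C.exists_hom _ _ fun i hi ↦ C'.isChartOn i (hs hi)

/-- The restriction to a smaller intersection of charts. -/
def ChartRing.res {s s' : Finset (Fin m)} (C : ChartRing k x y s) (C' : ChartRing k x y s')
    (hs : s ⊆ s') : C.ring →ₐ[k] C'.ring := (C.exists_res C' hs).choose

lemma ChartRing.map_res {s s' : Finset (Fin m)} (C : ChartRing k x y s)
    (C' : ChartRing k x y s') (hs : s ⊆ s') : C.ideal.map (tmap R (C.res C' hs)) = C'.ideal :=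
  (C.exists_res C' hs).choose_spec

lemma ChartRing.comp_res_eq {s s' : Finset (Fin m)} (C : ChartRing k x y s)
    (C' : ChartRing k x y s') (hs : s ⊆ s') {u : C.ring →ₐ[k] S} {v : C'.ring →ₐ[k] S}
    (h : C.ideal.map (tmap R u) = C'.ideal.map (tmap R v)) : v.comp (C.res C' hs) = u :=
  C.hom_ext _ _ _ (by rw [← map_tmap_tmap, C.map_res, h])

/-- The ring of the smaller intersection represents the same families as the localization of the
larger chart's ring at `δ`, so the restriction is that localization up to isomorphism. -/
lemma ChartRing.isOpenImmersion_res (h : IsGerm t W x y) {s s' : Finset (Fin m)}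
    (hs0 : s.Nonempty) (C : ChartRing k x y s) (C' : ChartRing k x y s') (hs : s ⊆ s') :
    IsOpenImmersion (specHom (C.res C' hs)) := by
  obtain ⟨δ, hδ⟩ := exists_isChartOn_iff h hs0 C.isChartOn s'
  obtain ⟨ψ, hψ⟩ := exists_locHom_lift δ (C.res C' hs) ((hδ _ _).mp
    ((C.map_res C' hs).symm ▸ C'.isChartOn))
  obtain ⟨u, hu⟩ := C'.exists_hom _ (C.ideal.map (tmap R (locHom k δ)))
    ((hδ _ _).mpr (isUnit_locHom k δ))
  have h1 : u.comp (C.res C' hs) = locHom k δ := C.comp_res_eq C' hs hu.symm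
  let e : Localization.Away δ ≃ₐ[k] C'.ring := AlgEquiv.ofAlgHom ψ u
    (C'.hom_ext _ _ _ (by
      rw [← map_tmap_tmap, hu, map_tmap_tmap, hψ, C.map_res, tmap_id, Ideal.map_id]))
    (locHom_hom_ext (by rw [AlgHom.comp_assoc, hψ, h1, AlgHom.id_comp]))
  have : IsIso (specHom ψ) := isIso_specHom e
  have : IsOpenImmersion (specHom (locHom k δ)) := IsOpenImmersion.of_isLocalization δ
  rw [← hψ, specHom_comp]
  infer_instance

/-- The index category of the intersections of charts. -/
abbrev ChartIndex (m : ℕ) : Type := ({s : Finset (Fin m) // s.Nonempty})ᵒᵈ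

/-- The diagram of the intersections of charts. -/
def chartFunctor (L : ∀ s : ChartIndex m, ChartRing k x y (OrderDual.ofDual s).1) :
    ChartIndex m ⥤ Scheme.{0} where
  obj s := Spec (CommRingCat.of (L s).ring)
  map {s s'} f := specHom ((L s').res (L s) (leOfHom f))
  map_id s := by
    rw [← specHom_id (k := k)]
    congr 1
    exact (L s).hom_ext _ _ _ (by rw [ChartRing.map_res, tmap_id, Ideal.map_id])
  map_comp {s s' s''} f g := by
    rw [← specHom_comp]
    congr 1
    exact (L s'').hom_ext _ _ _ (by
      rw [ChartRing.map_res, ← map_tmap_tmap, ChartRing.map_res, ChartRing.map_res])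

variable (L : ∀ s : ChartIndex m, ChartRing k x y (OrderDual.ofDual s).1)

lemma isOpenImmersion_chartFunctor (h : IsGerm t W x y) {s s' : ChartIndex m} (f : s ⟶ s') :
    IsOpenImmersion ((chartFunctor L).map f) :=
  ChartRing.isOpenImmersion_res h (OrderDual.ofDual s').2 _ _ _

/-- The union of two index sets. -/
def ChartIndex.union (s s' : ChartIndex m) : ChartIndex m :=
  OrderDual.toDual ⟨(OrderDual.ofDual s).1 ∪ (OrderDual.ofDual s').1,
    (OrderDual.ofDual s).2.mono Finset.subset_union_left⟩

lemma ChartIndex.subset_union_left (s s' : ChartIndex m) :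
    (OrderDual.ofDual s).1 ⊆ (OrderDual.ofDual (s.union s')).1 := Finset.subset_union_left

lemma ChartIndex.subset_union_right (s s' : ChartIndex m) :
    (OrderDual.ofDual s').1 ⊆ (OrderDual.ofDual (s.union s')).1 := Finset.subset_union_right

lemma IsChartOn.union {s s' : ChartIndex m} {I : Ideal (S ⊗[k] R)}
    (h : IsChartOn x y (OrderDual.ofDual s).1 I) (h' : IsChartOn x y (OrderDual.ofDual s').1 I) :
    IsChartOn x y (OrderDual.ofDual (s.union s')).1 I := fun i hi ↦ by
  rcases Finset.mem_union.mp hi with hi | hi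
  exacts [h i hi, h' i hi]

/-- Take two points with the same image `p` in a larger chart. The family over the residue field of
`p` lies in the charts of `s₁` and of `s₂`, hence in their union, and so defines a point there. It
maps to the two given points because open immersions are injective. -/
lemma isLocallyDirected_chartFunctor (h : IsGerm t W x y) :
    (chartFunctor L ⋙ Scheme.forget).IsLocallyDirected := by
  constructor
  intro s₁ s₂ s f₁ f₂ x₁ x₂ hx
  change PrimeSpectrum (L s₁).ring at x₁
  change PrimeSpectrum (L s₂).ring at x₂
  let ρ₁ := (L s).res (L s₁) (leOfHom f₁)
  let ρ₂ := (L s).res (L s₂) (leOfHom f₂)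
  let p : PrimeSpectrum (L s).ring := PrimeSpectrum.comap ρ₁.toRingHom x₁
  have hp : p = PrimeSpectrum.comap ρ₂.toRingHom x₂ := hx
  let κ := p.asIdeal.ResidueField
  let φ : (L s).ring →ₐ[k] κ := IsScalarTower.toAlgHom k _ κ
  have hφ (a : (L s).ring) (ha : a ∉ p.asIdeal) : IsUnit (φ a) :=
    isUnit_iff_ne_zero.mpr (mt Ideal.algebraMap_residueField_eq_zero.mp ha)
  have h1 : IsChartOn x y (OrderDual.ofDual s₁).1 ((L s).ideal.map (tmap R φ)) := by
    obtain ⟨δ, hδ⟩ := exists_isChartOn_iff h (OrderDual.ofDual s).2 (L s).isChartOn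
      (OrderDual.ofDual s₁).1
    refine (hδ _ _).mpr (hφ _ fun hmem ↦ ?_)
    exact x₁.2.ne_top (Ideal.eq_top_of_isUnit_mem _ hmem ((hδ _ ρ₁).mp
      (((L s).map_res (L s₁) _).symm ▸ (L s₁).isChartOn)))
  have h2 : IsChartOn x y (OrderDual.ofDual s₂).1 ((L s).ideal.map (tmap R φ)) := by
    obtain ⟨δ, hδ⟩ := exists_isChartOn_iff h (OrderDual.ofDual s).2 (L s).isChartOn
      (OrderDual.ofDual s₂).1
    refine (hδ _ _).mpr (hφ _ fun hmem ↦ ?_)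
    rw [hp] at hmem
    exact x₂.2.ne_top (Ideal.eq_top_of_isUnit_mem _ hmem ((hδ _ ρ₂).mp
      (((L s).map_res (L s₂) _).symm ▸ (L s₂).isChartOn)))
  obtain ⟨u, hu⟩ := (L (s₁.union s₂)).exists_hom κ _ (h1.union h2)
  let r₁ := (L s₁).res (L (s₁.union s₂)) (s₁.subset_union_left s₂)
  let r₂ := (L s₂).res (L (s₁.union s₂)) (s₁.subset_union_right s₂)
  have e1 : (u.comp r₁).comp ρ₁ = φ := (L s).hom_ext _ _ _ (by
    rw [← map_tmap_tmap, ChartRing.map_res, ← map_tmap_tmap, ChartRing.map_res, hu])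
  have e2 : (u.comp r₂).comp ρ₂ = φ := (L s).hom_ext _ _ _ (by
    rw [← map_tmap_tmap, ChartRing.map_res, ← map_tmap_tmap, ChartRing.map_res, hu])
  let o : PrimeSpectrum κ := ⊥
  have ho : PrimeSpectrum.comap φ.toRingHom o = p := by
    ext a
    exact Ideal.algebraMap_residueField_eq_zero
  have i1 := (isOpenImmersion_chartFunctor L h f₁).base_open.injective
  have i2 := (isOpenImmersion_chartFunctor L h f₂).base_open.injective
  refine ⟨s₁.union s₂, homOfLE (s₁.subset_union_left s₂), homOfLE (s₁.subset_union_right s₂),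
    PrimeSpectrum.comap u.toRingHom o, i1 ?_, i2 ?_⟩
  · change PrimeSpectrum.comap ((u.comp r₁).comp ρ₁).toRingHom o = p
    rw [e1, ho]
  · change PrimeSpectrum.comap ((u.comp r₂).comp ρ₂).toRingHom o =
      PrimeSpectrum.comap ρ₂.toRingHom x₂
    rw [e2, ho, hp]

end

end

end NodeHilb


namespace NodeHilb

noncomputable section

/-! ### Gluing the charts -/

section

variable {k R : Type} [CommRing k] [CommRing R] [Algebra k R]
  {t : k} {W : Set (MvPolynomial (Fin 2) k)} {x y : R} {m : ℕ}
  {S : Type} [CommRing S] [Algebra k S]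

/-- A scheme with an open covering by the spectra of the chart rings. -/
structure HilbAtlas (C : ∀ i : Fin m, ChartRing k x y {i}) where
  X : Scheme.{0}
  str : X ⟶ Spec (CommRingCat.of k)
  ι : ∀ i, Spec (CommRingCat.of (C i).ring) ⟶ X
  isOpenImmersion : ∀ i, IsOpenImmersion (ι i)
  ι_str : ∀ i, ι i ≫ str = Spec.map (CommRingCat.ofHom (algebraMap k (C i).ring))
  cover : ∀ p : X, ∃ i z, ι i z = p
  comp_ι_eq_iff : ∀ (i j : Fin m) (S : Type) [CommRing S] [Algebra k S] (u : (C i).ring →ₐ[k] S)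
    (v : (C j).ring →ₐ[k] S), specHom u ≫ ι i = specHom v ≫ ι j ↔
      (C i).ideal.map (tmap R u) = (C j).ideal.map (tmap R v)

attribute [instance] HilbAtlas.isOpenImmersion

lemma ChartRing.specHom_res_comp {s : Finset (Fin m)} (C C' : ChartRing k x y s) :
    specHom (C.res C' subset_rfl) ≫ specHom (C'.res C subset_rfl) = 𝟙 _ := by
  rw [← specHom_comp, ← specHom_id (k := k)]
  congr 1
  exact C'.hom_ext _ _ _ (by
    rw [← map_tmap_tmap, ChartRing.map_res, ChartRing.map_res, tmap_id, Ideal.map_id])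

lemma ChartRing.isIso_specHom_res {s : Finset (Fin m)} (C C' : ChartRing k x y s) :
    IsIso (specHom (C.res C' subset_rfl)) :=
  ⟨specHom (C'.res C subset_rfl), C.specHom_res_comp C', C'.specHom_res_comp C⟩

/-- The intersections of charts form a locally directed diagram of open immersions, and its colimit
is the scheme sought. What has to be extracted is that two `S`-points from different charts are
equal exactly when their families are (`hkey`); one then compares both through the intersection of
the two charts. -/
theorem exists_hilbAtlas (h : IsGerm t W x y) (C : ∀ i : Fin m, ChartRing k x y {i}) :
    Nonempty (HilbAtlas C) := by
  let L (s : ChartIndex m) : ChartRing k x y (OrderDual.ofDual s).1 :=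
    ((C _).exists_extend h (OrderDual.ofDual s).2.choose_spec).some
  let F := chartFunctor L
  have hopen {s s' : ChartIndex m} (f : s ⟶ s') : IsOpenImmersion (F.map f) :=
    isOpenImmersion_chartFunctor L h f
  have hdir : (F ⋙ Scheme.forget).IsLocallyDirected := isLocallyDirected_chartFunctor L h
  let X := Limits.colimit F
  let ι (s : ChartIndex m) : Spec (CommRingCat.of (L s).ring) ⟶ X := Limits.colimit.ι F s
  have hι (s) : IsOpenImmersion (ι s) := inferInstanceAs (IsOpenImmersion (Limits.colimit.ι F s))
  have hmono (s) : Mono (ι s) := inferInstance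
  have hw {s s' : ChartIndex m} (hs : (OrderDual.ofDual s').1 ⊆ (OrderDual.ofDual s).1) :
      specHom ((L s').res (L s) hs) ≫ ι s' = ι s :=
    Limits.colimit.w F (homOfLE hs : s ⟶ s')
  let str : X ⟶ Spec (CommRingCat.of k) := Limits.colimit.desc F
    { pt := Spec (CommRingCat.of k)
      ι := { app := fun s ↦ Spec.map (CommRingCat.ofHom (algebraMap k (L s).ring))
             naturality := fun s s' f ↦ by
               exact (specHom_structure _).trans (Category.comp_id _).symm } }
  have hstr (s) : ι s ≫ str = Spec.map (CommRingCat.ofHom (algebraMap k (L s).ring)) :=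
    Limits.colimit.ι_desc _ _
  -- If `δ` were not a unit on `S`, it would lie in a maximal ideal. The image of that closed point
  -- lies in both charts, hence comes from an intersection `s''` contained in both, where `δ` is
  -- invertible.
  have hback (s s' : ChartIndex m) {S : Type} [CommRing S] [Algebra k S]
      (u : (L s).ring →ₐ[k] S) (v : (L s').ring →ₐ[k] S)
      (e : specHom u ≫ ι s = specHom v ≫ ι s') :
      IsChartOn x y (OrderDual.ofDual s').1 ((L s).ideal.map (tmap R u)) := by
    obtain ⟨δ, hδ⟩ := exists_isChartOn_iff h (OrderDual.ofDual s).2 (L s).isChartOn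
      (OrderDual.ofDual s').1
    rw [hδ]
    by_contra hu
    obtain ⟨𝔪, hm, hle⟩ := exists_max_ideal_of_mem_nonunits hu
    let p : Spec (CommRingCat.of S) := (⟨𝔪, hm.isPrime⟩ : PrimeSpectrum S)
    have hp : ι s (specHom u p) = ι s' (specHom v p) := by
      rw [← Scheme.Hom.comp_apply, ← Scheme.Hom.comp_apply, e]
    obtain ⟨s'', f, f', z, hz, -⟩ := (Scheme.IsLocallyDirected.ι_eq_ι_iff F).mp hp
    have h1 : PrimeSpectrum.comap ((L s).res (L s'') (leOfHom f)).toRingHom z =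
        PrimeSpectrum.comap u.toRingHom ⟨𝔪, hm.isPrime⟩ := hz
    have h2 : δ ∈ (PrimeSpectrum.comap u.toRingHom ⟨𝔪, hm.isPrime⟩).asIdeal := hle
    rw [← h1] at h2
    refine z.2.ne_top (Ideal.eq_top_of_isUnit_mem _ h2 ((hδ _ _).mp ?_))
    rw [ChartRing.map_res]
    exact fun i hi ↦ (L s'').isChartOn i (leOfHom f' hi)
  have hkey (s s' : ChartIndex m) {S : Type} [CommRing S] [Algebra k S]
      (u : (L s).ring →ₐ[k] S) (v : (L s').ring →ₐ[k] S) :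
      specHom u ≫ ι s = specHom v ≫ ι s' ↔
        (L s).ideal.map (tmap R u) = (L s').ideal.map (tmap R v) := by
    have hs := s.subset_union_left s'
    have hs' := s.subset_union_right s'
    constructor
    · intro e
      obtain ⟨w, hw1⟩ := (L (s.union s')).exists_hom S _
        (((L s).isChartOn.map h u).union (hback s s' u v e))
      obtain ⟨w', hw2⟩ := (L (s.union s')).exists_hom S _
        ((hback s' s v u e.symm).union ((L s').isChartOn.map h v))
      have e1 := (L s).comp_res_eq _ hs hw1.symm
      have e2 := (L s').comp_res_eq _ hs' hw2.symm
      rw [← e1, ← e2, ← specHom_comp_assoc, ← specHom_comp_assoc, hw, hw, cancel_mono] at e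
      rw [← hw1, ← hw2, specHom_injective e]
    · intro e
      obtain ⟨w, hw1⟩ := (L (s.union s')).exists_hom S _
        (((L s).isChartOn.map h u).union (s' := s') (e ▸ (L s').isChartOn.map h v))
      rw [← (L s).comp_res_eq _ hs hw1.symm, ← (L s').comp_res_eq _ hs' (hw1.trans e).symm,
        ← specHom_comp_assoc, ← specHom_comp_assoc, hw, hw]
  -- The rings chosen in `L` for the singletons need not be the given `C i`; both represent the same
  -- families and are identified by the restriction maps.
  let σ (i : Fin m) : ChartIndex m := OrderDual.toDual ⟨{i}, Finset.singleton_nonempty i⟩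
  let a (i : Fin m) : (L (σ i)).ring →ₐ[k] (C i).ring := (L (σ i)).res (C i) subset_rfl
  have hai (i) : (L (σ i)).ideal.map (tmap R (a i)) = (C i).ideal := (L (σ i)).map_res (C i) _
  have ha (i) : IsIso (specHom (a i)) := (L (σ i)).isIso_specHom_res (C i)
  refine ⟨⟨X, str, fun i ↦ specHom (a i) ≫ ι (σ i), fun i ↦ inferInstance, fun i ↦ ?_, fun p ↦ ?_,
    fun i j S _ _ u v ↦ ?_⟩⟩
  · rw [Category.assoc, hstr, specHom_structure]
  · obtain ⟨s, z, rfl⟩ := Scheme.IsLocallyDirected.ι_jointly_surjective F p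
    obtain ⟨i, hi⟩ := (OrderDual.ofDual s).2
    have hsub : (OrderDual.ofDual (σ i)).1 ⊆ (OrderDual.ofDual s).1 :=
      Finset.singleton_subset_iff.mpr hi
    refine ⟨i, inv (specHom (a i)) (specHom ((L (σ i)).res (L s) hsub) z), ?_⟩
    have e : inv (specHom (a i)) ≫ specHom (a i) ≫ ι (σ i) = ι (σ i) :=
      IsIso.inv_hom_id_assoc _ _
    have e1 := congrArg (fun f ↦ f (specHom ((L (σ i)).res (L s) hsub) z)) e
    have e2 := congrArg (fun f ↦ f z) (hw hsub)
    exact e1.trans e2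
  · rw [specHom_comp_assoc, specHom_comp_assoc, hkey, ← map_tmap_tmap, ← map_tmap_tmap]
    rw [hai, hai]

end

end

end NodeHilb


namespace NodeHilb

noncomputable section

/-! ### Gluing morphisms from a spectrum -/

section GlueSpec

variable {k : Type} [CommRing k] {S : Type} [CommRing S] [Algebra k S] {X : Scheme.{0}}

lemma span_range_eq_top {P : S → Prop} (h : ∀ 𝔭 : PrimeSpectrum S, ∃ f ∉ 𝔭.asIdeal, P f) :
    Ideal.span (Set.range (fun f : {f : S // P f} ↦ f.1)) = ⊤ := by
  obtain ⟨T, hT, hP⟩ := exists_finset_span_eq_top h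
  rw [← top_le_iff, ← hT]
  exact Ideal.span_mono fun f hf ↦ ⟨⟨f, hP f hf⟩, rfl⟩

/-- Morphisms from a spectrum that agree locally are equal. -/
lemma spec_hom_ext_of_local {p p' : Spec (CommRingCat.of S) ⟶ X}
    (h : ∀ 𝔭 : PrimeSpectrum S, ∃ f ∉ 𝔭.asIdeal,
      specHom (locHom k f) ≫ p = specHom (locHom k f) ≫ p') : p = p' :=
  (Scheme.affineOpenCoverOfSpanRangeEqTop (R := CommRingCat.of S) _
    (span_range_eq_top h)).openCover.hom_ext _ _ fun f ↦ f.2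

/-- Morphisms from the members of a covering of a spectrum that agree on overlaps can be glued. -/
lemma exists_glued_hom {P : S → Prop} (h : ∀ 𝔭 : PrimeSpectrum S, ∃ f ∉ 𝔭.asIdeal, P f)
    (q : ∀ f, P f → (Spec (CommRingCat.of (Localization.Away f)) ⟶ X))
    (hq : ∀ f hf g hg (S' : Type) [CommRing S'] [Algebra k S']
      (φ : Localization.Away f →ₐ[k] S') (ψ : Localization.Away g →ₐ[k] S'),
      φ.comp (locHom k f) = ψ.comp (locHom k g) → specHom φ ≫ q f hf = specHom ψ ≫ q g hg) :
    ∃ p : Spec (CommRingCat.of S) ⟶ X, ∀ f hf, specHom (locHom k f) ≫ p = q f hf := by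
  let 𝒰 := (Scheme.affineOpenCoverOfSpanRangeEqTop (R := CommRingCat.of S) _
    (span_range_eq_top h)).openCover
  refine ⟨𝒰.glueMorphisms (fun f ↦ q f.1 f.2) fun f g ↦ ?_, fun f hf ↦
    𝒰.ι_glueMorphisms _ _ ⟨f, hf⟩⟩
  let e := pullbackSpecIso S (Localization.Away f.1) (Localization.Away g.1)
  let φ : Localization.Away f.1 →ₐ[k] Localization.Away f.1 ⊗[S] Localization.Away g.1 :=
    (Algebra.TensorProduct.includeLeft : Localization.Away f.1 →ₐ[S] _).restrictScalars k
  let ψ : Localization.Away g.1 →ₐ[k] Localization.Away f.1 ⊗[S] Localization.Away g.1 :=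
    (Algebra.TensorProduct.includeRight : _ →ₐ[S] _).restrictScalars k
  have h1 : specHom φ ≫ q f.1 f.2 = specHom ψ ≫ q g.1 g.2 := by
    refine hq _ _ _ _ _ φ ψ (AlgHom.ext fun s ↦ ?_)
    change algebraMap S (Localization.Away f.1) s ⊗ₜ[S] (1 : Localization.Away g.1) =
      (1 : Localization.Away f.1) ⊗ₜ[S] algebraMap S (Localization.Away g.1) s
    rw [Algebra.algebraMap_eq_smul_one, Algebra.algebraMap_eq_smul_one, TensorProduct.smul_tmul]
  have h2 : e.inv ≫ Limits.pullback.fst _ _ = specHom φ :=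
    pullbackSpecIso_inv_fst S (Localization.Away f.1) (Localization.Away g.1)
  have h3 : e.inv ≫ Limits.pullback.snd _ _ = specHom ψ :=
    pullbackSpecIso_inv_snd S (Localization.Away f.1) (Localization.Away g.1)
  rw [← h2, ← h3, Category.assoc, Category.assoc] at h1
  exact (cancel_epi e.inv).mp h1

end GlueSpec

/-! ### The Hilbert scheme -/

section

variable {k R : Type} [CommRing k] [CommRing R] [Algebra k R]
  {t : k} {W : Set (MvPolynomial (Fin 2) k)} {x y : R} {m : ℕ}

lemma exists_hilbFamily_of_isChart (h : IsGerm t W x y) {S : Type} [CommRing S] [Algebra k S]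
    {n r : ℕ} {I : Ideal (S ⊗[k] R)} (hI : IsChart x y n r I) (hm : n + 1 + r = m) :
    ∃ g : HilbFamily k R S m, g.ideal = I := by
  obtain ⟨z, hz, rfl⟩ := exists_isChartPoint h hI
  exact exists_hilbFamily h hz hm

namespace HilbAtlas

variable {C : ∀ i : Fin m, ChartRing k x y {i}} (A : HilbAtlas C)

/-- The morphism `p` corresponds to the family with the ideal `I`. -/
def Represents {S : Type} [CommRing S] [Algebra k S] (p : Spec (CommRingCat.of S) ⟶ A.X)
    (I : Ideal (S ⊗[k] R)) : Prop :=
  ∀ (i : Fin m) (S' : Type) [CommRing S'] [Algebra k S'] (φ : S →ₐ[k] S')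
    (u : (C i).ring →ₐ[k] S'), specHom φ ≫ p = specHom u ≫ A.ι i →
    (C i).ideal.map (tmap R u) = I.map (tmap R φ)

variable {S : Type} [CommRing S] [Algebra k S]

lemma exists_local_chart (p : SPoint A.str S) (𝔭 : PrimeSpectrum S) :
    ∃ f ∉ 𝔭.asIdeal, ∃ (i : Fin m) (u : (C i).ring →ₐ[k] Localization.Away f),
      specHom (locHom k f) ≫ p.1 = specHom u ≫ A.ι i := by
  obtain ⟨i, z, hz⟩ := A.cover (p.1 𝔭)
  obtain ⟨_, ⟨f, rfl⟩, hf, hfU⟩ :=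
    PrimeSpectrum.isTopologicalBasis_basic_opens.exists_subset_of_mem_open
      (show 𝔭 ∈ (p.1 ⁻¹ᵁ (A.ι i).opensRange).carrier from ⟨z, hz⟩)
      (p.1 ⁻¹ᵁ (A.ι i).opensRange).isOpen
  have hrange : Set.range (specHom (locHom k f) ≫ p.1) ⊆ Set.range (A.ι i) := by
    rintro _ ⟨q, rfl⟩
    have h1 : specHom (locHom k f) q ∈ (PrimeSpectrum.basicOpen f : Set (PrimeSpectrum S)) := by
      rw [← PrimeSpectrum.localization_away_comap_range (Localization.Away f) f]
      exact ⟨q, rfl⟩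
    exact hfU h1
  obtain ⟨u, hu⟩ := exists_specHom_eq (k := k)
    (IsOpenImmersion.lift (A.ι i) (specHom (locHom k f) ≫ p.1) hrange) (by
      rw [← A.ι_str, IsOpenImmersion.lift_fac_assoc, Category.assoc, p.2, specHom_structure])
  exact ⟨f, hf, i, u, by rw [← hu, IsOpenImmersion.lift_fac]⟩

/-- One chart near each point is enough: equality of ideals is local, and `comp_ι_eq_iff` translates
between different charts. -/
lemma represents_of_local {p : Spec (CommRingCat.of S) ⟶ A.X} {I : Ideal (S ⊗[k] R)}
    (h : ∀ 𝔭 : PrimeSpectrum S, ∃ f ∉ 𝔭.asIdeal,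
      ∃ (i : Fin m) (u : (C i).ring →ₐ[k] Localization.Away f),
        specHom (locHom k f) ≫ p = specHom u ≫ A.ι i ∧
        (C i).ideal.map (tmap R u) = I.map (tmap R (locHom k f))) : A.Represents p I := by
  intro i S' _ _ φ u hu
  refine ideal_eq_of_local fun 𝔮 ↦ ?_
  obtain ⟨f, hf, j, v, hv, hI⟩ := h (PrimeSpectrum.comap φ.toRingHom 𝔮)
  refine ⟨φ f, hf, ?_⟩
  obtain ⟨ψ, hψ⟩ := exists_locHom_lift f ((locHom k (φ f)).comp φ) (isUnit_locHom k (φ f))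
  rw [map_tmap_tmap, map_tmap_tmap, ← hψ, ← map_tmap_tmap I, ← hI, map_tmap_tmap,
    ← A.comp_ι_eq_iff, ← specHom_comp_assoc, ← hu, specHom_comp_assoc, ← hψ,
    ← specHom_comp_assoc, hv, specHom_comp_assoc]

lemma Represents.map {p : Spec (CommRingCat.of S) ⟶ A.X} {I : Ideal (S ⊗[k] R)}
    (h : A.Represents p I) {S' : Type} [CommRing S'] [Algebra k S'] (f : S →ₐ[k] S') :
    A.Represents (specHom f ≫ p) (I.map (tmap R f)) := by
  intro i S'' _ _ φ u hu
  rw [specHom_comp_assoc] at hu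
  rw [h i S'' _ u hu, map_tmap_tmap]

lemma Represents.ideal_unique {p : SPoint A.str S} {I I' : Ideal (S ⊗[k] R)}
    (h : A.Represents p.1 I) (h' : A.Represents p.1 I') : I = I' :=
  ideal_eq_of_local fun 𝔭 ↦ by
    obtain ⟨f, hf, i, u, hu⟩ := A.exists_local_chart p 𝔭
    exact ⟨f, hf, (h i _ _ u hu).symm.trans (h' i _ _ u hu)⟩

lemma Represents.hom_unique {p p' : SPoint A.str S} {I : Ideal (S ⊗[k] R)}
    (h : A.Represents p.1 I) (h' : A.Represents p'.1 I) : p = p' := by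
  refine Subtype.ext (spec_hom_ext_of_local (k := k) fun 𝔭 ↦ ?_)
  obtain ⟨f, hf, i, u, hu⟩ := A.exists_local_chart p 𝔭
  obtain ⟨g, hg, j, v, hv⟩ := A.exists_local_chart p' 𝔭
  refine ⟨f * g, 𝔭.2.mul_notMem hf hg, ?_⟩
  have hfg := isUnit_locHom k (f * g)
  rw [map_mul] at hfg
  obtain ⟨ψ, hψ⟩ := exists_locHom_lift f (locHom k (f * g)) (isUnit_of_mul_isUnit_left hfg)
  obtain ⟨ψ', hψ'⟩ := exists_locHom_lift g (locHom k (f * g)) (isUnit_of_mul_isUnit_right hfg)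
  conv_lhs => rw [← hψ, ← specHom_comp_assoc, hu, specHom_comp_assoc]
  conv_rhs => rw [← hψ', ← specHom_comp_assoc, hv, specHom_comp_assoc]
  rw [A.comp_ι_eq_iff, ← map_tmap_tmap, ← map_tmap_tmap, h i _ _ u hu, h' j _ _ v hv,
    map_tmap_tmap, map_tmap_tmap, hψ, hψ']

/-- Locally a morphism factors through a chart and pulls back its universal ideal. By
`comp_ι_eq_iff` these ideals agree on overlaps, so they glue to a family. -/
lemma exists_family (hR : IsGerm t W x y) (p : SPoint A.str S) :
    ∃ g : HilbFamily k R S m, A.Represents p.1 g.ideal := by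
  obtain ⟨T, hT, hP⟩ := exists_finset_span_eq_top (A.exists_local_chart p)
  choose i u hu using hP
  classical
  obtain ⟨J, hJ⟩ := exists_glued_ideal T
    (fun f ↦ if hf : f ∈ T then (C (i f hf)).ideal.map (tmap R (u f hf)) else ⊥)
    (fun f hf g hg S' _ _ φ ψ hφψ ↦ by
      rw [dif_pos hf, dif_pos hg, map_tmap_tmap, map_tmap_tmap, ← A.comp_ι_eq_iff, ← specHom_comp_assoc,
        ← specHom_comp_assoc, ← hu f hf, ← hu g hg, specHom_comp_assoc, specHom_comp_assoc, hφψ])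
  obtain ⟨g, rfl⟩ := exists_glued_family (m := m) hT J (fun f hf ↦ by
    rw [hJ f hf, dif_pos hf]
    exact exists_hilbFamily_of_isChart hR
      (((C (i f hf)).isChartOn _ (Finset.mem_singleton_self _)).map hR (u f hf)) (by omega))
  refine ⟨g, A.represents_of_local fun 𝔭 ↦ ?_⟩
  obtain ⟨f, hf, hfp⟩ := exists_mem_notMem hT 𝔭
  exact ⟨f, hfp, i f hf, u f hf, hu f hf, by rw [hJ f hf, dif_pos hf]⟩

/-- Conversely, a family lies locally in some chart and is classified there; the local morphisms
agree on overlaps by the other direction of `comp_ι_eq_iff`. -/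
lemma exists_point (hR : IsGerm t W x y) (hm : 1 ≤ m) (g : HilbFamily k R S m) :
    ∃ p : SPoint A.str S, A.Represents p.1 g.ideal := by
  have hloc (𝔭 : PrimeSpectrum S) : ∃ f ∉ 𝔭.asIdeal,
      ∃ (i : Fin m) (u : (C i).ring →ₐ[k] Localization.Away f),
        (C i).ideal.map (tmap R u) = g.ideal.map (tmap R (locHom k f)) := by
    obtain ⟨f, hf, n, r, hnr, hI⟩ := g.exists_isChart hR hm 𝔭
    refine ⟨f, hf, ⟨r, by omega⟩, (C _).exists_hom _ _ fun j hj ↦ ?_⟩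
    rw [Finset.mem_singleton] at hj
    subst hj
    have : m - 1 - r = n := by omega
    rw [this]
    exact hI
  choose i u hu using fun (f : S) (hf : ∃ (i : Fin m) (u : (C i).ring →ₐ[k] Localization.Away f),
        (C i).ideal.map (tmap R u) = g.ideal.map (tmap R (locHom k f))) ↦ hf
  obtain ⟨p, hp⟩ := exists_glued_hom (k := k) hloc (fun f hf ↦ specHom (u f hf) ≫ A.ι (i f hf))
    (fun f hf f' hf' S' _ _ φ ψ hφψ ↦ by
      rw [specHom_comp_assoc, specHom_comp_assoc, A.comp_ι_eq_iff, ← map_tmap_tmap,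
        ← map_tmap_tmap, hu, hu, map_tmap_tmap, map_tmap_tmap, hφψ])
  refine ⟨⟨p, spec_hom_ext_of_local (k := k) fun 𝔭 ↦ ?_⟩, A.represents_of_local fun 𝔭 ↦ ?_⟩
  · obtain ⟨f, hfp, hf⟩ := hloc 𝔭
    refine ⟨f, hfp, ?_⟩
    rw [← Category.assoc, hp f hf, Category.assoc, A.ι_str, specHom_structure, specHom_structure]
  · obtain ⟨f, hfp, hf⟩ := hloc 𝔭
    exact ⟨f, hfp, _, _, hp f hf, hu f hf⟩

/-- The Hilbert scheme obtained by gluing the charts. -/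
def hilbertScheme (hR : IsGerm t W x y) (hm : 1 ≤ m) : HilbertScheme k R m where
  carrier := A.X
  str := A.str
  family S _ _ := Equiv.ofBijective (fun p ↦ (A.exists_family hR p).choose) (by
    constructor
    · intro p p' hpp
      have h := (A.exists_family hR p).choose_spec
      have h' := (A.exists_family hR p').choose_spec
      simp only at hpp
      rw [hpp] at h
      exact h.hom_unique A h'
    · intro g
      obtain ⟨p, hp⟩ := A.exists_point hR hm g
      exact ⟨p, HilbFamily.ext ((A.exists_family hR p).choose_spec.ideal_unique A hp)⟩)
  natural S S' _ _ _ _ f p p' hp := by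
    have h := (A.exists_family hR p).choose_spec.map A f
    rw [← hp] at h
    exact (A.exists_family hR p').choose_spec.ideal_unique A h

lemma family_ideal (hR : IsGerm t W x y) (hm : 1 ≤ m) (i : Fin m) (u : (C i).ring →ₐ[k] S)
    (p : SPoint (A.hilbertScheme hR hm).str S) (hp : p.1 = specHom u ≫ A.ι i) :
    ((A.hilbertScheme hR hm).family S p).ideal = (C i).ideal.map (tmap R u) := by
  have h := (A.exists_family hR p).choose_spec i S (AlgHom.id k S) u
    (by rw [specHom_id, Category.id_comp]; exact hp)
  rw [h, tmap_id, Ideal.map_id]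
  rfl

end HilbAtlas

end

end

end NodeHilb


namespace NodeHilb

noncomputable section

/-! ### Ideal sheaves on affine charts -/

section Chart

variable {A : Type} [CommRing A] {X : Scheme.{0}} (j : Spec (CommRingCat.of A) ⟶ X)
  [IsOpenImmersion j]

/-- The image of an affine open immersion. -/
def chartOpen : X.affineOpens := ⟨j.opensRange, isAffineOpen_opensRange j⟩

lemma isAffineOpen_chartOpen : IsAffineOpen (chartOpen j).1 := (chartOpen j).2

lemma mem_chartOpen (z : Spec (CommRingCat.of A)) : j z ∈ (chartOpen j).1 := ⟨z, rfl⟩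

lemma top_le_preimage_chartOpen : ⊤ ≤ j ⁻¹ᵁ (chartOpen j).1 := fun z _ ↦ mem_chartOpen j z

/-- The identification of the sections on the image of an affine chart. -/
def chartHom : Γ(X, (chartOpen j).1) ⟶ CommRingCat.of A :=
  j.appLE (chartOpen j).1 ⊤ (top_le_preimage_chartOpen j) ≫ (Scheme.ΓSpecIso _).hom

instance : IsIso (chartHom j) := by
  have h2 : IsIso (j.app (chartOpen j).1) := j.isIso_app _ le_rfl
  have : IsIso (j.appLE (chartOpen j).1 ⊤ (top_le_preimage_chartOpen j)) := by
    have h : (⊤ : (Spec (CommRingCat.of A)).Opens) = j ⁻¹ᵁ (chartOpen j).1 :=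
      le_antisymm (top_le_preimage_chartOpen j) le_top
    have h3 : j.appLE (chartOpen j).1 ⊤ (top_le_preimage_chartOpen j) =
      j.app (chartOpen j).1 ≫ (Spec (CommRingCat.of A)).presheaf.map (eqToHom h).op := rfl
    rw [h3]
    exact IsIso.comp_isIso' h2 inferInstance
  exact IsIso.comp_isIso' this inferInstance

lemma specMap_chartHom : Spec.map (chartHom j) ≫ (isAffineOpen_chartOpen j).fromSpec = j := by
  rw [chartHom, Spec.map_comp, Category.assoc,
    (isAffineOpen_chartOpen j).SpecMap_appLE_fromSpec j (isAffineOpen_top _), IsAffineOpen.fromSpec_top,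
    Scheme.isoSpec_Spec_inv, ← Category.assoc, ← Spec.map_comp]
  simp

lemma bijective_chartHom : Function.Bijective (chartHom j).hom :=
  (asIso (chartHom j)).commRingCatIsoToRingEquiv.bijective

/-- The ideal of an ideal sheaf on an affine chart. -/
def sheafIdeal (D : X.IdealSheafData) : Ideal A := (D.ideal (chartOpen j)).map (chartHom j).hom

lemma comap_sheafIdeal (D : X.IdealSheafData) :
    (sheafIdeal j D).comap (chartHom j).hom = D.ideal (chartOpen j) :=
  Ideal.comap_map_of_bijective _ (bijective_chartHom j)

lemma sheafIdeal_sup (D D' : X.IdealSheafData) :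
    sheafIdeal j (D ⊔ D') = sheafIdeal j D ⊔ sheafIdeal j D' := Ideal.map_sup _ _ _

lemma sheafIdeal_top : sheafIdeal j (⊤ : X.IdealSheafData) = ⊤ := Ideal.map_top _

lemma sheafIdeal_bot : sheafIdeal j (⊥ : X.IdealSheafData) = ⊥ := Ideal.map_bot

lemma mem_sheafIdeal_iff (D : X.IdealSheafData) (a : Γ(X, (chartOpen j).1)) :
    (chartHom j).hom a ∈ sheafIdeal j D ↔ a ∈ D.ideal (chartOpen j) := by
  rw [← comap_sheafIdeal j D, Ideal.mem_comap]

lemma sheafIdeal_iInf {ι : Type} [Finite ι] (D : ι → X.IdealSheafData) :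
    sheafIdeal j (⨅ i, D i) = ⨅ i, sheafIdeal j (D i) := by
  ext a
  obtain ⟨a, rfl⟩ := (bijective_chartHom j).2 a
  rw [mem_sheafIdeal_iff, Scheme.IdealSheafData.ideal_iInf]
  have h : a ∈ (⨅ i, (D i).ideal) (chartOpen j) ↔ ∀ i, a ∈ (D i).ideal (chartOpen j) := by simp
  rw [h, Submodule.mem_iInf]
  exact forall_congr' fun i ↦ (mem_sheafIdeal_iff j (D i) a).symm

lemma mem_support_iff_sheafIdeal (D : X.IdealSheafData) (z : Spec (CommRingCat.of A)) :
    j z ∈ D.support ↔ sheafIdeal j D ≤ z.asIdeal := by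
  rw [Scheme.IdealSheafData.mem_support_iff_of_mem (mem_chartOpen j z)]
  have h : j z = (isAffineOpen_chartOpen j).fromSpec (Spec.map (chartHom j) z) := by
    rw [← Scheme.Hom.comp_apply, specMap_chartHom]
  have h2 : j z ∈ X.zeroLocus (U := (chartOpen j).1) (D.ideal (chartOpen j)) ↔
      Spec.map (chartHom j) z ∈ (isAffineOpen_chartOpen j).fromSpec ⁻¹'
        X.zeroLocus (U := (chartOpen j).1) (D.ideal (chartOpen j)) := by
    rw [h]; rfl
  rw [h2, IsAffineOpen.fromSpec_preimage_zeroLocus, sheafIdeal, Ideal.map_le_iff_le_comap]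
  rfl

/-- The components are defined as reduced structures on closed sets; this computes their ideals in
the charts. -/
lemma sheafIdeal_vanishingIdeal (Z : TopologicalSpace.Closeds X) :
    sheafIdeal j (Scheme.IdealSheafData.vanishingIdeal Z) =
      PrimeSpectrum.vanishingIdeal (j ⁻¹' (Z : Set X)) := by
  ext a
  obtain ⟨a, rfl⟩ := (bijective_chartHom j).2 a
  rw [mem_sheafIdeal_iff, Scheme.IdealSheafData.vanishingIdeal_ideal,
    PrimeSpectrum.mem_vanishingIdeal, PrimeSpectrum.mem_vanishingIdeal]
  have hj (z : Spec (CommRingCat.of A)) :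
      j z = (isAffineOpen_chartOpen j).fromSpec (Spec.map (chartHom j) z) := by
    rw [← Scheme.Hom.comp_apply, specMap_chartHom]
  constructor
  · intro h z hz
    exact h (Spec.map (chartHom j) z) (by
      have h2 : j (show Spec (CommRingCat.of A) from z) ∈ (Z : Set X) := hz
      rw [hj] at h2
      exact h2)
  · intro h w hw
    obtain ⟨z, rfl⟩ : ∃ z, Spec.map (chartHom j) z = w :=
      (Spec.map (chartHom j)).homeomorph.surjective w
    exact h z (by
      have h2 : (isAffineOpen_chartOpen j).fromSpec (Spec.map (chartHom j) z) ∈ (Z : Set X) := hw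
      rw [← hj] at h2
      exact h2)

/-- Reduces equalities of ideal sheaves, such as those for the union and for disjointness of the
components, to ideals of the chart rings. -/
lemma idealSheaf_ext {ι : Type} {A : ι → Type} [∀ i, CommRing (A i)]
    (j : ∀ i, Spec (CommRingCat.of (A i)) ⟶ X) [∀ i, IsOpenImmersion (j i)]
    (hj : ∀ p : X, ∃ i z, j i z = p) {D D' : X.IdealSheafData}
    (h : ∀ i, sheafIdeal (j i) D = sheafIdeal (j i) D') : D = D' := by
  refine Scheme.IdealSheafData.ext_of_iSup_eq_top (fun i ↦ chartOpen (j i)) ?_ fun i ↦ ?_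
  · refine top_le_iff.1 fun p _ ↦ ?_
    obtain ⟨i, z, rfl⟩ := hj p
    exact TopologicalSpace.Opens.mem_iSup.2 ⟨i, mem_chartOpen (j i) z⟩
  · rw [← comap_sheafIdeal (j i), h, comap_sheafIdeal]

/-! ### Charts of a closed subscheme -/

/-- The last clause, that the chart contains every point of the subscheme above the ambient chart,
turns a cover of the ambient scheme into a cover of the subscheme. -/
theorem exists_subscheme_chart (D : X.IdealSheafData) :
    ∃ g : Spec (CommRingCat.of (A ⧸ sheafIdeal j D)) ⟶ D.subscheme, IsOpenImmersion g ∧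
      g ≫ D.subschemeι =
        Spec.map (CommRingCat.ofHom (Ideal.Quotient.mk (sheafIdeal j D))) ≫ j ∧
      ∀ p : D.subscheme, D.subschemeι p ∈ Set.range j → p ∈ Set.range g := by
  let e : (Γ(X, (chartOpen j).1) ⧸ D.ideal (chartOpen j)) ≃+* (A ⧸ sheafIdeal j D) :=
    Ideal.quotientEquiv _ _ (RingEquiv.ofBijective _ (bijective_chartHom j)) rfl
  let u : CommRingCat.of (Γ(X, (chartOpen j).1) ⧸ D.ideal (chartOpen j)) ⟶
    CommRingCat.of (A ⧸ sheafIdeal j D) := CommRingCat.ofHom e.toRingHom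
  have hu : IsIso u := e.toCommRingCatIso.isIso_hom
  let f : Spec (CommRingCat.of (Γ(X, (chartOpen j).1) ⧸ D.ideal (chartOpen j))) ⟶ D.subscheme :=
    D.subschemeCover.f (chartOpen j)
  have hf : IsOpenImmersion f := D.subschemeCover.map_prop (chartOpen j)
  have hfι : f ≫ D.subschemeι = Spec.map (CommRingCat.ofHom (Ideal.Quotient.mk _)) ≫
      (isAffineOpen_chartOpen j).fromSpec :=
    (D.subschemeCover_map_subschemeι (chartOpen j)).trans (D.glueDataObjι_ι (chartOpen j))
  refine ⟨Spec.map u ≫ f, inferInstance, ?_, fun p hp ↦ ?_⟩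
  · rw [Category.assoc, hfι]
    refine Eq.trans ?_ (congrArg (fun v ↦ Spec.map (CommRingCat.ofHom
      (Ideal.Quotient.mk (sheafIdeal j D))) ≫ v) (specMap_chartHom j))
    rw [← Category.assoc, ← Category.assoc, ← Spec.map_comp, ← Spec.map_comp]
    rfl
  · have h1 : p ∈ f.opensRange := by
      have := D.opensRange_subschemeCover_map (chartOpen j)
      have h2 : f.opensRange = D.subschemeι ⁻¹ᵁ (chartOpen j).1 := this
      rw [h2]
      exact hp
    obtain ⟨q, rfl⟩ := h1
    obtain ⟨r, rfl⟩ : ∃ r, Spec.map u r = q := (Spec.map u).homeomorph.surjective q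
    exact ⟨r, by simp⟩

/-! ### Stalks on a chart -/

/-- A point of a spectrum as a prime ideal. -/
abbrev specPt (z : Spec (CommRingCat.of A)) : PrimeSpectrum A := z

/-- The local ring at a point of an affine chart. -/
def chartStalk (z : Spec (CommRingCat.of A)) :
    X.presheaf.stalk (j z) ≃+* Localization.AtPrime (specPt z).asIdeal :=
  (asIso (j.stalkMap z) ≪≫ Spec.stalkIso (CommRingCat.of A) z).commRingCatIsoToRingEquiv

lemma germ_chartStalk (z : Spec (CommRingCat.of A)) (s : Γ(X, (chartOpen j).1)) :
    chartStalk j z (X.presheaf.germ (chartOpen j).1 (j z) (mem_chartOpen j z) s) =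
      algebraMap A _ ((chartHom j).hom s) := by
  have h : X.presheaf.germ (chartOpen j).1 (j z) (mem_chartOpen j z) ≫ j.stalkMap z ≫
      (Spec.stalkIso (CommRingCat.of A) z).hom =
      chartHom j ≫ CommRingCat.ofHom (algebraMap A (Localization.AtPrime (specPt z).asIdeal)) := by
    have h1 : X.presheaf.germ (chartOpen j).1 (j z) (mem_chartOpen j z) ≫ j.stalkMap z =
        j.app (chartOpen j).1 ≫ (Spec (CommRingCat.of A)).presheaf.germ (j ⁻¹ᵁ (chartOpen j).1) z
          (mem_chartOpen j z) :=
      j.germ_stalkMap (chartOpen j).1 z (mem_chartOpen j z)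
    have h3 : (Spec (CommRingCat.of A)).presheaf.germ (j ⁻¹ᵁ (chartOpen j).1) z
          (mem_chartOpen j z) =
        (Spec (CommRingCat.of A)).presheaf.map (homOfLE (top_le_preimage_chartOpen j)).op ≫
          (Spec (CommRingCat.of A)).presheaf.germ ⊤ z trivial :=
      ((Spec (CommRingCat.of A)).presheaf.germ_res (homOfLE (top_le_preimage_chartOpen j)) z
        trivial).symm
    have h2 := Spec.germ_stalkMapIso_hom (R := CommRingCat.of A) (specPt z)
    have h4 := congrArg (fun v ↦ v ≫ (Spec.stalkIso (CommRingCat.of A) z).hom) h1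
    have h5 := congrArg (fun v ↦ (j.app (chartOpen j).1 ≫ v) ≫
      (Spec.stalkIso (CommRingCat.of A) z).hom) h3
    have h6 := congrArg (fun v ↦ (j.app (chartOpen j).1 ≫
      (Spec (CommRingCat.of A)).presheaf.map (homOfLE (top_le_preimage_chartOpen j)).op) ≫ v) h2
    rw [chartHom, Scheme.Hom.appLE]
    simp only [Category.assoc] at h4 h5 h6 ⊢
    exact h4.trans (h5.trans h6)
  exact congrArg (fun v ↦ v.hom s) h

lemma chartStalk_stalkHom {k : Type} [CommRing k] [Algebra k A]
    (s : X ⟶ Spec (CommRingCat.of k))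
    (hs : j ≫ s = Spec.map (CommRingCat.ofHom (algebraMap k A))) (z : Spec (CommRingCat.of A))
    (a : k) : chartStalk j z (stalkHom s (j z) a) = algebraMap A _ (algebraMap k A a) := by
  have h : ((Scheme.ΓSpecIso (CommRingCat.of k)).inv ≫ s.appTop ≫
      X.presheaf.germ ⊤ (j z) trivial) ≫ j.stalkMap z ≫
      (Spec.stalkIso (CommRingCat.of A) z).hom =
      CommRingCat.ofHom (algebraMap k A) ≫
        CommRingCat.ofHom (algebraMap A (Localization.AtPrime (specPt z).asIdeal)) := by
    have h1 : X.presheaf.germ ⊤ (j z) trivial ≫ j.stalkMap z =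
        j.app ⊤ ≫ (Spec (CommRingCat.of A)).presheaf.germ ⊤ z trivial :=
      j.germ_stalkMap ⊤ z trivial
    have h2 := Spec.germ_stalkMapIso_hom (R := CommRingCat.of A) (specPt z)
    have h3 : s.appTop ≫ j.app ⊤ = (Spec.map (CommRingCat.ofHom (algebraMap k A))).appTop := by
      rw [← hs]; rfl
    have h4 := Scheme.ΓSpecIso_inv_naturality (CommRingCat.ofHom (algebraMap k A))
    have h5 : (Scheme.ΓSpecIso (CommRingCat.of k)).inv ≫ s.appTop ≫ j.app ⊤ =
        CommRingCat.ofHom (algebraMap k A) ≫ (Scheme.ΓSpecIso (CommRingCat.of A)).inv := by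
      exact (congrArg (fun v ↦ (Scheme.ΓSpecIso (CommRingCat.of k)).inv ≫ v) h3).trans h4.symm
    have h6 := congrArg (fun v ↦ ((Scheme.ΓSpecIso (CommRingCat.of k)).inv ≫ s.appTop ≫ v) ≫
      (Spec.stalkIso (CommRingCat.of A) z).hom) h1
    have h7 := congrArg (fun v ↦ v ≫ (Spec (CommRingCat.of A)).presheaf.germ ⊤ z trivial ≫
      (Spec.stalkIso (CommRingCat.of A) z).hom) h5
    have h8 := congrArg (fun v ↦ CommRingCat.ofHom (algebraMap k A) ≫ v)
      ((Iso.inv_comp_eq _).2 h2)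
    simp only [Category.assoc] at h6 h7 h8 ⊢
    exact h6.trans (h7.trans h8)
  exact congrArg (fun v ↦ v.hom a) h

/-- Two affine neighbourhoods of `x` contain a common basic open neighbourhood, and both ideals
generate the ideal there. Hence a single affine neighbourhood already computes the supremum in
`stalkIdeal`. -/
lemma map_germ_ideal_eq (D : X.IdealSheafData) (U V : X.affineOpens) (x : X) (hU : x ∈ U.1)
    (hV : x ∈ V.1) : (D.ideal U).map (X.presheaf.germ U.1 x hU).hom =
      (D.ideal V).map (X.presheaf.germ V.1 x hV).hom := by
  obtain ⟨f, g, hfg, hxf⟩ := exists_basicOpen_le_affine_inter U.2 V.2 x ⟨hU, hV⟩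
  let T : X.affineOpens := X.affineBasicOpen f
  have hxT : x ∈ T.1 := hxf
  have hTU : T ≤ U := X.affineBasicOpen_le f
  have hTV : T ≤ V := by
    change X.basicOpen f ≤ V.1
    rw [hfg]
    exact X.basicOpen_le g
  have key (Y : X.affineOpens) (h : T ≤ Y) (hY : x ∈ Y.1) :
      (D.ideal Y).map (X.presheaf.germ Y.1 x hY).hom =
        (D.ideal T).map (X.presheaf.germ T.1 x hxT).hom := by
    rw [← D.map_ideal h, Ideal.map_map, ← CommRingCat.hom_comp]
    exact congrArg (fun v ↦ (D.ideal Y).map (CommRingCat.Hom.hom v))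
      (X.presheaf.germ_res (homOfLE h) x hxT).symm
  rw [key U hTU, key V hTV]

lemma stalkIdeal_eq (D : X.IdealSheafData) (U : X.affineOpens) (x : X) (hU : x ∈ U.1) :
    stalkIdeal D x = (D.ideal U).map (X.presheaf.germ U.1 x hU).hom :=
  le_antisymm (iSup₂_le fun V hV ↦ (map_germ_ideal_eq D V U x hV hU).le)
    (le_iSup₂_of_le U hU le_rfl)

lemma map_stalkIdeal (D : X.IdealSheafData) (z : Spec (CommRingCat.of A)) :
    (stalkIdeal D (j z)).map (chartStalk j z : _ →+* _) =
      (sheafIdeal j D).map (algebraMap A (Localization.AtPrime (specPt z).asIdeal)) := by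
  rw [stalkIdeal_eq D (chartOpen j) (j z) (mem_chartOpen j z), Ideal.map_map, sheafIdeal,
    Ideal.map_map]
  congr 1
  ext s
  exact germ_chartStalk j z s

lemma smoothAt_of_chart [Algebra ℂ A] (s : X ⟶ Spec (CommRingCat.of ℂ))
    (hs : j ≫ s = Spec.map (CommRingCat.ofHom (algebraMap ℂ A))) (z : Spec (CommRingCat.of A))
    (h : IsRegularLocalRing (Localization.AtPrime (specPt z).asIdeal))
    (h2 : Algebra.FormallySmooth ℂ (Localization.AtPrime (specPt z).asIdeal)) : SmoothAt s (j z) := by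
  refine ⟨IsRegularLocalRing.of_ringEquiv (chartStalk j z).symm, ?_⟩
  let := (stalkHom s (j z)).toAlgebra
  let e : Localization.AtPrime (specPt z).asIdeal ≃ₐ[ℂ] X.presheaf.stalk (j z) :=
    AlgEquiv.symm (AlgEquiv.ofRingEquiv (f := chartStalk j z) fun a ↦
      (chartStalk_stalkHom j s hs z a).trans
        (IsScalarTower.algebraMap_apply ℂ A _ a).symm)
  exact Algebra.FormallySmooth.of_equiv e

lemma ringKrullDim_stalk_chart (z : Spec (CommRingCat.of A)) :
    ringKrullDim (X.presheaf.stalk (j z)) = ringKrullDim (Localization.AtPrime (specPt z).asIdeal) :=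
  ringKrullDim_eq_of_ringEquiv (chartStalk j z)

end Chart

end

end NodeHilb


namespace NodeHilb

noncomputable section

/-! ### Localizations of polynomial rings -/

/-- Splitting off one variable, the kernel is a maximal ideal of a polynomial ring in one variable
over its contraction. The contraction is again the kernel of a `ℂ`-point, and the height grows by
one. -/
lemma height_ker_fin (n : ℕ) (φ : MvPolynomial (Fin n) ℂ →ₐ[ℂ] ℂ) :
    (RingHom.ker φ).height = n := by
  induction n with
  | zero =>
    refine le_antisymm ?_ bot_le
    have h1 := Ideal.height_le_ringKrullDim_of_ne_top (RingHom.ker_ne_top φ.toRingHom)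
    rw [MvPolynomial.ringKrullDim_of_isNoetherianRing] at h1
    simp only [ringKrullDim_eq_zero_of_field, Nat.card_eq_fintype_card, Fintype.card_fin,
      CharP.cast_eq_zero, add_zero] at h1
    exact_mod_cast h1
  | succ n ih =>
    let e := MvPolynomial.finSuccEquiv ℂ n
    let ψ : Polynomial (MvPolynomial (Fin n) ℂ) →ₐ[ℂ] ℂ := φ.comp e.symm.toAlgHom
    let χ : MvPolynomial (Fin n) ℂ →ₐ[ℂ] ℂ :=
      ψ.comp (IsScalarTower.toAlgHom ℂ _ (Polynomial (MvPolynomial (Fin n) ℂ)))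
    have hsurj : Function.Surjective ψ := fun a ↦ ⟨algebraMap ℂ _ a, ψ.commutes a⟩
    have hmax : (RingHom.ker ψ).IsMaximal := RingHom.ker_isMaximal_of_surjective _ hsurj
    have hover : (RingHom.ker ψ).LiesOver (RingHom.ker χ) := ⟨rfl⟩
    have h1 := Polynomial.height_eq_height_add_one (RingHom.ker χ) (RingHom.ker ψ)
    have h2 : (RingHom.ker ψ).comap e.toRingEquiv = RingHom.ker φ := by
      ext a
      simp [ψ, RingHom.mem_ker, Ideal.mem_comap]
    rw [← h2, RingEquiv.height_comap, h1, ih χ]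
    norm_cast

lemma height_ker {σ : Type} [Finite σ] (φ : MvPolynomial σ ℂ →ₐ[ℂ] ℂ) :
    (RingHom.ker φ).height = Nat.card σ := by
  let e := MvPolynomial.renameEquiv ℂ (Finite.equivFin σ)
  have h := height_ker_fin (Nat.card σ) (φ.comp e.symm.toAlgHom)
  have h2 : (RingHom.ker (φ.comp e.symm.toAlgHom)).comap e.toRingEquiv = RingHom.ker φ := by
    ext a
    simp only [RingHom.mem_ker, Ideal.mem_comap]
    exact iff_of_eq (congrArg (fun v ↦ φ v = 0) (e.symm_apply_apply a))
  rw [← h2, RingEquiv.height_comap, h]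

/-- The ring is a localization of a polynomial ring in `d` variables. -/
def IsPolyLoc (d : ℕ) (B : Type) [CommRing B] [Algebra ℂ B] : Prop :=
  ∃ (σ : Type) (_ : Finite σ) (_ : Algebra (MvPolynomial σ ℂ) B)
    (N : Submonoid (MvPolynomial σ ℂ)), IsScalarTower ℂ (MvPolynomial σ ℂ) B ∧
      IsLocalization N B ∧ Nat.card σ = d

section

variable {d : ℕ} {B : Type} [CommRing B] [Algebra ℂ B]

lemma IsPolyLoc.isRegularLocalRing (h : IsPolyLoc d B) (q : Ideal B) [q.IsPrime] :
    IsRegularLocalRing (Localization.AtPrime q) := by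
  obtain ⟨σ, _, _, N, _, _, -⟩ := h
  have : IsLocalization.AtPrime (Localization.AtPrime q)
      (q.comap (algebraMap (MvPolynomial σ ℂ) B)) :=
    IsLocalization.isLocalization_isLocalization_atPrime_isLocalization N _ q
  exact IsRegularLocalRing.of_ringEquiv (IsLocalization.algEquiv
    (q.comap (algebraMap (MvPolynomial σ ℂ) B)).primeCompl
    (Localization.AtPrime (q.comap (algebraMap (MvPolynomial σ ℂ) B)))
    (Localization.AtPrime q)).toRingEquiv

lemma IsPolyLoc.formallySmooth (h : IsPolyLoc d B) (q : Ideal B) [q.IsPrime] :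
    Algebra.FormallySmooth ℂ (Localization.AtPrime q) := by
  obtain ⟨σ, _, _, N, _, _, -⟩ := h
  have h1 : Algebra.FormallySmooth (MvPolynomial σ ℂ) B := Algebra.FormallySmooth.of_isLocalization N
  have h2 : Algebra.FormallySmooth ℂ B := Algebra.FormallySmooth.comp ℂ (MvPolynomial σ ℂ) B
  infer_instance

/-- Only primes that are kernels of `ℂ`-points are considered: these contract to kernels of
`ℂ`-points of the polynomial ring, where the height is the full number of variables. -/
lemma IsPolyLoc.ringKrullDim (h : IsPolyLoc d B) (q : Ideal B) [q.IsPrime] (φ : B →ₐ[ℂ] ℂ)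
    (hφ : RingHom.ker φ = q) : ringKrullDim (Localization.AtPrime q) = d := by
  obtain ⟨σ, _, _, N, _, _, rfl⟩ := h
  have : IsLocalization.AtPrime (Localization.AtPrime q)
      (q.comap (algebraMap (MvPolynomial σ ℂ) B)) :=
    IsLocalization.isLocalization_isLocalization_atPrime_isLocalization N _ q
  rw [IsLocalization.AtPrime.ringKrullDim_eq_height (q.comap (algebraMap (MvPolynomial σ ℂ) B))]
  have h2 : q.comap (algebraMap (MvPolynomial σ ℂ) B) =
      RingHom.ker (φ.comp (IsScalarTower.toAlgHom ℂ (MvPolynomial σ ℂ) B)) := by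
    rw [← hφ]; rfl
  rw [h2, height_ker]
  rfl

lemma IsPolyLoc.isDomain [Nontrivial B] (h : IsPolyLoc d B) : IsDomain B := by
  obtain ⟨σ, _, _, N, _, _, -⟩ := h
  refine IsLocalization.isDomain_of_le_nonZeroDivisors (M := N) B ?_
  refine le_nonZeroDivisors_of_noZeroDivisors fun h0 ↦ ?_
  have := IsLocalization.map_units B ⟨0, h0⟩
  simp at this

lemma IsPolyLoc.of_isLocalization {σ : Type} [Finite σ] {P : Type} [CommRing P] [Algebra ℂ P]
    (e : P ≃ₐ[ℂ] MvPolynomial σ ℂ) (M : Submonoid P) [Algebra P B] [IsScalarTower ℂ P B]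
    [IsLocalization M B] : IsPolyLoc (Nat.card σ) B := by
  let : Algebra (MvPolynomial σ ℂ) B :=
    ((algebraMap P B).comp (e.symm : MvPolynomial σ ℂ →+* P)).toAlgebra
  refine ⟨σ, inferInstance, inferInstance, M.map (e : P →* MvPolynomial σ ℂ),
    IsScalarTower.of_algebraMap_eq fun a ↦ ?_, ?_, rfl⟩
  · exact (IsScalarTower.algebraMap_apply ℂ P B a).trans
      (congrArg (algebraMap P B) (e.symm.commutes a).symm)
  · exact IsLocalization.isLocalization_of_base_ringEquiv M B e.toRingEquiv

/-- Localization commutes with quotients: if `P ⧸ J` is a polynomial ring, then `B ⧸ J B` is a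
localization of it. -/
lemma IsPolyLoc.quotient {σ : Type} [Finite σ] {P : Type} [CommRing P] [Algebra ℂ P]
    (J : Ideal P) (e : (P ⧸ J) ≃ₐ[ℂ] MvPolynomial σ ℂ) (M : Submonoid P) [Algebra P B]
    [IsScalarTower ℂ P B] [IsLocalization M B] :
    IsPolyLoc (Nat.card σ) (B ⧸ J.map (algebraMap P B)) := by
  have : IsScalarTower ℂ (P ⧸ J) (B ⧸ J.map (algebraMap P B)) :=
    IsScalarTower.of_algebraMap_eq fun a ↦
      congrArg (Ideal.Quotient.mk (J.map (algebraMap P B))) (IsScalarTower.algebraMap_apply ℂ P B a)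
  exact IsPolyLoc.of_isLocalization e (Algebra.algebraMapSubmonoid (P ⧸ J) M)

end

end

end NodeHilb


namespace NodeHilb

noncomputable section

/-! ### Universal chart points -/

section Universal

/-- The substitution of a pair in a polynomial in two variables. -/
def evalPair {C : Type} [CommRing C] (ρ : ℂ →+* C) (X Y : C) : MvPolynomial (Fin 2) ℂ →+* C :=
  MvPolynomial.eval₂Hom ρ ![X, Y]

lemma evalPair_X_zero {C : Type} [CommRing C] (ρ : ℂ →+* C) (X Y : C) :
    evalPair ρ X Y (MvPolynomial.X 0) = X := by simp [evalPair]

lemma evalPair_X_one {C : Type} [CommRing C] (ρ : ℂ →+* C) (X Y : C) :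
    evalPair ρ X Y (MvPolynomial.X 1) = Y := by simp [evalPair]

lemma evalPair_C {C : Type} [CommRing C] (ρ : ℂ →+* C) (X Y : C) (a : ℂ) :
    evalPair ρ X Y (MvPolynomial.C a) = ρ a := by simp [evalPair]

lemma ringHom_ext_pair {C : Type} [CommRing C] {f g : MvPolynomial (Fin 2) ℂ →+* C}
    (h : f.comp MvPolynomial.C = g.comp MvPolynomial.C)
    (h0 : f (MvPolynomial.X 0) = g (MvPolynomial.X 0))
    (h1 : f (MvPolynomial.X 1) = g (MvPolynomial.X 1)) : f = g := by
  refine MvPolynomial.ringHom_ext (fun a ↦ DFunLike.congr_fun h a) fun i ↦ ?_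
  fin_cases i
  · exact h0
  · exact h1

lemma map_evalPair {C C' : Type} [CommRing C] [CommRing C'] (ρ : ℂ →+* C) (f : C →+* C') (X Y : C)
    (w : MvPolynomial (Fin 2) ℂ) :
    f (evalPair ρ X Y w) = evalPair (f.comp ρ) (f X) (f Y) w := by
  refine DFunLike.congr_fun (ringHom_ext_pair (f := f.comp (evalPair ρ X Y)) ?_ ?_ ?_) w
  · ext a; simp [evalPair_C]
  · simp [evalPair_X_zero]
  · simp [evalPair_X_one]

/-- The polynomials in two variables with nonzero constant term. -/
def germSet (k : Type) [CommRing k] [Algebra ℂ k] : Set (MvPolynomial (Fin 2) k) :=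
  MvPolynomial.map (algebraMap ℂ k) '' {w | w ∉ originIdeal 2}

variable {k : Type} [CommRing k] [Algebra ℂ k] {n r : ℕ}

lemma aeval_map_pair {C : Type} [CommRing C] [Algebra k C] (X Y : C) (w : MvPolynomial (Fin 2) ℂ) :
    MvPolynomial.aeval ![X, Y] (MvPolynomial.map (algebraMap ℂ k) w) =
      evalPair ((algebraMap k C).comp (algebraMap ℂ k)) X Y w := by
  rw [MvPolynomial.aeval_def, MvPolynomial.eval₂_map]
  rfl

/-- The norm of the value of a polynomial at the coordinate functions of the family. -/
def normHom {S : Type} [CommRing S] (ρ : ℂ →+* S) (z : ChartCoord S n r) :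
    MvPolynomial (Fin 2) ℂ →* S :=
  (Algebra.norm S).comp
    (evalPair ((algebraMap S (ChartAlg z)).comp ρ) (ChartAlg.x z) (ChartAlg.y z) :
      MvPolynomial (Fin 2) ℂ →* ChartAlg z)

lemma normHom_apply {S : Type} [CommRing S] (ρ : ℂ →+* S) (z : ChartCoord S n r)
    (w : MvPolynomial (Fin 2) ℂ) : normHom ρ z w = Algebra.norm S
      (evalPair ((algebraMap S (ChartAlg z)).comp ρ) (ChartAlg.x z) (ChartAlg.y z) w) := rfl

lemma map_normHom {S S' : Type} [CommRing S] [CommRing S'] (ρ : ℂ →+* S) (z : ChartCoord S n r)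
    (f : S →+* S') (w : MvPolynomial (Fin 2) ℂ) :
    f (normHom ρ z w) = normHom (f.comp ρ) (z.map f) w := by
  rw [normHom_apply, ← norm_chartAlg_map, map_evalPair, ChartAlg.map_x, ChartAlg.map_y,
    normHom_apply]
  have h : (ChartAlg.map z f).comp ((algebraMap S (ChartAlg z)).comp ρ) =
      (algebraMap S' (ChartAlg (z.map f))).comp (f.comp ρ) :=
    RingHom.ext fun a ↦ ChartAlg.map_algebraMap z f (ρ a)
  rw [h]

/-- Invertibility in the algebra is replaced by invertibility of norms in `S`. As the norm is
multiplicative, the norms of the polynomials with nonzero constant term form a submonoid, and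
imposing the condition is a localization. -/
lemma isChartPoint_iff {S : Type} [CommRing S] [Algebra k S] {t : k} {z : ChartCoord S n r} :
    IsChartPoint t (germSet k) z ↔ z.b * z.c = algebraMap k S t ∧
      ∀ w ∈ (originIdeal 2).primeCompl,
        IsUnit (normHom ((algebraMap k S).comp (algebraMap ℂ k)) z w) := by
  have key (w : MvPolynomial (Fin 2) ℂ) :
      IsUnit (normHom ((algebraMap k S).comp (algebraMap ℂ k)) z w) ↔
        IsUnit (MvPolynomial.aeval ![ChartAlg.x z, ChartAlg.y z]
          (MvPolynomial.map (algebraMap ℂ k) w)) := by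
    rw [normHom_apply, isUnit_norm_chartAlg, aeval_map_pair]
    rfl
  constructor
  · exact fun h ↦ ⟨h.mul_eq, fun w hw ↦ (key w).2 (h.isUnit _ ⟨w, hw, rfl⟩)⟩
  · rintro ⟨h1, h2⟩
    refine ⟨h1, ?_⟩
    rintro _ ⟨w, hw, rfl⟩
    exact (key w).1 (h2 w hw)

/-- A point of a chart from which all points of the chart are obtained uniquely by base change. -/
structure IsUniversal (t : k) (W : Set (MvPolynomial (Fin 2) k)) {Λ : Type} [CommRing Λ]
    [Algebra k Λ] (z : ChartCoord Λ n r) : Prop where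
  isChartPoint : IsChartPoint t W z
  exists_hom : ∀ (S : Type) [CommRing S] [Algebra k S] (w : ChartCoord S n r),
    IsChartPoint t W w → ∃ u : Λ →ₐ[k] S, z.map (u : Λ →+* S) = w
  hom_ext : ∀ (S : Type) [CommRing S] [Algebra k S] (u v : Λ →ₐ[k] S),
    z.map (u : Λ →+* S) = z.map (v : Λ →+* S) → u = v

/-- Covers both families at once. The ring `P` of the hypersurface `b c = t` comes only with the
constants `ρ`; the structure over `k` is asked for after localization, since for the versal family
it exists only there. By `hk` a homomorphism out of `k` is known from its values on constants and on
`t`. -/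
theorem isUniversal_of_isLocalization {t : k} {P Λ : Type} [CommRing P] [CommRing Λ] [Algebra k Λ]
    [Algebra P Λ] (ρ : ℂ →+* P) (z : ChartCoord P n r)
    [IsLocalization ((originIdeal 2).primeCompl.map (normHom ρ z)) Λ]
    (hρ : (algebraMap P Λ).comp ρ = (algebraMap k Λ).comp (algebraMap ℂ k))
    (hbc : algebraMap P Λ (z.b * z.c) = algebraMap k Λ t)
    (hex : ∀ (S : Type) [CommRing S] [Algebra k S] (w : ChartCoord S n r),
      w.b * w.c = algebraMap k S t → ∃ g : P →+* S,
        g.comp ρ = (algebraMap k S).comp (algebraMap ℂ k) ∧ z.map g = w)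
    (hext : ∀ (S : Type) [CommRing S] (g g' : P →+* S), g.comp ρ = g'.comp ρ →
      z.map g = z.map g' → g = g')
    (hk : ∀ (S : Type) [CommRing S] (f g : k →+* S),
      f.comp (algebraMap ℂ k) = g.comp (algebraMap ℂ k) → f t = g t → f = g) :
    IsUniversal t (germSet k) (z.map (algebraMap P Λ)) := by
  refine ⟨isChartPoint_iff.2 ⟨?_, fun w hw ↦ ?_⟩, fun S _ _ w hw ↦ ?_, fun S _ _ u v huv ↦ ?_⟩
  · rw [← hbc, map_mul]; rfl
  · rw [← hρ, ← map_normHom]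
    exact IsLocalization.map_units Λ (⟨_, w, hw, rfl⟩ : (originIdeal 2).primeCompl.map (normHom ρ z))
  · obtain ⟨hw1, hw2⟩ := isChartPoint_iff.1 hw
    obtain ⟨g, hg, rfl⟩ := hex S w hw1
    have hu (a : (originIdeal 2).primeCompl.map (normHom ρ z)) : IsUnit (g a) := by
      obtain ⟨_, w, hw, rfl⟩ := a
      rw [map_normHom, hg]
      exact hw2 w hw
    let u : Λ →+* S := IsLocalization.lift hu
    have hug : u.comp (algebraMap P Λ) = g := IsLocalization.lift_comp hu
    have huk : u.comp (algebraMap k Λ) = algebraMap k S := by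
      refine hk S _ _ ?_ ?_
      · rw [RingHom.comp_assoc, ← hρ, ← RingHom.comp_assoc, hug, hg]
      · rw [RingHom.comp_apply, ← hbc, ← RingHom.comp_apply, hug, ← hw1, map_mul]
        rfl
    refine ⟨{ u with commutes' := fun a ↦ DFunLike.congr_fun huk a }, ?_⟩
    exact congrArg z.map hug
  · have h : (u : Λ →+* S).comp (algebraMap P Λ) = (v : Λ →+* S).comp (algebraMap P Λ) := by
      refine hext S _ _ ?_ huv
      rw [RingHom.comp_assoc, RingHom.comp_assoc, hρ, ← RingHom.comp_assoc, ← RingHom.comp_assoc,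
        AlgHom.comp_algebraMap, AlgHom.comp_algebraMap]
    exact AlgHom.coe_ringHom_injective
      (IsLocalization.ringHom_ext ((originIdeal 2).primeCompl.map (normHom ρ z)) h)

/-- The ring of a chart from a universal point. -/
def ChartRing.ofUniversal {R : Type} [CommRing R] [Algebra k R] {t : k}
    {W : Set (MvPolynomial (Fin 2) k)} {x y : R} (h : IsGerm t W x y) {m : ℕ} {i : Fin m}
    {Λ : Type} [CommRing Λ] [Algebra k Λ] {z : ChartCoord Λ (m - 1 - i) i}
    (hz : IsUniversal t W z) : ChartRing k x y ({i} : Finset (Fin m)) where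
  ring := Λ
  ideal := familyIdeal k x y z
  isChartOn j hj := by
    obtain rfl := Finset.mem_singleton.1 hj
    exact isChart_familyIdeal h hz.isChartPoint
  exists_hom S _ _ I hI := by
    obtain ⟨w, hw, rfl⟩ := exists_isChartPoint h (hI i (Finset.mem_singleton_self i))
    obtain ⟨u, rfl⟩ := hz.exists_hom S w hw
    exact ⟨u, familyIdeal_map u z⟩
  hom_ext S _ _ u v huv := by
    rw [familyIdeal_map, familyIdeal_map] at huv
    exact hz.hom_ext S u v (familyIdeal_injective h (isChartPoint_map hz.isChartPoint u) huv)

end Universal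

/-! ### Coordinates in affine space -/

section Coordinates

variable {m n r : ℕ} {S : Type}

/-- The chart coordinates given by a point of affine space. -/
def coordOf (h : n + 1 + r = m) (v : Fin (m + 1) → S) : ChartCoord S n r where
  -- The first two coordinates appear in the order `c, b`. With this order the component `D_i`,
  -- which is `b = 0` in chart `i`, is the hyperplane `z₁ = 0`, and `D_{i+1}` is `z₀ = 0`.
  b := v 1
  c := v 0
  p j := v ⟨2 + j, by omega⟩
  q j := v ⟨2 + r + j, by omega⟩

lemma coordOf_map (h : n + 1 + r = m) [CommRing S] (v : Fin (m + 1) → S) {S' : Type} [CommRing S']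
    (f : S →+* S') : (coordOf h v).map f = coordOf h (fun j ↦ f (v j)) := rfl

lemma exists_coordOf (h : n + 1 + r = m) (z : ChartCoord S n r) : ∃ v, coordOf h v = z := by
  have h1 : ((1 : Fin (m + 1)) : ℕ) = 1 := by
    rw [Fin.val_one']; exact Nat.mod_eq_of_lt (by omega)
  -- The indices `0`, `1`, the next `r` and the next `n` exhaust `Fin (m + 1)`; the final `z.b` is a
  -- filler that is never reached.
  refine ⟨fun j ↦ if j.1 = 0 then z.c else if j.1 = 1 then z.b else
    if h2 : j.1 - 2 < r then z.p ⟨j.1 - 2, h2⟩ else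
    if h3 : j.1 - 2 - r < n then z.q ⟨j.1 - 2 - r, h3⟩ else z.b, ?_⟩
  ext j
  rotate_left
  · simp [coordOf]
  rotate_left 2
  · change (if ((1 : Fin (m + 1)) : ℕ) = 0 then _ else if ((1 : Fin (m + 1)) : ℕ) = 1 then _ else _) = _
    rw [if_neg (by omega), if_pos h1]
  · simp [coordOf, show 2 + j.1 ≠ 1 by omega]
  · have e1 : 2 + r + j.1 - 2 - r = j.1 := by omega
    have e2 : ¬ (2 + r + j.1 - 2 < r) := by omega
    simp [coordOf, show 2 + r + j.1 ≠ 1 by omega, e1, e2]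

lemma coordOf_injective (h : n + 1 + r = m) :
    Function.Injective (coordOf h : (Fin (m + 1) → S) → ChartCoord S n r) := by
  intro v w hvw
  have h1 : ((1 : Fin (m + 1)) : ℕ) = 1 := by
    rw [Fin.val_one']; exact Nat.mod_eq_of_lt (by omega)
  funext j
  by_cases hj0 : j.1 = 0
  · obtain rfl : j = 0 := Fin.ext hj0
    exact congrArg ChartCoord.c hvw
  by_cases hj1 : j.1 = 1
  · obtain rfl : j = 1 := Fin.ext (hj1.trans h1.symm)
    exact congrArg ChartCoord.b hvw
  by_cases hj2 : j.1 - 2 < r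
  · have := congrFun (congrArg ChartCoord.p hvw) ⟨j.1 - 2, hj2⟩
    have e : (⟨2 + (j.1 - 2), by omega⟩ : Fin (m + 1)) = j := Fin.ext (by simp; omega)
    simpa [coordOf, e] using this
  · have := congrFun (congrArg ChartCoord.q hvw) ⟨j.1 - 2 - r, by omega⟩
    have e : (⟨2 + r + (j.1 - 2 - r), by omega⟩ : Fin (m + 1)) = j := Fin.ext (by simp; omega)
    simpa [coordOf, e] using this

end Coordinates

end

end NodeHilb


namespace NodeHilb

noncomputable section

/-! ### The germs of the node and of the plane -/

theorem isGerm_node : IsGerm (0 : ℂ) (germSet ℂ) (coord nodeEq 0) (coord nodeEq 1) := by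
  let J : Ideal (MvPolynomial (Fin 2) ℂ) := Ideal.span {nodeEq}
  let M := (originIdeal 2).primeCompl.map (Ideal.Quotient.mk J)
  let π : MvPolynomial (Fin 2) ℂ →+* NodeGerm := (algebraMap (_ ⧸ J) NodeGerm).comp
    (Ideal.Quotient.mk J)
  have hπ : π = evalPair (algebraMap ℂ NodeGerm) (coord nodeEq 0) (coord nodeEq 1) := by
    refine ringHom_ext_pair ?_ ?_ ?_
    · ext a
      rw [RingHom.comp_apply, RingHom.comp_apply, RingHom.comp_apply, evalPair_C]
      exact (IsScalarTower.algebraMap_apply ℂ (_ ⧸ J) NodeGerm a).symm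
    · exact (evalPair_X_zero _ _ _).symm
    · exact (evalPair_X_one _ _ _).symm
  refine ⟨?_, ?_, fun C _ _ X Y hXY hW ↦ ?_, fun C _ _ φ ψ h0 h1 ↦ ?_⟩
  · have h : Ideal.Quotient.mk J nodeEq = 0 :=
      Ideal.Quotient.eq_zero_iff_mem.2 (Ideal.subset_span rfl)
    calc coord nodeEq 0 * coord nodeEq 1 = π nodeEq := by
          rw [map_mul]; rfl
      _ = _ := by rw [RingHom.comp_apply, h, map_zero, map_zero]
  · rintro _ ⟨w, hw, rfl⟩
    rw [aeval_map_pair]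
    have h := IsLocalization.map_units NodeGerm (⟨_, w, hw, rfl⟩ : M)
    have h2 : π w = evalPair (algebraMap ℂ NodeGerm) (coord nodeEq 0) (coord nodeEq 1) w := by
      rw [hπ]
    exact h2 ▸ h
  · let g : MvPolynomial (Fin 2) ℂ →ₐ[ℂ] C := MvPolynomial.aeval ![X, Y]
    have hg (a) (ha : a ∈ J) : g a = 0 := by
      have hle : J ≤ RingHom.ker g := by
        rw [Ideal.span_le, Set.singleton_subset_iff]
        simp [g, hXY]
      exact hle ha
    let g' : (MvPolynomial (Fin 2) ℂ ⧸ J) →ₐ[ℂ] C := Ideal.Quotient.liftₐ J g hg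
    have hu (a : M) : IsUnit (g' a) := by
      obtain ⟨_, w, hw, rfl⟩ := a
      have h1 := hW _ ⟨w, hw, rfl⟩
      rw [show MvPolynomial.map (algebraMap ℂ ℂ) w = w from MvPolynomial.map_id w] at h1
      exact h1
    let u : NodeGerm →ₐ[ℂ] C := IsLocalization.liftAlgHom (M := M) (S := NodeGerm) hu
    have hug (j : Fin 2) : u (coord nodeEq j) = ![X, Y] j := by
      refine (IsLocalization.lift_eq (M := M) (S := NodeGerm) (g := g'.toRingHom) hu _).trans ?_
      exact MvPolynomial.aeval_X _ _
    exact ⟨u, hug 0, hug 1⟩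
  · have h : (φ : NodeGerm →+* C).comp π = (ψ : NodeGerm →+* C).comp π := by
      refine ringHom_ext_pair ?_ h0 h1
      ext a
      rw [hπ]
      simp [evalPair_C]
    refine AlgHom.coe_ringHom_injective (IsLocalization.ringHom_ext M ?_)
    exact Ideal.Quotient.ringHom_ext h

/-- The parameter of the base. -/
def baseT : BaseGerm := algebraMap (Polynomial ℂ) BaseGerm Polynomial.X

lemma baseGerm_ringHom_ext {S : Type} [CommRing S] {f g : BaseGerm →+* S}
    (h : f.comp (algebraMap ℂ BaseGerm) = g.comp (algebraMap ℂ BaseGerm))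
    (ht : f baseT = g baseT) : f = g := by
  refine IsLocalization.ringHom_ext baseIdeal.primeCompl (Polynomial.ringHom_ext (fun a ↦ ?_) ht)
  have h1 := DFunLike.congr_fun h a
  rw [RingHom.comp_apply, RingHom.comp_apply,
    IsScalarTower.algebraMap_apply ℂ (Polynomial ℂ) BaseGerm] at h1
  exact h1

instance : IsLocalization.AtPrime PlaneGerm (originIdeal 2) :=
  inferInstanceAs (IsLocalization.AtPrime (Localization.AtPrime (originIdeal 2)) (originIdeal 2))

lemma algebraMap_planeGerm (p : Polynomial ℂ) :
    algebraMap BaseGerm PlaneGerm (algebraMap (Polynomial ℂ) BaseGerm p) =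
      algebraMap (MvPolynomial (Fin 2) ℂ) PlaneGerm (Polynomial.aeval nodeEq p) :=
  Localization.localRingHom_to_map _ _ _ baseIdeal_eq_comap _

lemma algebraMap_planeGerm_C (a : ℂ) :
    algebraMap BaseGerm PlaneGerm (algebraMap ℂ BaseGerm a) =
      algebraMap (MvPolynomial (Fin 2) ℂ) PlaneGerm (MvPolynomial.C a) := by
  rw [IsScalarTower.algebraMap_apply ℂ (Polynomial ℂ) BaseGerm, algebraMap_planeGerm]
  simp [MvPolynomial.algebraMap_eq]

theorem isGerm_plane : IsGerm baseT (germSet BaseGerm)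
    (algebraMap _ PlaneGerm (MvPolynomial.X 0 : MvPolynomial (Fin 2) ℂ))
    (algebraMap _ PlaneGerm (MvPolynomial.X 1 : MvPolynomial (Fin 2) ℂ)) := by
  have hπ : algebraMap (MvPolynomial (Fin 2) ℂ) PlaneGerm =
      evalPair ((algebraMap BaseGerm PlaneGerm).comp (algebraMap ℂ BaseGerm))
        (algebraMap _ PlaneGerm (MvPolynomial.X 0 : MvPolynomial (Fin 2) ℂ))
        (algebraMap _ PlaneGerm (MvPolynomial.X 1 : MvPolynomial (Fin 2) ℂ)) := by
    refine ringHom_ext_pair ?_ ?_ ?_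
    · ext a
      rw [RingHom.comp_apply, RingHom.comp_apply, evalPair_C, RingHom.comp_apply,
        algebraMap_planeGerm_C]
    · exact (evalPair_X_zero _ _ _).symm
    · exact (evalPair_X_one _ _ _).symm
  refine ⟨?_, ?_, fun C _ _ X Y hXY hW ↦ ?_, fun C _ _ φ ψ h0 h1 ↦ ?_⟩
  · rw [baseT, algebraMap_planeGerm, Polynomial.aeval_X, map_mul]
  · rintro _ ⟨w, hw, rfl⟩
    rw [aeval_map_pair, ← hπ]
    exact IsLocalization.map_units PlaneGerm (⟨w, hw⟩ : (originIdeal 2).primeCompl)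
  · let ρ := (algebraMap BaseGerm C).comp (algebraMap ℂ BaseGerm)
    have hu (a : (originIdeal 2).primeCompl) : IsUnit (evalPair ρ X Y a) := by
      have h1 := hW _ ⟨a, a.2, rfl⟩
      rwa [aeval_map_pair] at h1
    let u : PlaneGerm →+* C := IsLocalization.lift hu
    have hug (a) : u (algebraMap _ PlaneGerm a) = evalPair ρ X Y a := IsLocalization.lift_eq hu a
    have huk : u.comp (algebraMap BaseGerm PlaneGerm) = algebraMap BaseGerm C := by
      refine baseGerm_ringHom_ext ?_ ?_
      · ext a
        rw [RingHom.comp_apply, RingHom.comp_apply, algebraMap_planeGerm_C, hug, evalPair_C]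
      · rw [RingHom.comp_apply, baseT, algebraMap_planeGerm, hug, Polynomial.aeval_X, map_mul,
          evalPair_X_zero, evalPair_X_one, hXY]
        rfl
    refine ⟨{ u with commutes' := fun a ↦ DFunLike.congr_fun huk a }, ?_, ?_⟩
    · exact (hug _).trans (evalPair_X_zero _ _ _)
    · exact (hug _).trans (evalPair_X_one _ _ _)
  · have h : (φ : PlaneGerm →+* C).comp (algebraMap (MvPolynomial (Fin 2) ℂ) PlaneGerm) =
        (ψ : PlaneGerm →+* C).comp (algebraMap (MvPolynomial (Fin 2) ℂ) PlaneGerm) := by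
      refine ringHom_ext_pair ?_ h0 h1
      ext a
      rw [RingHom.comp_apply, RingHom.comp_apply, RingHom.comp_apply, RingHom.comp_apply,
        ← algebraMap_planeGerm_C]
      simp
    exact AlgHom.coe_ringHom_injective
      (IsLocalization.ringHom_ext (originIdeal 2).primeCompl h)

/-! ### The chart rings of the node -/

section NodeChart

variable {m n r : ℕ} (h : n + 1 + r = m)

/-- The coordinate ring of `b c = 0`. -/
abbrev NodeAff (m : ℕ) : Type :=
  MvPolynomial (Fin (m + 1)) ℂ ⧸ Ideal.span ({eqBC m} : Set (MvPolynomial (Fin (m + 1)) ℂ))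

/-- The coordinate functions on `b c = 0`. -/
def nodeVar (m : ℕ) (j : Fin (m + 1)) : NodeAff m := Ideal.Quotient.mk _ (MvPolynomial.X j)

/-- The functions that are inverted in the chart. -/
def nodeMonoid : Submonoid (NodeAff m) := (originIdeal 2).primeCompl.map
  (normHom (algebraMap ℂ (NodeAff m)) (coordOf h (nodeVar m)))

/-- The ring of a chart of the Hilbert scheme of the node. -/
def NodeChart : Type := Localization (nodeMonoid h)

instance : CommRing (NodeChart h) := inferInstanceAs (CommRing (Localization (nodeMonoid h)))

instance : Algebra (NodeAff m) (NodeChart h) :=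
  inferInstanceAs (Algebra _ (Localization (nodeMonoid h)))

instance : IsLocalization (nodeMonoid h) (NodeChart h) :=
  inferInstanceAs (IsLocalization _ (Localization (nodeMonoid h)))

instance : Algebra ℂ (NodeChart h) := inferInstanceAs (Algebra _ (Localization (nodeMonoid h)))

instance : IsScalarTower ℂ (NodeAff m) (NodeChart h) :=
  inferInstanceAs (IsScalarTower _ _ (Localization (nodeMonoid h)))

/-- The universal point of the chart. -/
def nodePoint : ChartCoord (NodeChart h) n r :=
  (coordOf h (nodeVar m)).map (algebraMap (NodeAff m) (NodeChart h))

lemma nodeVar_mul : nodeVar m 0 * nodeVar m 1 = 0 :=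
  (map_mul (Ideal.Quotient.mk (Ideal.span {eqBC m})) _ _).symm.trans
    (Ideal.Quotient.eq_zero_iff_mem.2 (Ideal.subset_span rfl))

lemma nodeAff_ringHom_ext {S : Type} [CommRing S] {f g : NodeAff m →+* S}
    (h : f.comp (algebraMap ℂ (NodeAff m)) = g.comp (algebraMap ℂ (NodeAff m)))
    (hv : ∀ j, f (nodeVar m j) = g (nodeVar m j)) : f = g :=
  Ideal.Quotient.ringHom_ext (MvPolynomial.ringHom_ext (fun a ↦ DFunLike.congr_fun h a) hv)

theorem isUniversal_nodePoint : IsUniversal (0 : ℂ) (germSet ℂ) (nodePoint h) := by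
  have : IsLocalization ((originIdeal 2).primeCompl.map
      (normHom (algebraMap ℂ (NodeAff m)) (coordOf h (nodeVar m)))) (NodeChart h) :=
    inferInstanceAs (IsLocalization (nodeMonoid h) (NodeChart h))
  refine isUniversal_of_isLocalization (algebraMap ℂ (NodeAff m)) (coordOf h (nodeVar m))
    ?_ ?_ (fun S _ _ w hw ↦ ?_) (fun S _ f g hfg hz ↦ ?_) (fun S _ f g hfg _ ↦ hfg)
  · exact (IsScalarTower.algebraMap_eq ℂ (NodeAff m) (NodeChart h)).symm
  · exact (congrArg _ ((mul_comm _ _).trans nodeVar_mul)).trans (by simp)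
  · obtain ⟨v, rfl⟩ := exists_coordOf h w
    let g : NodeAff m →ₐ[ℂ] S := Ideal.Quotient.liftₐ _ (MvPolynomial.aeval v) (by
      intro a ha
      have hle : Ideal.span {eqBC m} ≤ RingHom.ker (MvPolynomial.aeval v : _ →ₐ[ℂ] S) := by
        rw [Ideal.span_le, Set.singleton_subset_iff]
        simpa [coordOf, mul_comm] using hw
      exact hle ha)
    refine ⟨g, ?_, ?_⟩
    · ext a
      exact g.commutes a
    · rw [coordOf_map]
      congr 1
      funext j
      exact MvPolynomial.aeval_X v j
  · rw [coordOf_map, coordOf_map] at hz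
    exact nodeAff_ringHom_ext hfg (congrFun (coordOf_injective h hz))

end NodeChart

/-! ### The chart rings of the versal family -/

section VersalChart

variable {m n r : ℕ} (h : n + 1 + r = m)

/-- The functions that are inverted in the chart. -/
def versalMonoid : Submonoid (MvPolynomial (Fin (m + 1)) ℂ) := (originIdeal 2).primeCompl.map
  (normHom (algebraMap ℂ (MvPolynomial (Fin (m + 1)) ℂ)) (coordOf h MvPolynomial.X))

/-- The ring of a chart of the Hilbert scheme of the versal family. -/
def VersalChart : Type := Localization (versalMonoid h)

instance : CommRing (VersalChart h) := inferInstanceAs (CommRing (Localization (versalMonoid h)))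

instance : Algebra (MvPolynomial (Fin (m + 1)) ℂ) (VersalChart h) :=
  inferInstanceAs (Algebra _ (Localization (versalMonoid h)))

instance : IsLocalization (versalMonoid h) (VersalChart h) :=
  inferInstanceAs (IsLocalization _ (Localization (versalMonoid h)))

instance : Algebra ℂ (VersalChart h) := inferInstanceAs (Algebra _ (Localization (versalMonoid h)))

instance : IsScalarTower ℂ (MvPolynomial (Fin (m + 1)) ℂ) (VersalChart h) :=
  inferInstanceAs (IsScalarTower _ _ (Localization (versalMonoid h)))

/-- If `p(0) ≠ 0`, then `p(x y)` has nonzero constant term, so its norm is inverted in the chart. On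
the family `x y = b c`, so this norm is a power of `p(b c)`, with exponent the positive rank of the
algebra, and `p(b c)` is itself a unit. -/
lemma isUnit_aeval_mul {p : Polynomial ℂ} (hp : p ∈ baseIdeal.primeCompl) :
    IsUnit (algebraMap (MvPolynomial (Fin (m + 1)) ℂ) (VersalChart h)
      (Polynomial.aeval (MvPolynomial.X 0 * MvPolynomial.X 1) p)) := by
  let P := MvPolynomial (Fin (m + 1)) ℂ
  let z : ChartCoord P n r := coordOf h MvPolynomial.X
  let w : MvPolynomial (Fin 2) ℂ := Polynomial.aeval nodeEq p
  have hw : w ∈ (originIdeal 2).primeCompl := by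
    intro hw
    refine hp ?_
    rw [baseIdeal_eq_comap]
    exact hw
  have hu := IsLocalization.map_units (VersalChart h) (⟨_, w, hw, rfl⟩ : versalMonoid h)
  have h1 : evalPair ((algebraMap P (ChartAlg z)).comp (algebraMap ℂ P)) (ChartAlg.x z)
      (ChartAlg.y z) w = algebraMap P (ChartAlg z)
        (Polynomial.aeval (MvPolynomial.X 0 * MvPolynomial.X 1) p) := by
    have e : (evalPair ((algebraMap P (ChartAlg z)).comp (algebraMap ℂ P)) (ChartAlg.x z)
        (ChartAlg.y z)).comp (Polynomial.aeval nodeEq : Polynomial ℂ →ₐ[ℂ] _).toRingHom =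
        (algebraMap P (ChartAlg z)).comp
          (Polynomial.aeval (MvPolynomial.X 0 * MvPolynomial.X 1) : Polynomial ℂ →ₐ[ℂ] P).toRingHom := by
      refine Polynomial.ringHom_ext (fun a ↦ ?_) ?_
      · simp [MvPolynomial.algebraMap_eq, evalPair_C]
      · have h2 := ChartAlg.x_mul_y z
        simp only [AlgHom.toRingHom_eq_coe, RingHom.coe_comp, RingHom.coe_coe, Function.comp_apply,
          Polynomial.aeval_X, map_mul, evalPair_X_zero, evalPair_X_one] at h2 ⊢
        exact h2.trans (mul_comm _ _)
    exact DFunLike.congr_fun e p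
  change IsUnit (algebraMap P (VersalChart h) (normHom _ z w)) at hu
  rw [normHom_apply, h1, Algebra.norm_algebraMap_of_basis (chartBasis z), map_pow] at hu
  exact (isUnit_pow_iff (by simp)).1 hu

/-- The parameter `t` acts as `b c`, so no coordinate for `t` is needed. -/
instance : Algebra BaseGerm (VersalChart h) := RingHom.toAlgebra <|
  IsLocalization.lift (M := baseIdeal.primeCompl)
    (g := (algebraMap (MvPolynomial (Fin (m + 1)) ℂ) (VersalChart h)).comp
      (Polynomial.aeval (MvPolynomial.X 0 * MvPolynomial.X 1) :
        Polynomial ℂ →ₐ[ℂ] MvPolynomial (Fin (m + 1)) ℂ).toRingHom)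
    fun p ↦ isUnit_aeval_mul h p.2

lemma algebraMap_versalChart (p : Polynomial ℂ) :
    algebraMap BaseGerm (VersalChart h) (algebraMap (Polynomial ℂ) BaseGerm p) =
      algebraMap (MvPolynomial (Fin (m + 1)) ℂ) (VersalChart h)
        (Polynomial.aeval (MvPolynomial.X 0 * MvPolynomial.X 1) p) :=
  IsLocalization.lift_eq _ _

instance : IsScalarTower ℂ BaseGerm (VersalChart h) := by
  refine IsScalarTower.of_algebraMap_eq fun a ↦ ?_
  rw [IsScalarTower.algebraMap_apply ℂ (Polynomial ℂ) BaseGerm, algebraMap_versalChart,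
    IsScalarTower.algebraMap_apply ℂ (MvPolynomial (Fin (m + 1)) ℂ) (VersalChart h)]
  simp

/-- The universal point of the chart. -/
def versalPoint : ChartCoord (VersalChart h) n r :=
  (coordOf h MvPolynomial.X).map (algebraMap (MvPolynomial (Fin (m + 1)) ℂ) (VersalChart h))

theorem isUniversal_versalPoint : IsUniversal baseT (germSet BaseGerm) (versalPoint h) := by
  let P := MvPolynomial (Fin (m + 1)) ℂ
  have : IsLocalization ((originIdeal 2).primeCompl.map
      (normHom (algebraMap ℂ P) (coordOf h MvPolynomial.X))) (VersalChart h) :=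
    inferInstanceAs (IsLocalization (versalMonoid h) (VersalChart h))
  refine isUniversal_of_isLocalization (algebraMap ℂ P) (coordOf h MvPolynomial.X)
    ?_ ?_ (fun S _ _ w hw ↦ ?_) (fun S _ f g hfg hz ↦ ?_)
    (fun S _ f g hfg ht ↦ baseGerm_ringHom_ext hfg ht)
  · rw [← IsScalarTower.algebraMap_eq, ← IsScalarTower.algebraMap_eq]
  · rw [baseT, algebraMap_versalChart, Polynomial.aeval_X, mul_comm]
    rfl
  · obtain ⟨v, rfl⟩ := exists_coordOf h w
    refine ⟨MvPolynomial.eval₂Hom ((algebraMap BaseGerm S).comp (algebraMap ℂ BaseGerm)) v, ?_, ?_⟩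
    · ext a
      simp [MvPolynomial.algebraMap_eq, P]
    · rw [coordOf_map]
      congr 1
      funext j
      exact MvPolynomial.eval₂_X _ _ _
  · rw [coordOf_map, coordOf_map] at hz
    exact MvPolynomial.ringHom_ext (fun a ↦ DFunLike.congr_fun hfg a)
      (congrFun (coordOf_injective h hz))

end VersalChart

end

end NodeHilb


namespace NodeHilb

noncomputable section

/-! ### Overlaps of charts over the node -/

section Overlap

variable {S C : Type} [CommRing S] [CommRing C] [Algebra S C] {n r n' r' : ℕ} {X Y : C}

lemma mul_aeval_of_mul_eq_zero (hXY : X * Y = 0) (q : Polynomial S) :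
    Y * Polynomial.aeval X q = Y * algebraMap S C (q.coeff 0) := by
  conv_lhs => rw [← Polynomial.divX_mul_X_add q]
  rw [map_add, map_mul, Polynomial.aeval_X, Polynomial.aeval_C, mul_add]
  linear_combination (Polynomial.aeval X q.divX) * hXY

/-- If `b = 0`, then `y P(y) = 0` is a nontrivial relation among `y, …, y^(r+1)`. These all belong
to the second set of monomials because `r < r'`. -/
lemma b_ne_zero_of_linearIndependent [Nontrivial S] (hm : LinearIndependent S (mon X Y n' r'))
    (hr : r < r') {z : ChartCoord S n r} (hF : relF z X Y = 0) : z.b ≠ 0 := by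
  intro hb
  rw [relF, hb, zero_smul, sub_zero] at hF
  have h := (eq_zero_of_linearIndependent_mon hm (a := 0) (d := monicPoly z.p)
    (by rw [Polynomial.degree_zero]; exact WithBot.bot_lt_coe _)
    ((degree_monicPoly_lt _).trans_le (by exact_mod_cast hr)) (by simpa using hF)).2
  have h2 := monicPoly_coeff_self z.p
  rw [h] at h2
  simp at h2

/-- Multiplying `y P(y) = b Q(x)` by `y` leaves only the constant term of `Q`, since `x y = 0`. The
result is a relation in `y` alone with leading term `y^(r+2)`, which is impossible if `r + 2 ≤ r'`.
-/
lemma eq_succ_of_linearIndependent [Nontrivial S] (hXY : X * Y = 0)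
    (hm : LinearIndependent S (mon X Y n' r')) (hr : r < r') {z : ChartCoord S n r}
    (hF : relF z X Y = 0) : r' = r + 1 := by
  by_contra hne
  have hr2 : r + 2 ≤ r' := by omega
  let d : Polynomial S := Polynomial.X * monicPoly z.p -
    Polynomial.C (z.b * (monicPoly z.q).coeff 0)
  have hd : d.degree < (r' : WithBot ℕ) := by
    refine lt_of_lt_of_le ?_ (show ((r + 2 : ℕ) : WithBot ℕ) ≤ r' by exact_mod_cast hr2)
    refine (Polynomial.degree_sub_le _ _).trans_lt (max_lt ?_ ?_)
    · refine (Polynomial.degree_mul_le _ _).trans_lt ?_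
      have h1 : (monicPoly z.p).degree ≤ (r : WithBot ℕ) :=
        Order.lt_succ_iff.1 (by exact_mod_cast degree_monicPoly_lt z.p)
      calc _ ≤ (1 : WithBot ℕ) + r := add_le_add Polynomial.degree_X_le h1
        _ < _ := by exact_mod_cast (show 1 + r < r + 2 by omega)
    · exact Polynomial.degree_C_le.trans_lt (by exact_mod_cast Nat.succ_pos _)
  have h0 : Polynomial.aeval X (0 : Polynomial S) + Y * Polynomial.aeval Y d = 0 := by
    rw [relF, Algebra.smul_def] at hF
    have h1 := mul_aeval_of_mul_eq_zero hXY (monicPoly z.q)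
    simp only [d, map_zero, map_sub, map_mul, Polynomial.aeval_X, Polynomial.aeval_C]
    linear_combination Y * hF + algebraMap S C z.b * h1
  have h := (eq_zero_of_linearIndependent_mon hm
    (by rw [Polynomial.degree_zero]; exact WithBot.bot_lt_coe _) hd h0).2
  have h2 : d.coeff (r + 1) = 1 := by
    simp [d, Polynomial.coeff_X_mul, monicPoly_coeff_self]
  rw [h] at h2
  simp at h2

variable {k R : Type} [CommRing k] [CommRing R] [Algebra k R] [Algebra k S] {t : k}
  {W : Set (MvPolynomial (Fin 2) k)} {x y : R}

lemma relF_mk_familyIdeal (z : ChartCoord S n r) :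
    relF z (Ideal.Quotient.mk (familyIdeal k x y z) (incl S k x))
      (Ideal.Quotient.mk (familyIdeal k x y z) (incl S k y)) = 0 := by
  rw [← mk_relF, Ideal.Quotient.eq_zero_iff_mem]
  exact Ideal.subset_span (by simp)

lemma relG_mk_familyIdeal (z : ChartCoord S n r) :
    relG z (Ideal.Quotient.mk (familyIdeal k x y z) (incl S k x))
      (Ideal.Quotient.mk (familyIdeal k x y z) (incl S k y)) = 0 := by
  rw [← mk_relG, Ideal.Quotient.eq_zero_iff_mem]
  exact Ideal.subset_span (by simp)

/-- Two charts of the Hilbert scheme of the node meet only if they are adjacent. -/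
theorem overlap [Nontrivial S] (h : IsGerm t W x y) (ht : algebraMap k S t = 0)
    {z : ChartCoord S n r} {z' : ChartCoord S n' r'} (hz : IsChartPoint t W z)
    (hz' : IsChartPoint t W z') (hI : familyIdeal k x y z = familyIdeal k x y z')
    (hm : n + 1 + r = n' + 1 + r') (hr : r < r') : r' = r + 1 ∧ z.b ≠ 0 ∧ z'.c ≠ 0 := by
  have h1 := isChart_familyIdeal h hz
  have h2 := isChart_familyIdeal h hz'
  have hF := relF_mk_familyIdeal (k := k) (x := x) (y := y) z
  have hG := relG_mk_familyIdeal (k := k) (x := x) (y := y) z'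
  rw [← hI] at hG h2
  have hXY : Ideal.Quotient.mk (familyIdeal k x y z) (incl S k x) *
      Ideal.Quotient.mk (familyIdeal k x y z) (incl S k y) = 0 := by
    rw [← map_mul, incl_mul h, ht, map_zero, map_zero]
  refine ⟨eq_succ_of_linearIndependent hXY h2.1 hr hF, b_ne_zero_of_linearIndependent h2.1 hr hF, ?_⟩
  -- With the branches exchanged the two charts trade roles: `r < r'` becomes `n' < n`, and `c` of
  -- the second chart plays the part of `b`.
  exact b_ne_zero_of_linearIndependent (linearIndependent_mon_swap h1.1) (by omega)
    (z := z'.swap) hG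

end Overlap

/-! ### The chart points on the coordinate axes -/

section Axis

variable {S : Type} [CommRing S] {n r : ℕ}

/-- The chart coordinates that vanish except possibly for `b` and `c`. -/
def axisCoord (b c : S) : ChartCoord S n r := ⟨b, c, 0, 0⟩

lemma monicPoly_zero : monicPoly (0 : Fin r → S) = Polynomial.X ^ r := by simp [monicPoly]

lemma relF_axisCoord {C : Type} [CommRing C] [Algebra S C] (b c : S) (X Y : C) :
    relF (axisCoord b c : ChartCoord S n r) X Y = Y ^ (r + 1) - b • X ^ n := by
  simp [relF, axisCoord, monicPoly_zero, pow_succ']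

lemma relG_axisCoord {C : Type} [CommRing C] [Algebra S C] (b c : S) (X Y : C) :
    relG (axisCoord b c : ChartCoord S n r) X Y = X ^ (n + 1) - c • Y ^ r :=
  relF_axisCoord c b Y X

/-- One has `y^(r+2) = b x^n y`, which vanishes by `x y = 0` if `n > 0`. For `n = 0` the equation
`y^(r+1) = b` leaves the origin unless `b = 0`, whence the side condition. -/
lemma isNilpotent_y_axisCoord {b c : S} (hbc : b * c = 0) (hb : n = 0 → b = 0) :
    IsNilpotent (ChartAlg.y (axisCoord b c : ChartCoord S n r)) := by
  have hF := ChartAlg.relF_eq (axisCoord b c : ChartCoord S n r)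
  have hXY := ChartAlg.x_mul_y (axisCoord b c : ChartCoord S n r)
  rw [relF_axisCoord, Algebra.smul_def] at hF
  rw [show (axisCoord b c : ChartCoord S n r).b * (axisCoord b c : ChartCoord S n r).c = 0 from hbc,
    map_zero] at hXY
  refine ⟨r + 2, ?_⟩
  rcases n with - | n
  · have h0 : algebraMap S (ChartAlg (axisCoord b c : ChartCoord S 0 r)) b = 0 := by
      rw [hb rfl, map_zero]
    rw [h0, zero_mul, sub_zero] at hF
    rw [pow_succ, hF, zero_mul]
  · rw [pow_succ _ n] at hF
    linear_combination ChartAlg.y _ * hF +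
      algebraMap S _ b * ChartAlg.x (axisCoord b c : ChartCoord S (n + 1) r) ^ n * hXY

lemma isNilpotent_x_axisCoord {b c : S} (hbc : b * c = 0) (hc : r = 0 → c = 0) :
    IsNilpotent (ChartAlg.x (axisCoord b c : ChartCoord S n r)) := by
  have hG := ChartAlg.relG_eq (axisCoord b c : ChartCoord S n r)
  have hXY := ChartAlg.x_mul_y (axisCoord b c : ChartCoord S n r)
  rw [relG_axisCoord, Algebra.smul_def] at hG
  rw [show (axisCoord b c : ChartCoord S n r).b * (axisCoord b c : ChartCoord S n r).c = 0 from hbc,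
    map_zero] at hXY
  refine ⟨n + 2, ?_⟩
  rcases r with - | r
  · have h0 : algebraMap S (ChartAlg (axisCoord b c : ChartCoord S n 0)) c = 0 := by
      rw [hc rfl, map_zero]
    rw [h0, zero_mul, sub_zero] at hG
    rw [pow_succ, hG, zero_mul]
  · rw [pow_succ _ r] at hG
    linear_combination ChartAlg.x _ * hG +
      algebraMap S _ c * ChartAlg.y (axisCoord b c : ChartCoord S n (r + 1)) ^ r * hXY

/-- Modulo nilpotents only the constant term survives, and it is a nonzero complex number. -/
lemma isUnit_evalPair_of_isNilpotent {C : Type} [CommRing C] (ρ : ℂ →+* C) {X Y : C}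
    (hX : IsNilpotent X) (hY : IsNilpotent Y) {w : MvPolynomial (Fin 2) ℂ}
    (hw : w ∈ (originIdeal 2).primeCompl) : IsUnit (evalPair ρ X Y w) := by
  have h0 : (Ideal.Quotient.mk (nilradical C)) (evalPair ρ X Y w) =
      Ideal.Quotient.mk (nilradical C) (ρ (MvPolynomial.constantCoeff w)) := by
    have e : (Ideal.Quotient.mk (nilradical C)).comp (evalPair ρ X Y) =
        ((Ideal.Quotient.mk (nilradical C)).comp ρ).comp MvPolynomial.constantCoeff := by
      refine ringHom_ext_pair ?_ ?_ ?_
      · ext a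
        simp [evalPair_C]
      · simpa [evalPair_X_zero, Ideal.Quotient.eq_zero_iff_mem, mem_nilradical] using hX
      · simpa [evalPair_X_one, Ideal.Quotient.eq_zero_iff_mem, mem_nilradical] using hY
    exact DFunLike.congr_fun e w
  have h1 : IsNilpotent (evalPair ρ X Y w - ρ (MvPolynomial.constantCoeff w)) :=
    mem_nilradical.1 (Ideal.Quotient.eq.1 h0)
  have h2 : IsUnit (ρ (MvPolynomial.constantCoeff w)) := (isUnit_iff_ne_zero.2 hw).map ρ
  have h3 := h1.isUnit_add_right_of_commute h2 (Commute.all _ _)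
  rwa [sub_add_cancel] at h3 

variable {k : Type} [CommRing k] [Algebra k S] {t : k}

lemma isChartPoint_axisCoord [Algebra ℂ k] (ht : algebraMap k S t = 0) {b c : S} (hbc : b * c = 0)
    (hb : n = 0 → b = 0) (hc : r = 0 → c = 0) :
    IsChartPoint t (germSet k) (axisCoord b c : ChartCoord S n r) := by
  refine ⟨hbc.trans ht.symm, ?_⟩
  rintro _ ⟨w, hw, rfl⟩
  rw [aeval_map_pair]
  exact isUnit_evalPair_of_isNilpotent _ (isNilpotent_x_axisCoord hbc hc)
    (isNilpotent_y_axisCoord hbc hb) hw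

variable {R : Type} [CommRing R] [Algebra k R] {x y : R}

lemma familyIdeal_axisCoord (b c : S) : familyIdeal k x y (axisCoord b c : ChartCoord S n r) =
    Ideal.span {incl S k y ^ (r + 1) - b • incl S k x ^ n,
      incl S k x ^ (n + 1) - c • incl S k y ^ r} := by
  rw [familyIdeal, relF_axisCoord, relG_axisCoord]

lemma familyIdeal_axisCoord_zero {m : ℕ} (hm : n + 1 + r = m) :
    familyIdeal k x y (axisCoord 0 0 : ChartCoord S n r) =
      (idealQ x y m (r + 1)).map (Algebra.TensorProduct.includeRight : R →ₐ[k] S ⊗[k] R).toRingHom := by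
  rw [familyIdeal_axisCoord, zero_smul, zero_smul, sub_zero, sub_zero, idealQ, Ideal.map_span,
    Set.image_pair, Set.pair_comm, show m - (r + 1) + 1 = n + 1 by omega]
  simp [incl]

end Axis

/-! ### The points of the Hilbert scheme of the node -/

section NodePoints

lemma eq_X_pow_of_forall_ne_zero {p : Polynomial ℂ} (hp : p.Monic)
    (h : ∀ α, p.eval α = 0 → α = 0) : p = Polynomial.X ^ p.natDegree := by
  have h1 := (IsAlgClosed.splits p).eq_prod_roots_of_monic hp
  have h2 : p.roots = Multiset.replicate p.natDegree 0 := by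
    rw [Multiset.eq_replicate]
    exact ⟨(IsAlgClosed.splits p).natDegree_eq_card_roots.symm,
      fun α hα ↦ h α (Polynomial.isRoot_of_mem_roots hα)⟩
  rw [h2] at h1
  simpa using h1

variable {n r : ℕ}

lemma monic_monicPoly {S : Type} [CommRing S] (p : Fin r → S) : (monicPoly p).Monic :=
  Polynomial.monic_X_pow_add (degree_fin_sum_lt p)

lemma natDegree_monicPoly {S : Type} [CommRing S] [Nontrivial S] (p : Fin r → S) :
    (monicPoly p).natDegree = r := by
  refine Polynomial.natDegree_eq_of_le_of_coeff_ne_zero ?_ ?_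
  · exact Polynomial.natDegree_le_iff_degree_le.2
      (Order.lt_succ_iff.1 (by exact_mod_cast degree_monicPoly_lt p))
  · rw [monicPoly_coeff_self]
    exact one_ne_zero

/-- The hypothesis says that the origin is the only `ℂ`-point of the subscheme; it is tested on the
line `x = 0`. If `c = 0`, the points there are the roots of `y P(y) - b Q(0)`, so this polynomial is
`y^(r+1)`; thus `P = y^r` and `b Q(0) = 0`, where `Q = 1` in case `n = 0`. If `c ≠ 0`, then `b = 0`
and the points there are the roots of `P`. -/
lemma p_eq_zero_of_forall {z : ChartCoord ℂ n r} (hbc : z.b * z.c = 0)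
    (h : ∀ X Y : ℂ, X * Y = 0 → relF z X Y = 0 → relG z X Y = 0 → X = 0 ∧ Y = 0) :
    z.p = 0 ∧ (n = 0 → z.b = 0) := by
  suffices h2 : monicPoly z.p = Polynomial.X ^ r ∧ (n = 0 → z.b = 0) from
    ⟨monicPoly_injective (h2.1.trans monicPoly_zero.symm), h2.2⟩
  by_cases hc : z.c = 0
  · let a := z.b * (monicPoly z.q).eval 0
    let d : Polynomial ℂ := Polynomial.X * monicPoly z.p - Polynomial.C a
    have hmon : (Polynomial.X * monicPoly z.p).Monic := Polynomial.monic_X.mul (monic_monicPoly _)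
    have hdeg : (Polynomial.X * monicPoly z.p).natDegree = r + 1 := by
      rw [Polynomial.monic_X.natDegree_mul (monic_monicPoly _), Polynomial.natDegree_X,
        natDegree_monicPoly, add_comm]
    have hlt : (Polynomial.C a).degree < (Polynomial.X * monicPoly z.p).degree := by
      refine Polynomial.degree_C_le.trans_lt ?_
      rw [Polynomial.degree_eq_natDegree hmon.ne_zero, hdeg]
      exact_mod_cast Nat.succ_pos r
    have hd : d.Monic := hmon.sub_of_left hlt
    have hdd : d.natDegree = r + 1 := by
      rw [← hdeg]
      exact Polynomial.natDegree_eq_of_degree_eq (Polynomial.degree_sub_eq_left_of_degree_lt hlt)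
    have h1 := eq_X_pow_of_forall_ne_zero hd (fun α hα ↦ by
      refine (h 0 α (zero_mul _) ?_ ?_).2
      · simpa [relF, d, a, Polynomial.aeval_def, Polynomial.eval₂_eq_eval_map] using hα
      · simp [relG, hc])
    rw [hdd] at h1
    have ha : a = 0 := by
      have h2 := congrArg (fun p ↦ Polynomial.coeff p 0) h1
      simpa [d] using h2
    constructor
    · refine mul_left_cancel₀ (Polynomial.X_ne_zero (R := ℂ)) ?_
      rw [← pow_succ', ← h1]
      simp [d, ha]
    · rintro rfl
      simpa [a, monicPoly] using ha
  · have hb : z.b = 0 := (mul_eq_zero.1 hbc).resolve_right hc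
    refine ⟨?_, fun _ ↦ hb⟩
    have h1 := eq_X_pow_of_forall_ne_zero (monic_monicPoly z.p) (fun α hα ↦ by
      have hα' : Polynomial.aeval α (monicPoly z.p) = 0 := by
        simpa [Polynomial.aeval_def, Polynomial.eval₂_eq_eval_map] using hα
      refine (h 0 α (zero_mul _) ?_ ?_).2
      · simp [relF, hb, hα']
      · simp [relG, hα'])
    rwa [natDegree_monicPoly] at h1

/-- The chart points of the node over `ℂ`. -/
theorem eq_axisCoord_of_isChartPoint {z : ChartCoord ℂ n r}
    (hz : IsChartPoint (0 : ℂ) (germSet ℂ) z) :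
    z = axisCoord z.b z.c ∧ z.b * z.c = 0 ∧ (n = 0 → z.b = 0) ∧ (r = 0 → z.c = 0) := by
  have hbc : z.b * z.c = 0 := hz.mul_eq.trans (map_zero _)
  -- A `ℂ`-point `(X, Y)` is a homomorphism from the chart algebra to `ℂ`. If `X ≠ 0`, the
  -- polynomial `x - X` has nonzero constant term and must be sent to a unit, yet it vanishes at the
  -- point; likewise for `Y`.
  have h (X Y : ℂ) (hXY : X * Y = 0) (hF : relF z X Y = 0) (hG : relG z X Y = 0) :
      X = 0 ∧ Y = 0 := by
    have hXY' : X * Y = algebraMap ℂ ℂ (z.b * z.c) := by rw [hbc, hXY, map_zero]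
    let φ : ChartAlg z →ₐ[ℂ] ℂ := ChartAlg.lift z X Y hXY' hF hG
    have key (w : MvPolynomial (Fin 2) ℂ) (hw : w ∉ originIdeal 2) :
        evalPair (RingHom.id ℂ) X Y w ≠ 0 := by
      have h1 := (hz.isUnit _ ⟨w, hw, rfl⟩).map φ
      rw [aeval_map_pair] at h1
      have h2 := map_evalPair ((algebraMap ℂ (ChartAlg z)).comp (algebraMap ℂ ℂ)) (φ : _ →+* ℂ)
        (ChartAlg.x z) (ChartAlg.y z) w
      have h3 : (φ : ChartAlg z →+* ℂ).comp
          ((algebraMap ℂ (ChartAlg z)).comp (algebraMap ℂ ℂ)) = RingHom.id ℂ := by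
        ext; simp
      rw [h3] at h2
      have h4 : (φ : ChartAlg z →+* ℂ) (ChartAlg.x z) = X := ChartAlg.lift_x z X Y hXY' hF hG
      have h5 : (φ : ChartAlg z →+* ℂ) (ChartAlg.y z) = Y := ChartAlg.lift_y z X Y hXY' hF hG
      rw [h4, h5] at h2
      rw [← h2]
      exact h1.ne_zero
    constructor
    · by_contra hX
      refine key (MvPolynomial.X 0 - MvPolynomial.C X) (by simpa [RingHom.mem_ker] using hX) ?_
      simp [evalPair_X_zero, evalPair_C]
    · by_contra hY
      refine key (MvPolynomial.X 1 - MvPolynomial.C Y) (by simpa [RingHom.mem_ker] using hY) ?_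
      simp [evalPair_X_one, evalPair_C]
  obtain ⟨h1, h2⟩ := p_eq_zero_of_forall hbc h
  obtain ⟨h3, h4⟩ := p_eq_zero_of_forall (z := z.swap) ((mul_comm _ _).trans hbc)
    (fun X Y hXY hF hG ↦ (h Y X ((mul_comm _ _).trans hXY) hG hF).symm)
  exact ⟨ChartCoord.ext rfl rfl h1 h3, hbc, h2, h4⟩

/-- The function `x` on the trivial family over `ℂ`. -/
abbrev incx : ℂ ⊗[ℂ] NodeGerm := incl ℂ ℂ (coord nodeEq 0)

/-- The function `y` on the trivial family over `ℂ`. -/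
abbrev incy : ℂ ⊗[ℂ] NodeGerm := incl ℂ ℂ (coord nodeEq 1)

lemma map_idealI (m i : ℕ) (a : ℂ) : (idealI m i a).map
    (Algebra.TensorProduct.includeRight : NodeGerm →ₐ[ℂ] ℂ ⊗[ℂ] NodeGerm).toRingHom =
      Ideal.span {incy ^ i + algebraMap ℂ (ℂ ⊗[ℂ] NodeGerm) a * incx ^ (m - i)} := by
  rw [idealI, Ideal.map_span, Set.image_singleton]
  have h : (Algebra.TensorProduct.includeRight : NodeGerm →ₐ[ℂ] ℂ ⊗[ℂ] NodeGerm)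
      (algebraMap ℂ NodeGerm a) = algebraMap ℂ (ℂ ⊗[ℂ] NodeGerm) a := AlgHom.commutes _ a
  rw [← h]
  refine congrArg (fun v ↦ Ideal.span {v}) ?_
  exact (map_add _ _ _).trans (by
    rw [map_mul, map_pow, map_pow]
    rfl)

lemma incx_mul_incy : incx * incy = 0 := by
  rw [incl_mul isGerm_node]; simp

/-- Multiplying `y^(r+1) - b x^n` by `x` leaves `-b x^(n+1)`, so the second generator is redundant.
-/
lemma familyIdeal_axisCoord_b {m : ℕ} (hm : n + 1 + r = m) {b : ℂ} (hb : b ≠ 0) :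
    familyIdeal ℂ (coord nodeEq 0) (coord nodeEq 1) (axisCoord b 0 : ChartCoord ℂ n r) =
      (idealI m (r + 1) (-b)).map
        (Algebra.TensorProduct.includeRight : NodeGerm →ₐ[ℂ] ℂ ⊗[ℂ] NodeGerm).toRingHom := by
  have e1 : m - (r + 1) = n := by omega
  have h2 : algebraMap ℂ (ℂ ⊗[ℂ] NodeGerm) b⁻¹ * algebraMap ℂ _ b = 1 := by
    rw [← map_mul, inv_mul_cancel₀ hb, map_one]
  rw [familyIdeal_axisCoord, map_idealI, e1, zero_smul, sub_zero, Algebra.smul_def, map_neg]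
  refine le_antisymm (Ideal.span_le.2 ?_) (Ideal.span_le.2 ?_)
  · rintro _ (rfl | rfl)
    · refine Ideal.mem_span_singleton'.2 ⟨1, ?_⟩
      ring
    · refine Ideal.mem_span_singleton'.2 ⟨-(algebraMap ℂ (ℂ ⊗[ℂ] NodeGerm) b⁻¹ * incx), ?_⟩
      linear_combination (incx ^ (n + 1)) * h2 -
        algebraMap ℂ (ℂ ⊗[ℂ] NodeGerm) b⁻¹ * incy ^ r * incx_mul_incy
  · rw [Set.singleton_subset_iff]
    refine Ideal.mem_span_pair.2 ⟨1, 0, ?_⟩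
    ring

/-- Here the generator `x^(n+1) - c y^r` suffices: times `y` it is `-c y^(r+1)`. The index is now
`r` and not `r + 1`, because the `c`-axis belongs to the component shared with the preceding chart,
and normalizing the coefficient of `y^r` inverts `c`. -/
lemma familyIdeal_axisCoord_c {m : ℕ} (hm : n + 1 + r = m) {c : ℂ} (hc : c ≠ 0) :
    familyIdeal ℂ (coord nodeEq 0) (coord nodeEq 1) (axisCoord 0 c : ChartCoord ℂ n r) =
      (idealI m r (-c⁻¹)).map
        (Algebra.TensorProduct.includeRight : NodeGerm →ₐ[ℂ] ℂ ⊗[ℂ] NodeGerm).toRingHom := by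
  have e1 : m - r = n + 1 := by omega
  have h2 : algebraMap ℂ (ℂ ⊗[ℂ] NodeGerm) c⁻¹ * algebraMap ℂ _ c = 1 := by
    rw [← map_mul, inv_mul_cancel₀ hc, map_one]
  rw [familyIdeal_axisCoord, map_idealI, e1, zero_smul, sub_zero, Algebra.smul_def,
    map_neg]
  refine le_antisymm (Ideal.span_le.2 ?_) (Ideal.span_le.2 ?_)
  · rintro _ (rfl | rfl)
    · refine Ideal.mem_span_singleton'.2 ⟨incy, ?_⟩
      linear_combination - algebraMap ℂ (ℂ ⊗[ℂ] NodeGerm) c⁻¹ * incx ^ n * incx_mul_incy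
    · refine Ideal.mem_span_singleton'.2 ⟨- algebraMap ℂ (ℂ ⊗[ℂ] NodeGerm) c, ?_⟩
      linear_combination (incx ^ (n + 1)) * h2
  · rw [Set.singleton_subset_iff]
    refine Ideal.mem_span_pair.2 ⟨0, - algebraMap ℂ (ℂ ⊗[ℂ] NodeGerm) c⁻¹, ?_⟩
    linear_combination (incy ^ r) * h2

end NodePoints

end

end NodeHilb


namespace NodeHilb

noncomputable section

/-! ### Hilbert schemes covered by universal charts -/

section Cover

variable {k R : Type} [CommRing k] [CommRing R] [Algebra k R] {m : ℕ} {Λ : Fin m → Type}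
  [∀ i, CommRing (Λ i)] [∀ i, Algebra k (Λ i)]

/-- A Hilbert scheme together with an open cover by the charts with coordinates `z i`. -/
structure ChartCover (x y : R) (z : ∀ i : Fin m, ChartCoord (Λ i) (m - 1 - i) i) where
  H : HilbertScheme k R m
  ι : ∀ i, Spec (CommRingCat.of (Λ i)) ⟶ H.carrier
  isOpenImmersion : ∀ i, IsOpenImmersion (ι i)
  ι_str : ∀ i, ι i ≫ H.str = Spec.map (CommRingCat.ofHom (algebraMap k (Λ i)))
  cover : ∀ p : H.carrier, ∃ i q, ι i q = p
  comp_ι_eq_iff : ∀ (i j : Fin m) (S : Type) [CommRing S] [Algebra k S] (u : Λ i →ₐ[k] S)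
    (v : Λ j →ₐ[k] S), specHom u ≫ ι i = specHom v ≫ ι j ↔
      familyIdeal k x y ((z i).map (u : Λ i →+* S)) = familyIdeal k x y ((z j).map (v : Λ j →+* S))
  family_ideal : ∀ (i : Fin m) (S : Type) [CommRing S] [Algebra k S] (u : Λ i →ₐ[k] S)
    (p : SPoint H.str S), p.1 = specHom u ≫ ι i →
      (H.family S p).ideal = familyIdeal k x y ((z i).map (u : Λ i →+* S))

attribute [instance] ChartCover.isOpenImmersion

variable {t : k} {W : Set (MvPolynomial (Fin 2) k)} {x y : R}
  {z : ∀ i : Fin m, ChartCoord (Λ i) (m - 1 - i) i}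

theorem exists_chartCover (hR : IsGerm t W x y) (hz : ∀ i, IsUniversal t W (z i)) (hm : 1 ≤ m) :
    Nonempty (ChartCover (k := k) x y z) := by
  obtain ⟨A⟩ := exists_hilbAtlas hR fun i ↦ ChartRing.ofUniversal hR (hz i)
  exact ⟨{ H := A.hilbertScheme hR hm
           ι := A.ι
           isOpenImmersion := A.isOpenImmersion
           ι_str := A.ι_str
           cover := A.cover
           comp_ι_eq_iff := fun i j S _ _ u v ↦ by
             rw [← familyIdeal_map, ← familyIdeal_map]
             exact A.comp_ι_eq_iff i j S u v
           family_ideal := fun i S _ _ u p hp ↦ by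
             rw [← familyIdeal_map]
             exact A.family_ideal hR hm i u p hp }⟩

lemma specPt_specHom {A κ : Type} [CommRing A] [Algebra k A] [Field κ] [Algebra k κ]
    (u : A →ₐ[k] κ) :
    (specPt (specHom u (IsLocalRing.closedPoint κ))).asIdeal = RingHom.ker (u : A →+* κ) := by
  have h : (IsLocalRing.closedPoint κ).asIdeal = ⊥ := IsLocalRing.maximalIdeal_eq_bot
  ext a
  exact (show u a ∈ (IsLocalRing.closedPoint κ).asIdeal ↔ _ by rw [h]; rfl)

lemma specHom_closedPoint_eq_iff {A κ : Type} [CommRing A] [Algebra k A] [Field κ] [Algebra k κ]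
    (u : A →ₐ[k] κ) (q : Spec (CommRingCat.of A)) :
    specHom u (IsLocalRing.closedPoint κ) = q ↔ RingHom.ker (u : A →+* κ) = (specPt q).asIdeal := by
  rw [← specPt_specHom]
  exact (PrimeSpectrum.ext_iff (x := specPt (specHom u (IsLocalRing.closedPoint κ)))
    (y := specPt q))

namespace ChartCover

variable (K : ChartCover (k := k) x y z) {κ : Type} [Field κ] [Algebra k κ]

lemma exists_hom_of_point (p : SPoint K.H.str κ) (i : Fin m) (q : Spec (CommRingCat.of (Λ i)))
    (hp : p.1 (IsLocalRing.closedPoint κ) = K.ι i q) :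
    ∃ u : Λ i →ₐ[k] κ, p.1 = specHom u ≫ K.ι i ∧ specHom u (IsLocalRing.closedPoint κ) = q := by
  have hr : Set.range p.1 ⊆ Set.range (K.ι i) := by
    rintro _ ⟨v, rfl⟩
    rw [Subsingleton.elim v (IsLocalRing.closedPoint κ), hp]
    exact ⟨q, rfl⟩
  let f := IsOpenImmersion.lift (K.ι i) p.1 hr
  have hf : f ≫ K.ι i = p.1 := IsOpenImmersion.lift_fac _ _ _
  obtain ⟨u, hu⟩ := exists_specHom_eq (k := k) f (by rw [← K.ι_str, ← Category.assoc, hf, p.2])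
  refine ⟨u, by rw [← hu, hf], ?_⟩
  rw [← hu]
  refine (K.ι i).injective (Eq.trans ?_ hp)
  exact (Scheme.Hom.comp_apply f (K.ι i) _).symm.trans
    (congrArg (fun g : Spec (CommRingCat.of κ) ⟶ K.H.carrier ↦ g (IsLocalRing.closedPoint κ)) hf)

/-- The point of the Hilbert scheme with the given coordinates. -/
def point {i : Fin m} {S : Type} [CommRing S] [Algebra k S] (u : Λ i →ₐ[k] S) : SPoint K.H.str S :=
  ⟨specHom u ≫ K.ι i, by rw [Category.assoc, K.ι_str, specHom_structure]⟩

lemma isRationalPoint_iff (i : Fin m) (q : Spec (CommRingCat.of (Λ i))) :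
    K.H.IsRationalPoint κ (K.ι i q) ↔
      ∃ u : Λ i →ₐ[k] κ, specHom u (IsLocalRing.closedPoint κ) = q := by
  constructor
  · rintro ⟨p, hp⟩
    obtain ⟨u, -, hu⟩ := K.exists_hom_of_point p i q hp
    exact ⟨u, hu⟩
  · rintro ⟨u, rfl⟩
    exact ⟨K.point u, rfl⟩

lemma isPoint_iff (J : Ideal R) (i : Fin m) (q : Spec (CommRingCat.of (Λ i))) :
    K.H.IsPoint κ J (K.ι i q) ↔
      ∃ u : Λ i →ₐ[k] κ, specHom u (IsLocalRing.closedPoint κ) = q ∧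
        familyIdeal k x y ((z i).map (u : Λ i →+* κ)) =
          J.map (Algebra.TensorProduct.includeRight : R →ₐ[k] κ ⊗[k] R).toRingHom := by
  constructor
  · rintro ⟨p, hp, hJ⟩
    obtain ⟨u, hu, hu2⟩ := K.exists_hom_of_point p i q hp
    exact ⟨u, hu2, by rw [← hJ, K.family_ideal i κ u p hu]⟩
  · rintro ⟨u, rfl, hu⟩
    exact ⟨K.point u, rfl, by rw [← hu, K.family_ideal i κ u _ rfl]⟩

lemma ι_eq_of_familyIdeal_eq {i j : Fin m} {S : Type} [CommRing S] [Algebra k S] (u : Λ i →ₐ[k] S)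
    (v : Λ j →ₐ[k] S) (h : familyIdeal k x y ((z i).map (u : Λ i →+* S)) =
      familyIdeal k x y ((z j).map (v : Λ j →+* S))) (s : Spec (CommRingCat.of S)) :
    K.ι i (specHom u s) = K.ι j (specHom v s) := by
  rw [← Scheme.Hom.comp_apply, (K.comp_ι_eq_iff i j S u v).2 h, Scheme.Hom.comp_apply]

/-- A common point of two charts comes from a field-valued point. -/
lemma exists_of_ι_eq {i j : Fin m} (q : Spec (CommRingCat.of (Λ i)))
    (q' : Spec (CommRingCat.of (Λ j))) (h : K.ι i q = K.ι j q') :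
    ∃ (κ : Type) (_ : Field κ) (_ : Algebra k κ) (u : Λ i →ₐ[k] κ) (v : Λ j →ₐ[k] κ),
      specHom u (IsLocalRing.closedPoint κ) = q ∧ specHom v (IsLocalRing.closedPoint κ) = q' ∧
      familyIdeal k x y ((z i).map (u : Λ i →+* κ)) =
        familyIdeal k x y ((z j).map (v : Λ j →+* κ)) := by
  let κ := (specPt q).asIdeal.ResidueField
  let u : Λ i →ₐ[k] κ := IsScalarTower.toAlgHom k (Λ i) κ
  have hu : specHom u (IsLocalRing.closedPoint κ) = q := by
    rw [specHom_closedPoint_eq_iff]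
    exact Ideal.ker_algebraMap_residueField _
  obtain ⟨v, hv, hv2⟩ := K.exists_hom_of_point (K.point u) j q'
    ((congrArg (K.ι i) hu).trans h)
  exact ⟨κ, inferInstance, inferInstance, u, v, hu, hv2, (K.comp_ι_eq_iff i j κ u v).1 hv⟩

end ChartCover

end Cover

end

end NodeHilb


namespace NodeHilb

noncomputable section

/-! ### The coordinate subspaces of a chart of the node -/

section NodeIdeal

variable {m n r : ℕ} (h : n + 1 + r = m)

/-- The quotient of the coordinate ring of `b c = 0` by some of the coordinates. -/
def nodeQuotientEquiv (m : ℕ) (K : Finset (Fin (m + 1))) (hK : 0 ∈ K ∨ 1 ∈ K) :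
    (NodeAff m ⧸ Ideal.span (nodeVar m '' K)) ≃ₐ[ℂ] MvPolynomial {j // j ∉ K} ℂ := by
  let v (j : Fin (m + 1)) : MvPolynomial {j // j ∉ K} ℂ :=
    if hj : j ∈ K then 0 else MvPolynomial.X ⟨j, hj⟩
  have hv {j} (hj : j ∈ K) : v j = 0 := dif_pos hj
  have hv' {j} (hj : j ∉ K) : v j = MvPolynomial.X ⟨j, hj⟩ := dif_neg hj
  have h1 (a : MvPolynomial (Fin (m + 1)) ℂ) (ha : a ∈ Ideal.span {eqBC m}) :
      MvPolynomial.aeval v a = 0 := by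
    have hle : Ideal.span {eqBC m} ≤ RingHom.ker (MvPolynomial.aeval (R := ℂ) v) := by
      rw [Ideal.span_le, Set.singleton_subset_iff]
      rcases hK with hK | hK <;> simp [RingHom.mem_ker, hv hK]
    exact hle ha
  let f : NodeAff m →ₐ[ℂ] MvPolynomial {j // j ∉ K} ℂ := Ideal.Quotient.liftₐ _ _ h1
  have hf (j) : f (nodeVar m j) = v j := MvPolynomial.aeval_X v j
  have h2 (a : NodeAff m) (ha : a ∈ Ideal.span (nodeVar m '' K)) : f a = 0 := by
    have hle : Ideal.span (nodeVar m '' K) ≤ RingHom.ker f := by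
      rw [Ideal.span_le]
      rintro _ ⟨j, hj, rfl⟩
      exact (hf j).trans (hv hj)
    exact hle ha
  let F : (NodeAff m ⧸ Ideal.span (nodeVar m '' K)) →ₐ[ℂ] MvPolynomial {j // j ∉ K} ℂ :=
    Ideal.Quotient.liftₐ _ f h2
  have hF (j) : F (Ideal.Quotient.mk _ (nodeVar m j)) = v j := hf j
  let G : MvPolynomial {j // j ∉ K} ℂ →ₐ[ℂ] NodeAff m ⧸ Ideal.span (nodeVar m '' K) :=
    MvPolynomial.aeval fun j : {j // j ∉ K} ↦ Ideal.Quotient.mk _ (nodeVar m j)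
  have hG (j) : G (MvPolynomial.X j) = Ideal.Quotient.mk _ (nodeVar m j) := MvPolynomial.aeval_X _ j
  refine AlgEquiv.ofAlgHom F G ?_ ?_
  · refine MvPolynomial.algHom_ext fun j ↦ ?_
    exact (congrArg F (hG j)).trans ((hF j).trans (hv' j.2))
  · suffices h4 : (G.comp F).toRingHom.comp (Ideal.Quotient.mk _) =
        Ideal.Quotient.mk (Ideal.span (nodeVar m '' K)) from
      AlgHom.coe_ringHom_injective (Ideal.Quotient.ringHom_ext h4)
    refine nodeAff_ringHom_ext (S := NodeAff m ⧸ Ideal.span (nodeVar m '' K)) ?_ ?_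
    · ext a
      exact AlgHom.commutes (G.comp F) a
    · intro j
      have h3 : G (F (Ideal.Quotient.mk _ (nodeVar m j))) = Ideal.Quotient.mk _ (nodeVar m j) := by
        by_cases hj : j ∈ K
        · exact (congrArg G ((hF j).trans (hv hj))).trans ((map_zero G).trans
            (Ideal.Quotient.eq_zero_iff_mem.2 (Ideal.subset_span (Set.mem_image_of_mem _ hj))).symm)
        · exact (congrArg G ((hF j).trans (hv' hj))).trans (hG _)
      exact h3

/-- The ideal of a coordinate subspace of a chart. -/
def nodeIdeal (K : Finset (Fin (m + 1))) : Ideal (NodeChart h) :=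
  (Ideal.span (nodeVar m '' K)).map (algebraMap (NodeAff m) (NodeChart h))

lemma isPolyLoc_nodeIdeal (K : Finset (Fin (m + 1))) (hK : 0 ∈ K ∨ 1 ∈ K) :
    IsPolyLoc (m + 1 - K.card) (NodeChart h ⧸ nodeIdeal h K) := by
  have h1 := IsPolyLoc.quotient (B := NodeChart h) _ (nodeQuotientEquiv m K hK) (nodeMonoid h)
  have h2 : Nat.card {j // j ∉ K} = m + 1 - K.card := by
    rw [Nat.card_eq_fintype_card, Fintype.card_subtype_compl, Fintype.card_fin, Fintype.card_coe]
  rw [h2] at h1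
  exact h1

lemma nodeIdeal_union (K K' : Finset (Fin (m + 1))) :
    nodeIdeal h (K ∪ K') = nodeIdeal h K ⊔ nodeIdeal h K' := by
  rw [nodeIdeal, nodeIdeal, nodeIdeal, ← Ideal.map_sup, ← Ideal.span_union, Finset.coe_union,
    Set.image_union]

lemma nodeIdeal_singleton (j : Fin (m + 1)) :
    nodeIdeal h {j} = Ideal.span {algebraMap (NodeAff m) (NodeChart h) (nodeVar m j)} := by
  rw [nodeIdeal, Finset.coe_singleton, Set.image_singleton, Ideal.map_span, Set.image_singleton]

/-- If a multiple of `z₀` is a multiple of `z₁` modulo `z₀ z₁`, then the prime `z₁` divides the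
cofactor of `z₀`, so the element is zero. For `m = 0` the indices `0` and `1` would coincide. -/
lemma span_nodeVar_inf (hm : m ≠ 0) :
    Ideal.span {nodeVar m 0} ⊓ Ideal.span {nodeVar m 1} = (⊥ : Ideal (NodeAff m)) := by
  rw [eq_bot_iff]
  rintro a ⟨h0, h1⟩
  obtain ⟨c, rfl⟩ := Ideal.mem_span_singleton'.1 h0
  obtain ⟨d, hd⟩ := Ideal.mem_span_singleton'.1 h1
  obtain ⟨c, rfl⟩ := Ideal.Quotient.mk_surjective c
  obtain ⟨d, rfl⟩ := Ideal.Quotient.mk_surjective d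
  have h2 : d * MvPolynomial.X 1 - c * MvPolynomial.X 0 ∈ Ideal.span {eqBC m} :=
    Ideal.Quotient.eq.1 hd
  obtain ⟨e, he⟩ := Ideal.mem_span_singleton'.1 h2
  have h01 : (1 : Fin (m + 1)) ≠ 0 := by
    obtain ⟨m, rfl⟩ := Nat.exists_eq_succ_of_ne_zero hm
    exact one_ne_zero
  have h3 : (MvPolynomial.X 1 : MvPolynomial (Fin (m + 1)) ℂ) ∣ c * MvPolynomial.X 0 :=
    ⟨d - e * MvPolynomial.X 0, by linear_combination he⟩
  have h4 : (MvPolynomial.X 1 : MvPolynomial (Fin (m + 1)) ℂ) ∣ c := by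
    refine ((MvPolynomial.X_prime (R := ℂ) (i := (1 : Fin (m + 1)))).dvd_or_dvd h3).resolve_right fun h5 ↦ ?_
    rw [MvPolynomial.X_dvd_X] at h5
    exact h01 h5
  obtain ⟨f, rfl⟩ := h4
  have h6 : Ideal.Quotient.mk (Ideal.span {eqBC m}) (MvPolynomial.X 1 * f * MvPolynomial.X 0) = 0 :=
    Ideal.Quotient.eq_zero_iff_mem.2 (Ideal.mem_span_singleton'.2 ⟨f, by ring⟩)
  exact h6

lemma nodeIdeal_inf : nodeIdeal h {0} ⊓ nodeIdeal h {1} = ⊥ := by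
  rw [nodeIdeal, nodeIdeal, ← IsLocalization.map_inf (nodeMonoid h), Finset.coe_singleton,
    Finset.coe_singleton, Set.image_singleton, Set.image_singleton, span_nodeVar_inf (by omega),
    Ideal.map_bot]

lemma nodeIdeal_zero : nodeIdeal h {0} = Ideal.span {(nodePoint h).c} := nodeIdeal_singleton h 0

lemma nodeIdeal_one : nodeIdeal h {1} = Ideal.span {(nodePoint h).b} := nodeIdeal_singleton h 1

end NodeIdeal

/-! ### The local ring at the origin -/

section LocalRing

variable {m n r : ℕ} (h : n + 1 + r = m)

lemma algHom_eq_zero_of_map_eq {u : NodeChart h →ₐ[ℂ] ℂ}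
    (hu : (nodePoint h).map (u : NodeChart h →+* ℂ) = axisCoord 0 0) (j : Fin (m + 1)) :
    u (algebraMap (NodeAff m) (NodeChart h) (nodeVar m j)) = 0 := by
  have h0 : (axisCoord 0 0 : ChartCoord ℂ n r) = coordOf h 0 := rfl
  rw [nodePoint, coordOf_map, coordOf_map, h0] at hu
  exact congrFun (coordOf_injective h hu) j

lemma comap_ker_eq {u : NodeChart h →ₐ[ℂ] ℂ}
    (hu : (nodePoint h).map (u : NodeChart h →+* ℂ) = axisCoord 0 0) :
    (RingHom.ker u).comap ((algebraMap (NodeAff m) (NodeChart h)).comp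
      (Ideal.Quotient.mk (Ideal.span {eqBC m}))) = originIdeal (m + 1) := by
  have h1 : ((u : NodeChart h →+* ℂ).comp (algebraMap (NodeAff m) (NodeChart h))).comp
      (Ideal.Quotient.mk (Ideal.span {eqBC m})) = MvPolynomial.constantCoeff := by
    refine MvPolynomial.ringHom_ext (fun a ↦ ?_) (fun j ↦ ?_)
    · rw [MvPolynomial.constantCoeff_C]
      exact u.commutes a
    · rw [MvPolynomial.constantCoeff_X]
      exact algHom_eq_zero_of_map_eq h hu j
  ext a
  rw [RingHom.mem_ker, ← h1]
  rfl

/-- At the origin the chart is the hypersurface `b c = 0`. -/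
theorem exists_localization_equiv {u : NodeChart h →ₐ[ℂ] ℂ}
    (hu : (nodePoint h).map (u : NodeChart h →+* ℂ) = axisCoord 0 0) (q : Ideal (NodeChart h))
    [q.IsPrime] (hq : RingHom.ker u = q) :
    ∃ φ : Localization.AtPrime q ≃+* HypersurfaceGerm (m + 1) (eqBC m),
      (∀ a : ℂ, φ (algebraMap (NodeChart h) _ (algebraMap ℂ _ a)) = algebraMap ℂ _ a) ∧
      ∀ j, φ (algebraMap (NodeChart h) _ (algebraMap (NodeAff m) _ (nodeVar m j))) =
        coord (eqBC m) j := by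
  subst hq
  have h1 : IsLocalization.AtPrime (Localization.AtPrime (RingHom.ker u))
      ((RingHom.ker u).comap (algebraMap (NodeAff m) (NodeChart h))) :=
    IsLocalization.isLocalization_isLocalization_atPrime_isLocalization (nodeMonoid h) _ _
  have h2 : (originIdeal (m + 1)).primeCompl.map (Ideal.Quotient.mk (Ideal.span {eqBC m})) =
      ((RingHom.ker u).comap (algebraMap (NodeAff m) (NodeChart h))).primeCompl := by
    ext a
    constructor
    · rintro ⟨p, hp, rfl⟩ hp'
      exact hp ((comap_ker_eq h hu).le hp')
    · intro ha
      obtain ⟨p, rfl⟩ := Ideal.Quotient.mk_surjective a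
      exact ⟨p, fun hp ↦ ha ((comap_ker_eq h hu).ge hp), rfl⟩
  have h3 : IsLocalization ((originIdeal (m + 1)).primeCompl.map
      (Ideal.Quotient.mk (Ideal.span {eqBC m}))) (Localization.AtPrime (RingHom.ker u)) := by
    rw [h2]
    exact h1
  let φ := IsLocalization.algEquiv ((originIdeal (m + 1)).primeCompl.map
      (Ideal.Quotient.mk (Ideal.span {eqBC m}))) (Localization.AtPrime (RingHom.ker u))
      (HypersurfaceGerm (m + 1) (eqBC m))
  exact ⟨φ.toRingEquiv, fun a ↦ φ.commutes (algebraMap ℂ (NodeAff m) a),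
    fun j ↦ φ.commutes (nodeVar m j)⟩

end LocalRing

end

end NodeHilb


namespace NodeHilb

noncomputable section

/-! ### Subschemes that are polynomial germs in the charts -/

section Subschemes

/-- A scheme is integral if it is covered by spectra of domains that meet pairwise. -/
theorem isIntegral_of_charts {Y : Scheme.{0}} {ι : Type} [Nonempty ι] {A : ι → Type}
    [∀ i, CommRing (A i)] [∀ i, IsDomain (A i)] (g : ∀ i, Spec (CommRingCat.of (A i)) ⟶ Y)
    [∀ i, IsOpenImmersion (g i)] (hg : ∀ p : Y, ∃ i, p ∈ Set.range (g i))
    (hmeet : ∀ i j, (Set.range (g i) ∩ Set.range (g j)).Nonempty) : IsIntegral Y := by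
  have h1 : IsReduced Y := by
    have (p : Y) : _root_.IsReduced (Y.presheaf.stalk p) := by
      obtain ⟨i, q, rfl⟩ := hg p
      have : IsDomain (Localization.AtPrime (specPt q).asIdeal) :=
        IsLocalization.isDomain_localization (Ideal.primeCompl_le_nonZeroDivisors _)
      exact isReduced_of_injective (chartStalk (g i) q).toRingHom (chartStalk (g i) q).injective
    exact isReduced_of_isReduced_stalk Y
  have hI (i : ι) : PreirreducibleSpace (Spec (CommRingCat.of (A i))) := by
    have : IrreducibleSpace (PrimeSpectrum (A i)) := inferInstance
    exact this.toPreirreducibleSpace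
  -- Given `U` meeting chart `i` and `V` meeting chart `j`: by irreducibility of chart `i`, `U`
  -- meets the overlap of the two charts, hence meets chart `j`, and there it meets `V`.
  have h2 : PreirreducibleSpace Y := by
    refine PreirreducibleSpace.of_forall_nonempty_inter fun U V hU hV hU' hV' ↦ ?_
    obtain ⟨p, hp⟩ := hU'
    obtain ⟨i, p, rfl⟩ := hg p
    obtain ⟨q, hq⟩ := hV'
    obtain ⟨j, q, rfl⟩ := hg q
    obtain ⟨_, ⟨a, rfl⟩, ⟨b, hb⟩⟩ := hmeet i j
    obtain ⟨c, hc, d, hd⟩ := nonempty_preirreducible_inter (X := Spec (CommRingCat.of (A i)))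
      (hU.preimage (g i).continuous) ((g j).isOpenEmbedding.isOpen_range.preimage (g i).continuous)
      ⟨p, hp⟩ ⟨a, b, hb⟩
    have hd' : d ∈ g j ⁻¹' U := by
      rw [Set.mem_preimage, hd]
      exact hc
    obtain ⟨e, he, he'⟩ := nonempty_preirreducible_inter (X := Spec (CommRingCat.of (A j)))
      (hU.preimage (g j).continuous) (hV.preimage (g j).continuous) ⟨d, hd'⟩ ⟨q, hq⟩
    exact ⟨g j e, he, he'⟩
  have h3 : IrreducibleSpace Y := by
    obtain ⟨p, -⟩ := hmeet (Classical.arbitrary ι) (Classical.arbitrary ι)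
    exact { toNonempty := ⟨p⟩ }
  exact isIntegral_of_irreducibleSpace_of_isReduced Y

variable {R : Type} [CommRing R] [Algebra ℂ R] {m d : ℕ} {Λ : Fin m → Type}
  [∀ i, CommRing (Λ i)] [∀ i, Algebra ℂ (Λ i)] {x y : R}
  {z : ∀ i : Fin m, ChartCoord (Λ i) (m - 1 - i) i}

namespace ChartCover

variable (K : ChartCover (k := ℂ) x y z)

/-- The polynomial structure is required only in charts where the ideal is proper, as the subscheme
has no points in the others. A `ℂ`-point of the ambient chart that lies on the subscheme descends to
the quotient ring, which gives the dimension. -/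
lemma smoothAt_subscheme {D : K.H.carrier.IdealSheafData}
    (hD : ∀ i, sheafIdeal (K.ι i) D ≠ ⊤ → IsPolyLoc d (Λ i ⧸ sheafIdeal (K.ι i) D))
    (p : D.subscheme) : SmoothAt (D.subschemeι ≫ K.H.str) p ∧
      (K.H.IsRationalPoint ℂ (D.subschemeι p) → ringKrullDim (D.subscheme.presheaf.stalk p) = d) := by
  obtain ⟨i, q, hq⟩ := K.cover (D.subschemeι p)
  obtain ⟨g, hg, hgι, hmem⟩ := exists_subscheme_chart (K.ι i) D
  obtain ⟨w, rfl⟩ := hmem p ⟨q, hq⟩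
  have hne : sheafIdeal (K.ι i) D ≠ ⊤ := fun h ↦ by
    have h1 := (specPt w).2.ne_top
    rw [Ne, Ideal.eq_top_iff_one] at h1
    refine h1 ?_
    have h2 : (1 : Λ i ⧸ sheafIdeal (K.ι i) D) = 0 := by
      have := Ideal.Quotient.subsingleton_iff.2 h
      exact Subsingleton.elim _ _
    rw [h2]
    exact zero_mem (specPt w).asIdeal
  have hP := hD i hne
  have hs : g ≫ D.subschemeι ≫ K.H.str =
      Spec.map (CommRingCat.ofHom (algebraMap ℂ (Λ i ⧸ sheafIdeal (K.ι i) D))) := by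
    rw [← Category.assoc, hgι, Category.assoc, K.ι_str, ← Spec.map_comp, ← CommRingCat.ofHom_comp]
  refine ⟨smoothAt_of_chart g _ hs w (hP.isRegularLocalRing _) (hP.formallySmooth _), fun hr ↦ ?_⟩
  rw [ringKrullDim_stalk_chart]
  have h1 : D.subschemeι (g w) =
      K.ι i (Spec.map (CommRingCat.ofHom (Ideal.Quotient.mk (sheafIdeal (K.ι i) D))) w) := by
    rw [← Scheme.Hom.comp_apply, hgι, Scheme.Hom.comp_apply]
  rw [h1, K.isRationalPoint_iff] at hr
  obtain ⟨u, hu⟩ := hr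
  rw [specHom_closedPoint_eq_iff] at hu
  have hu' (a : Λ i) : u a = 0 ↔ Ideal.Quotient.mk (sheafIdeal (K.ι i) D) a ∈ (specPt w).asIdeal :=
    (SetLike.ext_iff.1 hu a)
  let φ : (Λ i ⧸ sheafIdeal (K.ι i) D) →ₐ[ℂ] ℂ := Ideal.Quotient.liftₐ _ u fun a ha ↦ by
    rw [← RingHom.mem_ker, RingHom.mem_ker]
    refine (hu' a).2 ?_
    rw [Ideal.Quotient.eq_zero_iff_mem.2 ha]
    exact zero_mem _
  refine hP.ringKrullDim _ φ ?_
  ext a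
  obtain ⟨a, rfl⟩ := Ideal.Quotient.mk_surjective a
  exact hu' a

lemma isIntegral_subscheme {D : K.H.carrier.IdealSheafData}
    (hD : ∀ i, sheafIdeal (K.ι i) D ≠ ⊤ → IsPolyLoc d (Λ i ⧸ sheafIdeal (K.ι i) D))
    (hne : ∃ i, sheafIdeal (K.ι i) D ≠ ⊤)
    (hmeet : ∀ i j, sheafIdeal (K.ι i) D ≠ ⊤ → sheafIdeal (K.ι j) D ≠ ⊤ →
      ∃ p ∈ D.support, p ∈ Set.range (K.ι i) ∧ p ∈ Set.range (K.ι j)) : IsIntegral D.subscheme := by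
  choose g hg hgι hmem using fun i ↦ exists_subscheme_chart (K.ι i) D
  have (i : {i // sheafIdeal (K.ι i) D ≠ ⊤}) : IsDomain (Λ i ⧸ sheafIdeal (K.ι i) D) := by
    have := Ideal.Quotient.nontrivial_iff.2 i.2
    exact (hD i i.2).isDomain
  have : Nonempty {i // sheafIdeal (K.ι i) D ≠ ⊤} := ⟨⟨_, hne.choose_spec⟩⟩
  refine isIntegral_of_charts (fun i : {i // sheafIdeal (K.ι i) D ≠ ⊤} ↦ g i) (fun p ↦ ?_)
    fun i j ↦ ?_
  · obtain ⟨i, q, hq⟩ := K.cover (D.subschemeι p)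
    obtain ⟨w, rfl⟩ := hmem i p ⟨q, hq⟩
    refine ⟨⟨i, fun h ↦ ?_⟩, w, rfl⟩
    have h0 := Ideal.Quotient.subsingleton_iff.2 h
    exact (specPt w).2.ne_top (Subsingleton.elim _ _)
  · obtain ⟨p, hp, hi, hj⟩ := hmeet i j i.2 j.2
    have hp' : p ∈ Set.range D.subschemeι := by
      rw [Scheme.IdealSheafData.range_subschemeι]
      exact hp
    obtain ⟨w, rfl⟩ := hp'
    exact ⟨w, hmem i w hi, hmem j w hj⟩

end ChartCover

end Subschemes

end

end NodeHilb


namespace NodeHilb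

noncomputable section

/-! ### The components of the Hilbert scheme of the node -/

section Strata

variable {m : ℕ}

lemma chart_size (i : Fin m) : m - 1 - i.1 + 1 + i.1 = m := by have := i.2; omega

/-- The ring of the `i`-th chart of the Hilbert scheme of the node. -/
abbrev NodeRing (i : Fin m) : Type := NodeChart (chart_size i)

/-- The universal point of the `i`-th chart of the Hilbert scheme of the node. -/
abbrev nodeUniv (i : Fin m) : ChartCoord (NodeRing i) (m - 1 - i.1) i.1 := nodePoint (chart_size i)

/-- The Hilbert scheme of the node with its charts. -/
abbrev NodeCover (m : ℕ) : Type 1 :=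
  ChartCover (k := ℂ) (coord nodeEq 0) (coord nodeEq 1) (fun i : Fin m ↦ nodeUniv i)

lemma nodeUniv_mul (i : Fin m) : (nodeUniv i).b * (nodeUniv i).c = 0 := by
  rw [(isUniversal_nodePoint (chart_size i)).isChartPoint.mul_eq, map_zero]

/-- The ideal of the `j`-th component in the `i`-th chart. -/
def strataIdeal (i : Fin m) (j : Fin (m + 1)) : Ideal (NodeRing i) :=
  -- Chart `i` sees only two components: `b = 0`, variable `1`, is the component `i`, and `c = 0`,
  -- variable `0`, is the component `i + 1`.
  if j = i.castSucc then nodeIdeal (chart_size i) {1} else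
    if j = i.succ then nodeIdeal (chart_size i) {0} else ⊤

lemma strataIdeal_castSucc (i : Fin m) :
    strataIdeal i i.castSucc = nodeIdeal (chart_size i) {1} := if_pos rfl

lemma strataIdeal_succ (i : Fin m) : strataIdeal i i.succ = nodeIdeal (chart_size i) {0} := by
  rw [strataIdeal, if_neg (Fin.castSucc_lt_succ (i := i)).ne', if_pos rfl]

lemma strataIdeal_of_ne {i : Fin m} {j : Fin (m + 1)} (h1 : j ≠ i.castSucc) (h2 : j ≠ i.succ) :
    strataIdeal i j = ⊤ := by
  rw [strataIdeal, if_neg h1, if_neg h2]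

lemma strataIdeal_le_iff {i : Fin m} {j : Fin (m + 1)} {q : Ideal (NodeRing i)} [q.IsPrime] :
    strataIdeal i j ≤ q ↔ (j = i.castSucc ∧ (nodeUniv i).b ∈ q) ∨ (j = i.succ ∧ (nodeUniv i).c ∈ q) := by
  have h0 : i.succ ≠ i.castSucc := (Fin.castSucc_lt_succ (i := i)).ne'
  by_cases h1 : j = i.castSucc
  · subst h1
    rw [strataIdeal_castSucc, nodeIdeal_one, Ideal.span_le, Set.singleton_subset_iff]
    simp [h0.symm]
  by_cases h2 : j = i.succ
  · subst h2
    rw [strataIdeal_succ, nodeIdeal_zero, Ideal.span_le, Set.singleton_subset_iff]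
    simp [h0]
  rw [strataIdeal_of_ne h1 h2, top_le_iff]
  simp [h1, h2, Ideal.IsPrime.ne_top]

lemma isPolyLoc_strataIdeal (i : Fin m) (j : Fin (m + 1)) (h : strataIdeal i j ≠ ⊤) :
    IsPolyLoc m (NodeRing i ⧸ strataIdeal i j) := by
  by_cases h1 : j = i.castSucc
  · subst h1
    rw [strataIdeal_castSucc]
    exact isPolyLoc_nodeIdeal _ _ (Or.inr (by simp))
  by_cases h2 : j = i.succ
  · subst h2
    rw [strataIdeal_succ]
    exact isPolyLoc_nodeIdeal _ _ (Or.inl (by simp))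
  exact (h (strataIdeal_of_ne h1 h2)).elim

/-- Ensures that the reduced structure on the glued set recovers exactly these ideals in the charts.
-/
lemma isRadical_strataIdeal (i : Fin m) (j : Fin (m + 1)) : (strataIdeal i j).IsRadical := by
  by_cases h : strataIdeal i j = ⊤
  · rw [h]
    exact fun _ _ ↦ trivial
  · have := Ideal.Quotient.nontrivial_iff.2 h
    have := (isPolyLoc_strataIdeal i j h).isDomain
    rw [Ideal.isRadical_iff_quotient_reduced]
    infer_instance

variable (K : NodeCover m)

/-- The hyperplanes of different charts match. By `overlap`, at a common point of the charts `i` and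
`i + 1` the first has `b ≠ 0` and the second `c ≠ 0`. As `b c = 0` in a field, the point lies on `c
= 0` in the first and on `b = 0` in the second, and on no other hyperplane; both are the component
`i + 1`. -/
lemma strataIdeal_le_of_ι_eq {i i' : Fin m} {j : Fin (m + 1)} {q : Spec (CommRingCat.of (NodeRing i))}
    {q' : Spec (CommRingCat.of (NodeRing i'))} (h : K.ι i q = K.ι i' q')
    (hq : strataIdeal i' j ≤ (specPt q').asIdeal) : strataIdeal i j ≤ (specPt q).asIdeal := by
  obtain ⟨κ, _, _, u, v, hu, hv, huv⟩ := K.exists_of_ι_eq q q' h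
  rw [specHom_closedPoint_eq_iff] at hu hv
  have hu' (a) : a ∈ (specPt q).asIdeal ↔ u a = 0 := (SetLike.ext_iff.1 hu a).symm
  have hv' (a) : a ∈ (specPt q').asIdeal ↔ v a = 0 := (SetLike.ext_iff.1 hv a).symm
  have hz := isChartPoint_map (isUniversal_nodePoint (chart_size i)).isChartPoint u
  have hz' := isChartPoint_map (isUniversal_nodePoint (chart_size i')).isChartPoint v
  have hbc : u (nodeUniv i).b * u (nodeUniv i).c = 0 := by
    rw [← map_mul, nodeUniv_mul, map_zero]
  rw [strataIdeal_le_iff, hv', hv'] at hq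
  rw [strataIdeal_le_iff, hu', hu']
  rcases lt_trichotomy i.1 i'.1 with hlt | heq | hlt
  · obtain ⟨e, hb, hc⟩ := overlap isGerm_node (map_zero _) hz hz' huv
      ((chart_size i).trans (chart_size i').symm) hlt
    obtain ⟨rfl, -⟩ := hq.resolve_right fun h ↦ hc h.2
    exact Or.inr ⟨Fin.ext e, (mul_eq_zero.1 hbc).resolve_left hb⟩
  · obtain rfl := Fin.ext heq
    obtain rfl := (K.ι i).injective h
    rwa [← hv', ← hv', hu', hu'] at hq
  · obtain ⟨e, hb, hc⟩ := overlap isGerm_node (map_zero _) hz' hz huv.symm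
      ((chart_size i').trans (chart_size i).symm) hlt
    obtain ⟨rfl, -⟩ := hq.resolve_left fun h ↦ hb h.2
    exact Or.inl ⟨Fin.ext e.symm, (mul_eq_zero.1 hbc).resolve_right hc⟩

/-- The underlying set of the `j`-th component. -/
def strataSet (j : Fin (m + 1)) : Set K.H.carrier :=
  ⋃ i, K.ι i '' {q | strataIdeal i j ≤ (specPt q).asIdeal}

lemma ι_mem_strataSet {i : Fin m} {j : Fin (m + 1)} {q : Spec (CommRingCat.of (NodeRing i))} :
    K.ι i q ∈ strataSet K j ↔ strataIdeal i j ≤ (specPt q).asIdeal := by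
  rw [strataSet, Set.mem_iUnion]
  constructor
  · rintro ⟨i', q', hq', h⟩
    exact strataIdeal_le_of_ι_eq K h.symm hq'
  · intro h
    exact ⟨i, q, h, rfl⟩

lemma preimage_strataSet (i : Fin m) (j : Fin (m + 1)) :
    K.ι i ⁻¹' strataSet K j = PrimeSpectrum.zeroLocus (strataIdeal i j : Set (NodeRing i)) :=
  Set.ext fun _ ↦ ι_mem_strataSet K

lemma isClosed_strataSet (j : Fin (m + 1)) : IsClosed (strataSet K j) := by
  have h : (strataSet K j)ᶜ = ⋃ i, K.ι i '' (K.ι i ⁻¹' strataSet K j)ᶜ := by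
    ext p
    obtain ⟨i, q, rfl⟩ := K.cover p
    rw [Set.mem_iUnion]
    constructor
    · intro hp
      exact ⟨i, q, hp, rfl⟩
    · rintro ⟨i', q', hq', h⟩
      rw [← h]
      exact hq'
  rw [← isOpen_compl_iff, h]
  refine isOpen_iUnion fun i ↦ (K.ι i).isOpenEmbedding.isOpenMap _ ?_
  rw [isOpen_compl_iff, preimage_strataSet]
  exact PrimeSpectrum.isClosed_zeroLocus _

/-- The components of the Hilbert scheme of the node. -/
def strata (j : Fin (m + 1)) : K.H.carrier.IdealSheafData :=
  Scheme.IdealSheafData.vanishingIdeal ⟨strataSet K j, isClosed_strataSet K j⟩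

lemma sheafIdeal_strata (i : Fin m) (j : Fin (m + 1)) :
    sheafIdeal (K.ι i) (strata K j) = strataIdeal i j := by
  rw [strata, sheafIdeal_vanishingIdeal]
  refine (congrArg PrimeSpectrum.vanishingIdeal (preimage_strataSet K i j)).trans ?_
  rw [PrimeSpectrum.vanishingIdeal_zeroLocus_eq_radical]
  exact (isRadical_strataIdeal i j).radical

lemma iInf_strata : ⨅ j, strata K j = ⊥ := by
  refine idealSheaf_ext K.ι K.cover fun i ↦ ?_
  rw [sheafIdeal_iInf, sheafIdeal_bot, eq_bot_iff]
  simp_rw [sheafIdeal_strata]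
  refine (le_inf (iInf_le _ i.castSucc) (iInf_le _ i.succ)).trans ?_
  rw [strataIdeal_castSucc, strataIdeal_succ, inf_comm, nodeIdeal_inf]

lemma strata_sup_of_lt {j j' : Fin (m + 1)} (h : j.1 + 1 < j'.1) :
    strata K j ⊔ strata K j' = ⊤ := by
  refine idealSheaf_ext K.ι K.cover fun i ↦ ?_
  rw [sheafIdeal_sup, sheafIdeal_top, sheafIdeal_strata, sheafIdeal_strata]
  by_cases hj : strataIdeal i j = ⊤
  · rw [hj, top_sup_eq]
  · rw [strataIdeal_of_ne (j := j'), sup_top_eq]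
    · rintro rfl
      exact hj (strataIdeal_of_ne (fun e ↦ by subst e; simp at h) fun e ↦ by subst e; simp at h; omega)
    · rintro rfl
      exact hj (strataIdeal_of_ne (fun e ↦ by subst e; simp at h) fun e ↦ by subst e; simp at h)

lemma sheafIdeal_inter (a i : Fin m) :
    sheafIdeal (K.ι i) (strata K a.castSucc ⊔ strata K a.succ) =
      if i = a then nodeIdeal (chart_size i) {0, 1} else ⊤ := by
  rw [sheafIdeal_sup, sheafIdeal_strata, sheafIdeal_strata]
  split_ifs with h
  · subst h
    rw [strataIdeal_castSucc, strataIdeal_succ, sup_comm, ← nodeIdeal_union]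
    rfl
  · by_cases h1 : a.castSucc = i.succ
    · rw [strataIdeal_of_ne (j := a.succ), sup_top_eq]
      · intro e
        rw [Fin.ext_iff] at h1 e
        simp at h1 e
        omega
      · intro e
        exact h (Fin.succ_injective _ e).symm
    · rw [strataIdeal_of_ne (j := a.castSucc) _ h1, top_sup_eq]
      exact fun e ↦ h (Fin.castSucc_injective _ e).symm

lemma isPolyLoc_inter (a i : Fin m)
    (h : sheafIdeal (K.ι i) (strata K a.castSucc ⊔ strata K a.succ) ≠ ⊤) :
    IsPolyLoc (m - 1)
      (NodeRing i ⧸ sheafIdeal (K.ι i) (strata K a.castSucc ⊔ strata K a.succ)) := by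
  rw [sheafIdeal_inter] at h ⊢
  split_ifs at h with h1
  · rw [if_pos h1]
    have h2 := isPolyLoc_nodeIdeal (chart_size i) {0, 1} (Or.inl (by simp))
    have hm : m ≠ 0 := i.pos.ne'
    obtain ⟨m, rfl⟩ := Nat.exists_eq_succ_of_ne_zero hm
    rw [Finset.card_pair (by simp)] at h2
    exact h2
  · exact (h rfl).elim

/-! ### Points of the components -/

/-- In the two extreme charts one of the axes is excluded, since its points would not be supported
at the origin. This is why the first and the last component have a single `ℂ`-point. -/
lemma exists_axis_hom (i : Fin m) {S : Type} [CommRing S] [Algebra ℂ S] {b c : S} (hbc : b * c = 0)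
    (hb : m - 1 - i.1 = 0 → b = 0) (hc : i.1 = 0 → c = 0) :
    ∃ u : NodeRing i →ₐ[ℂ] S, (nodeUniv i).map (u : NodeRing i →+* S) = axisCoord b c :=
  (isUniversal_nodePoint (chart_size i)).exists_hom S _
    (isChartPoint_axisCoord (map_zero _) hbc hb hc)

/-- The point of the Hilbert scheme that corresponds to a `ℂ`-valued point of a chart. -/
def pointOf {i : Fin m} (u : NodeRing i →ₐ[ℂ] ℂ) : K.H.carrier :=
  K.ι i (specHom u (IsLocalRing.closedPoint ℂ))

lemma exists_pointOf {p : K.H.carrier} (hp : K.H.IsRationalPoint ℂ p) :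
    ∃ (i : Fin m) (u : NodeRing i →ₐ[ℂ] ℂ) (b c : ℂ), p = pointOf K u ∧
      (nodeUniv i).map (u : NodeRing i →+* ℂ) = axisCoord b c ∧ b * c = 0 ∧
      (m - 1 - i.1 = 0 → b = 0) ∧ (i.1 = 0 → c = 0) := by
  obtain ⟨i, q, rfl⟩ := K.cover p
  obtain ⟨u, rfl⟩ := (K.isRationalPoint_iff i q).1 hp
  obtain ⟨h1, h2, h3, h4⟩ := eq_axisCoord_of_isChartPoint
    (isChartPoint_map (isUniversal_nodePoint (chart_size i)).isChartPoint u)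
  exact ⟨i, u, _, _, rfl, h1, h2, h3, h4⟩

lemma pointOf_mem_support {i : Fin m} {u : NodeRing i →ₐ[ℂ] ℂ} {b c : ℂ}
    (hu : (nodeUniv i).map (u : NodeRing i →+* ℂ) = axisCoord b c) (j : Fin (m + 1)) :
    pointOf K u ∈ (strata K j).support ↔ (j = i.castSucc ∧ b = 0) ∨ (j = i.succ ∧ c = 0) := by
  have hb : u (nodeUniv i).b = b := congrArg ChartCoord.b hu
  have hc : u (nodeUniv i).c = c := congrArg ChartCoord.c hu
  have h := mem_support_iff_sheafIdeal (K.ι i) (strata K j)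
    (specHom u (IsLocalRing.closedPoint ℂ))
  rw [sheafIdeal_strata] at h
  refine h.trans ((strataIdeal_le_iff (q := (specPt _).asIdeal)).trans ?_)
  have h2 (a) : a ∈ (specPt (specHom u (IsLocalRing.closedPoint ℂ))).asIdeal ↔ u a = 0 :=
    SetLike.ext_iff.1 (specPt_specHom u) a
  rw [h2, h2, hb, hc]

lemma isPoint_pointOf_iff {J : Ideal NodeGerm} {i : Fin m} (u : NodeRing i →ₐ[ℂ] ℂ)
    (hu : familyIdeal ℂ (coord nodeEq 0) (coord nodeEq 1)
      ((nodeUniv i).map (u : NodeRing i →+* ℂ)) =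
        J.map (Algebra.TensorProduct.includeRight : NodeGerm →ₐ[ℂ] ℂ ⊗[ℂ] NodeGerm).toRingHom)
    (p : K.H.carrier) : K.H.IsPoint ℂ J p ↔ p = pointOf K u := by
  constructor
  · intro hp
    obtain ⟨i', q, rfl⟩ := K.cover p
    obtain ⟨v, rfl, hv⟩ := (K.isPoint_iff J i' q).1 hp
    exact K.ι_eq_of_familyIdeal_eq v u (hv.trans hu.symm) _
  · rintro rfl
    exact (K.isPoint_iff J i _).2 ⟨u, rfl, hu⟩

lemma isPoint_idealQ_iff {i : Fin m} {u : NodeRing i →ₐ[ℂ] ℂ}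
    (hu : (nodeUniv i).map (u : NodeRing i →+* ℂ) = axisCoord 0 0) (p : K.H.carrier) :
    K.H.IsPoint ℂ (idealQ (coord nodeEq 0) (coord nodeEq 1) m (i.1 + 1)) p ↔ p = pointOf K u :=
  isPoint_pointOf_iff K u (by rw [hu, familyIdeal_axisCoord_zero (chart_size i)]) p

lemma isPoint_idealI_iff_b {i : Fin m} {u : NodeRing i →ₐ[ℂ] ℂ} {b : ℂ} (hb : b ≠ 0)
    (hu : (nodeUniv i).map (u : NodeRing i →+* ℂ) = axisCoord b 0) (p : K.H.carrier) :
    K.H.IsPoint ℂ (idealI m (i.1 + 1) (-b)) p ↔ p = pointOf K u :=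
  isPoint_pointOf_iff K u (by rw [hu, familyIdeal_axisCoord_b (chart_size i) hb]) p

lemma isPoint_idealI_iff_c {i : Fin m} {u : NodeRing i →ₐ[ℂ] ℂ} {c : ℂ} (hc : c ≠ 0)
    (hu : (nodeUniv i).map (u : NodeRing i →+* ℂ) = axisCoord 0 c) (p : K.H.carrier) :
    K.H.IsPoint ℂ (idealI m i.1 (-c⁻¹)) p ↔ p = pointOf K u :=
  isPoint_pointOf_iff K u (by rw [hu, familyIdeal_axisCoord_c (chart_size i) hc]) p

/-- A line in a chart lies in the closure of its points away from the origin. -/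
lemma pointOf_mem_closure {i : Fin m} {β γ : Polynomial ℂ} (hβγ : β * γ = 0)
    (hβ : m - 1 - i.1 = 0 → β = 0) (hγ : i.1 = 0 → γ = 0) {T : Set K.H.carrier}
    (hT : ∀ a ≠ 0, ∀ u : NodeRing i →ₐ[ℂ] ℂ, (nodeUniv i).map (u : NodeRing i →+* ℂ) =
      axisCoord (β.eval a) (γ.eval a) → pointOf K u ∈ T) {u : NodeRing i →ₐ[ℂ] ℂ}
    (hu : (nodeUniv i).map (u : NodeRing i →+* ℂ) = axisCoord (β.eval 0) (γ.eval 0)) :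
    pointOf K u ∈ closure T := by
  -- Over `ℂ[T]` the whole line becomes one morphism from the affine line. The claim then follows by
  -- continuity from the density of the nonzero points: a polynomial vanishing at all of them is
  -- zero.
  obtain ⟨w, hw⟩ := exists_axis_hom i hβγ hβ hγ
  let e (a : ℂ) : Polynomial ℂ →ₐ[ℂ] ℂ := Polynomial.aeval a
  have hwe (a : ℂ) : (nodeUniv i).map (((e a).comp w : NodeRing i →ₐ[ℂ] ℂ) : NodeRing i →+* ℂ) =
      axisCoord (β.eval a) (γ.eval a) := by
    have h1 := congrArg (fun v ↦ v.map (e a : Polynomial ℂ →+* ℂ)) hw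
    refine Eq.trans ?_ (h1.trans ?_)
    · rfl
    · ext <;> simp [axisCoord, ChartCoord.map, e]
  have hu0 : u = (e 0).comp w :=
    (isUniversal_nodePoint (chart_size i)).hom_ext ℂ _ _ (hu.trans (hwe 0).symm)
  let f := specHom w ≫ K.ι i
  let P (a : ℂ) : Spec (CommRingCat.of (Polynomial ℂ)) := specHom (e a) (IsLocalRing.closedPoint ℂ)
  have hf (a : ℂ) : f (P a) = pointOf K ((e a).comp w) := by
    rw [pointOf, specHom_comp]
    rfl
  have hP0 : P 0 ∈ closure {p | ∃ a ≠ 0, P a = p} := by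
    have h1 := PrimeSpectrum.zeroLocus_vanishingIdeal_eq_closure
      (R := Polynomial ℂ) {p | ∃ a ≠ 0, P a = p}
    refine h1.le fun p hp ↦ ?_
    have hp' : p = 0 := by
      refine Polynomial.eq_zero_of_infinite_isRoot p
        ((Set.infinite_of_finite_compl (s := {a : ℂ | a ≠ 0}) ?_).mono fun a ha ↦ ?_)
      · simp [Set.compl_ofPred]
      · have h2 := (PrimeSpectrum.mem_vanishingIdeal _ _).1 hp (P a) ⟨a, ha, rfl⟩
        have h3 : e a p = 0 := (SetLike.ext_iff.1 (specPt_specHom (e a)) p).1 h2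
        simpa [e, Polynomial.aeval_def, Polynomial.eval₂_eq_eval_map] using h3
    rw [hp']
    exact zero_mem _
  rw [hu0, ← hf]
  refine closure_mono ?_ (image_closure_subset_closure_image f.continuous ⟨P 0, hP0, rfl⟩)
  rintro _ ⟨_, ⟨a, ha, rfl⟩, rfl⟩
  rw [hf]
  exact hT a ha _ (hwe a)

end Strata

end

end NodeHilb


/-! ### Supports, integrality and local equations of the components. -/

namespace NodeHilb

noncomputable section

/-- The local ring at a point of a chart, with two principal ideal sheaves. -/
lemma exists_stalk_equiv {A T : Type} [CommRing A] [CommRing T] [Algebra ℂ A] [Algebra ℂ T]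
    {X : Scheme.{0}} (j : Spec (CommRingCat.of A) ⟶ X) [IsOpenImmersion j]
    (s : X ⟶ Spec (CommRingCat.of ℂ))
    (hs : j ≫ s = Spec.map (CommRingCat.ofHom (algebraMap ℂ A))) (z : Spec (CommRingCat.of A))
    (φ : Localization.AtPrime (specPt z).asIdeal ≃+* T)
    (hφ : ∀ a : ℂ, φ (algebraMap A _ (algebraMap ℂ A a)) = algebraMap ℂ T a)
    {D D' : X.IdealSheafData} {f f' : A} {t t' : T} (hf : sheafIdeal j D = Ideal.span {f})
    (hf' : sheafIdeal j D' = Ideal.span {f'}) (ht : φ (algebraMap A _ f) = t)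
    (ht' : φ (algebraMap A _ f') = t') :
    ∃ ψ : X.presheaf.stalk (j z) ≃+* T, (∀ a : ℂ, ψ (stalkHom s (j z) a) = algebraMap ℂ T a) ∧
      (stalkIdeal D (j z)).map (ψ : _ →+* T) = Ideal.span {t} ∧
      (stalkIdeal D' (j z)).map (ψ : _ →+* T) = Ideal.span {t'} := by
  have key {D : X.IdealSheafData} {f : A} (hf : sheafIdeal j D = Ideal.span {f}) :
      (stalkIdeal D (j z)).map ((chartStalk j z).trans φ : _ →+* T) =
        Ideal.span {φ (algebraMap A _ f)} := by
    have h1 := congrArg (Ideal.map (φ : _ →+* T)) (map_stalkIdeal j D z)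
    rw [hf, Ideal.map_span, Ideal.map_span, Set.image_singleton, Set.image_singleton,
      Ideal.map_map] at h1
    exact h1
  exact ⟨(chartStalk j z).trans φ,
    fun a ↦ (congrArg φ (chartStalk_stalkHom j s hs z a)).trans (hφ a),
    ht ▸ key hf, ht' ▸ key hf'⟩

section

variable {m : ℕ} (K : NodeCover m)

/-- Component `0` appears only in chart `0`, as `b = 0`. There `r = 0` forces `c = 0` at a
`ℂ`-point, so only the origin remains. -/
lemma mem_support_strata_zero (hm : 1 ≤ m) {p : K.H.carrier} (hp : K.H.IsRationalPoint ℂ p) :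
    p ∈ (strata K 0).support ↔
      K.H.IsPoint ℂ (idealQ (coord nodeEq 0) (coord nodeEq 1) m 1) p := by
  constructor
  · intro h
    obtain ⟨i, u, b, c, rfl, hu, hbc, hb, hc⟩ := exists_pointOf K hp
    rw [pointOf_mem_support K hu] at h
    obtain ⟨h0, rfl⟩ := h.resolve_right fun h ↦ (Fin.succ_ne_zero i) h.1.symm
    have hi : i.1 = 0 := (congrArg Fin.val h0).symm
    obtain rfl := hc hi
    have h1 := (isPoint_idealQ_iff K hu (pointOf K u)).2 rfl
    rwa [hi] at h1
  · intro h
    obtain ⟨u, hu⟩ := exists_axis_hom (⟨0, hm⟩ : Fin m) (zero_mul (0 : ℂ)) (fun _ ↦ rfl) fun _ ↦ rfl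
    obtain rfl := (isPoint_idealQ_iff K hu p).1 h
    exact (pointOf_mem_support K hu _).2 (Or.inl ⟨rfl, rfl⟩)

lemma mem_support_strata_last (hm : 1 ≤ m) {p : K.H.carrier} (hp : K.H.IsRationalPoint ℂ p) :
    p ∈ (strata K (Fin.last m)).support ↔
      K.H.IsPoint ℂ (idealQ (coord nodeEq 0) (coord nodeEq 1) m m) p := by
  constructor
  · intro h
    obtain ⟨i, u, b, c, rfl, hu, hbc, hb, hc⟩ := exists_pointOf K hp
    rw [pointOf_mem_support K hu] at h
    obtain ⟨h0, rfl⟩ := h.resolve_left fun h ↦ (Fin.castSucc_lt_last i).ne' h.1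
    have hi : m = i.1 + 1 := congrArg Fin.val h0
    obtain rfl := hb (by omega)
    have h1 := (isPoint_idealQ_iff K hu (pointOf K u)).2 rfl
    rwa [← hi] at h1
  · intro h
    obtain ⟨u, hu⟩ := exists_axis_hom (⟨m - 1, by omega⟩ : Fin m) (zero_mul (0 : ℂ)) (fun _ ↦ rfl)
      fun _ ↦ rfl
    obtain rfl := (isPoint_idealQ_iff K hu p).1 (by rwa [show m - 1 + 1 = m by omega])
    exact (pointOf_mem_support K hu _).2 (Or.inr ⟨Fin.ext (by simp; omega), rfl⟩)

lemma mem_support_inter {i : Fin m} {p : K.H.carrier} (hp : K.H.IsRationalPoint ℂ p) :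
    p ∈ (strata K i.castSucc ⊔ strata K i.succ).support ↔
      K.H.IsPoint ℂ (idealQ (coord nodeEq 0) (coord nodeEq 1) m (i.1 + 1)) p := by
  have h0 : p ∈ (strata K i.castSucc ⊔ strata K i.succ).support ↔
      p ∈ (strata K i.castSucc).support ∧ p ∈ (strata K i.succ).support := by
    obtain ⟨a, q, rfl⟩ := K.cover p
    rw [mem_support_iff_sheafIdeal, mem_support_iff_sheafIdeal, mem_support_iff_sheafIdeal,
      sheafIdeal_sup, sup_le_iff]
  rw [h0]
  constructor
  · rintro ⟨h, h'⟩
    obtain ⟨a, u, b, c, rfl, hu, hbc, hb, hc⟩ := exists_pointOf K hp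
    rw [pointOf_mem_support K hu] at h h'
    simp only [Fin.ext_iff, Fin.val_castSucc, Fin.val_succ] at h h'
    have hia : i = a := Fin.ext (by omega)
    subst hia
    obtain rfl : b = 0 := (h.resolve_right fun h ↦ by omega).2
    obtain rfl : c = 0 := (h'.resolve_left fun h ↦ by omega).2
    exact (isPoint_idealQ_iff K hu _).2 rfl
  · intro h
    obtain ⟨u, hu⟩ := exists_axis_hom i (zero_mul (0 : ℂ)) (fun _ ↦ rfl) fun _ ↦ rfl
    obtain rfl := (isPoint_idealQ_iff K hu p).1 h
    exact ⟨(pointOf_mem_support K hu _).2 (Or.inl ⟨rfl, rfl⟩),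
      (pointOf_mem_support K hu _).2 (Or.inr ⟨rfl, rfl⟩)⟩

/-- The point `I^m_j(a)` is visible in two charts, as `c = -a⁻¹` in chart `j` and as `b = -a` in
chart `j - 1`. This links the two pieces of a middle component. -/
lemma mem_support_strata_of_isPoint_idealI {j : Fin (m + 1)} (h0 : 0 < j.1) (hj : j.1 < m) {a : ℂ}
    (ha : a ≠ 0) {p : K.H.carrier} (hp : K.H.IsPoint ℂ (idealI m j.1 a) p) :
    p ∈ (strata K j).support ∧ p ∈ Set.range (K.ι ⟨j.1, hj⟩) ∧
      p ∈ Set.range (K.ι ⟨j.1 - 1, by omega⟩) := by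
  obtain ⟨u, hu⟩ := exists_axis_hom (⟨j.1, hj⟩ : Fin m) (zero_mul (-a⁻¹)) (fun _ ↦ rfl)
    fun h ↦ (h0.ne' h).elim
  obtain ⟨v, hv⟩ := exists_axis_hom (⟨j.1 - 1, by omega⟩ : Fin m) (mul_zero (-a))
    (fun h ↦ by simp only at h; omega) fun _ ↦ rfl
  have h1 : p = pointOf K u := (isPoint_idealI_iff_c K (by simpa using ha) hu p).1 (by simpa using hp)
  have h2 : p = pointOf K v := (isPoint_idealI_iff_b K (by simpa using ha) hv p).1
    (by simpa [show j.1 - 1 + 1 = j.1 by omega] using hp)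
  refine ⟨?_, h1 ▸ ⟨_, rfl⟩, h2 ▸ ⟨_, rfl⟩⟩
  rw [h1]
  exact (pointOf_mem_support K hu _).2 (Or.inl ⟨rfl, rfl⟩)

lemma exists_isPoint_idealI {j : ℕ} (h0 : 0 < j) (hj : j < m) {a : ℂ} (ha : a ≠ 0) :
    ∃ p, K.H.IsPoint ℂ (idealI m j a) p := by
  obtain ⟨u, hu⟩ := exists_axis_hom (⟨j, hj⟩ : Fin m) (zero_mul (-a⁻¹)) (fun _ ↦ rfl)
    fun h ↦ (h0.ne' h).elim
  refine ⟨pointOf K u, ?_⟩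
  have h := (isPoint_idealI_iff_c K (by simpa using ha) hu (pointOf K u)).2 rfl
  simpa using h

/-- In each of its two charts the `ℂ`-points of the component form a line; its nonzero points are
the `I^m_j(a)` and its origin is a limit of them. The converse holds because the support is closed.
-/
lemma mem_support_strata_mid {j : Fin (m + 1)} (h0 : 0 < j.1) (hj : j.1 < m) {p : K.H.carrier}
    (hp : K.H.IsRationalPoint ℂ p) : p ∈ (strata K j).support ↔
      p ∈ closure {q | ∃ a : ℂ, a ≠ 0 ∧ K.H.IsPoint ℂ (idealI m j a) q} := by
  constructor
  · intro h
    obtain ⟨i, u, b, c, rfl, hu, hbc, hb, hc⟩ := exists_pointOf K hp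
    rw [pointOf_mem_support K hu] at h
    rcases h with ⟨rfl, rfl⟩ | ⟨rfl, rfl⟩
    · have key (a : ℂ) (ha : a ≠ 0) (v : NodeRing i →ₐ[ℂ] ℂ)
          (hv : (nodeUniv i).map (v : NodeRing i →+* ℂ) = axisCoord 0 a) :
          pointOf K v ∈ {q | ∃ a : ℂ, a ≠ 0 ∧ K.H.IsPoint ℂ (idealI m i.castSucc a) q} :=
        ⟨-a⁻¹, by simpa using ha, (isPoint_idealI_iff_c K ha hv _).2 rfl⟩
      by_cases h : c = 0
      · subst h
        exact pointOf_mem_closure K (β := 0) (γ := Polynomial.X) (zero_mul _) (fun _ ↦ rfl)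
          (fun h ↦ (h0.ne' h).elim) (fun a ha v hv ↦ key a ha v (by simpa using hv))
          (by simpa using hu)
      · exact subset_closure (key c h u hu)
    · have key (a : ℂ) (ha : a ≠ 0) (v : NodeRing i →ₐ[ℂ] ℂ)
          (hv : (nodeUniv i).map (v : NodeRing i →+* ℂ) = axisCoord a 0) :
          pointOf K v ∈ {q | ∃ a : ℂ, a ≠ 0 ∧ K.H.IsPoint ℂ (idealI m i.succ a) q} :=
        ⟨-a, by simpa using ha, (isPoint_idealI_iff_b K ha hv _).2 rfl⟩
      by_cases h : b = 0
      · subst h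
        refine pointOf_mem_closure K (β := Polynomial.X) (γ := 0) (mul_zero _) (fun h ↦ ?_)
          (fun _ ↦ rfl) (fun a ha v hv ↦ key a ha v (by simpa using hv)) (by simpa using hu)
        simp only [Fin.val_succ] at hj
        omega
      · exact subset_closure (key b h u hu)
  · intro h
    refine (strata K j).support.isClosed.closure_subset_iff.2 ?_ h
    rintro q ⟨a, ha, hq⟩
    exact (mem_support_strata_of_isPoint_idealI K h0 hj ha hq).1

lemma strataIdeal_ne_top_iff {i : Fin m} {j : Fin (m + 1)} :
    strataIdeal i j ≠ ⊤ ↔ j = i.castSucc ∨ j = i.succ := by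
  constructor
  · intro h
    by_contra! h'
    exact h (strataIdeal_of_ne h'.1 h'.2)
  · intro h htop
    obtain ⟨u, hu⟩ := exists_axis_hom i (zero_mul (0 : ℂ)) (fun _ ↦ rfl) fun _ ↦ rfl
    have hb : u (nodeUniv i).b = 0 := congrArg ChartCoord.b hu
    have hc : u (nodeUniv i).c = 0 := congrArg ChartCoord.c hu
    have : (RingHom.ker u).IsPrime := RingHom.ker_isPrime (u : NodeRing i →+* ℂ)
    have h1 : strataIdeal i j ≤ RingHom.ker u :=
      strataIdeal_le_iff.2 (h.imp (fun h ↦ ⟨h, hb⟩) fun h ↦ ⟨h, hc⟩)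
    exact RingHom.ker_ne_top u (top_le_iff.1 (htop ▸ h1))

/-- An extreme component lies in one chart. A middle one is covered by two charts, each contributing
a domain, and they meet in the point `I^m_j(1)`. -/
lemma isIntegral_strata (hm : 1 ≤ m) (j : Fin (m + 1)) : IsIntegral (strata K j).subscheme := by
  have hr {i : Fin m} (hi : strataIdeal i j ≠ ⊤) :
      ∃ p ∈ (strata K j).support, p ∈ Set.range (K.ι i) := by
    obtain ⟨u, hu⟩ := exists_axis_hom i (zero_mul (0 : ℂ)) (fun _ ↦ rfl) fun _ ↦ rfl
    exact ⟨pointOf K u, (pointOf_mem_support K hu j).2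
      ((strataIdeal_ne_top_iff.1 hi).imp (fun h ↦ ⟨h, rfl⟩) fun h ↦ ⟨h, rfl⟩), _, rfl⟩
  refine K.isIntegral_subscheme (d := m) (fun i hi ↦ ?_) ?_ fun i i' hi hi' ↦ ?_
  · rw [sheafIdeal_strata] at hi ⊢
    exact isPolyLoc_strataIdeal i j hi
  · simp only [sheafIdeal_strata, strataIdeal_ne_top_iff]
    by_cases h0 : j = 0
    · exact ⟨⟨0, hm⟩, Or.inl h0⟩
    · exact ⟨j.pred h0, Or.inr (Fin.succ_pred j h0).symm⟩
  · rw [sheafIdeal_strata] at hi hi'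
    by_cases hii : i = i'
    · subst hii
      obtain ⟨p, hp, hp'⟩ := hr hi
      exact ⟨p, hp, hp', hp'⟩
    rw [strataIdeal_ne_top_iff] at hi hi'
    simp only [Fin.ext_iff, Fin.val_castSucc, Fin.val_succ] at hi hi' hii
    have h0 : 0 < j.1 := by omega
    have hj : j.1 < m := by omega
    obtain ⟨p, hp⟩ := exists_isPoint_idealI K h0 hj one_ne_zero
    obtain ⟨h1, h2, h3⟩ := mem_support_strata_of_isPoint_idealI K h0 hj one_ne_zero hp
    have hl {a : Fin m} (ha : j.1 = a.1 ∨ j.1 = a.1 + 1) : p ∈ Set.range (K.ι a) := by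
      rcases ha with ha | ha
      · rwa [show a = ⟨j.1, hj⟩ from Fin.ext ha.symm]
      · rwa [show a = ⟨j.1 - 1, by omega⟩ from Fin.ext (by simp only; omega)]
    exact ⟨p, h1, hl hi, hl hi'⟩

lemma exists_local_equation (i : Fin m) : ∃ x : K.H.carrier,
    K.H.IsPoint ℂ (idealQ (coord nodeEq 0) (coord nodeEq 1) m (i.1 + 1)) x ∧
    ∃ φ : K.H.carrier.presheaf.stalk x ≃+* HypersurfaceGerm (m + 1) (eqBC m),
      (∀ a : ℂ, φ (stalkHom K.H.str x a) = algebraMap ℂ _ a) ∧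
      (stalkIdeal (strata K i.castSucc) x).map (φ : _ →+* _) = Ideal.span {coord (eqBC m) 1} ∧
      (stalkIdeal (strata K i.succ) x).map (φ : _ →+* _) = Ideal.span {coord (eqBC m) 0} := by
  obtain ⟨u, hu⟩ := exists_axis_hom i (zero_mul (0 : ℂ)) (fun _ ↦ rfl) fun _ ↦ rfl
  let q : Spec (CommRingCat.of (NodeRing i)) := specHom u (IsLocalRing.closedPoint ℂ)
  obtain ⟨φ, hφ, hφ'⟩ := exists_localization_equiv (chart_size i) hu (specPt q).asIdeal
    (specPt_specHom u).symm
  exact ⟨K.ι i q, (isPoint_idealQ_iff K hu _).2 rfl,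
    exists_stalk_equiv (K.ι i) K.H.str (K.ι_str i) q φ hφ
      ((sheafIdeal_strata K i _).trans ((strataIdeal_castSucc i).trans (nodeIdeal_singleton _ _)))
      ((sheafIdeal_strata K i _).trans ((strataIdeal_succ i).trans (nodeIdeal_singleton _ _)))
      (hφ' 1) (hφ' 0)⟩

theorem isSmoothChain_strata (hm : 1 ≤ m) : IsSmoothChain K.H (strata K) where
  union := iInf_strata K
  integral := isIntegral_strata K hm
  smooth j p := (K.smoothAt_subscheme (d := m) (fun i hi ↦ by
    rw [sheafIdeal_strata] at hi ⊢
    exact isPolyLoc_strataIdeal i j hi) p).1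
  dim j p := (K.smoothAt_subscheme (d := m) (fun i hi ↦ by
    rw [sheafIdeal_strata] at hi ⊢
    exact isPolyLoc_strataIdeal i j hi) p).2
  supp_mid _ h0 hj _ hp := mem_support_strata_mid K h0 hj hp
  supp_zero _ hp := mem_support_strata_zero K hm hp
  supp_last _ hp := mem_support_strata_last K hm hp
  disjoint _ _ h := strata_sup_of_lt K h
  inter_smooth i p := (K.smoothAt_subscheme (isPolyLoc_inter K i) p).1
  inter_dim i p hp := (K.smoothAt_subscheme (isPolyLoc_inter K i) p).2 hp
  inter_supp _ _ hp := mem_support_inter K hp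
  local_eq := exists_local_equation K

end

end

end NodeHilb


namespace NodeHilb

noncomputable section

/-! ### The local ring of the versal family -/

section VersalLocal

variable {m n r : ℕ} (h : n + 1 + r = m)

/-- The graph `b c = t` is an affine space. -/
def graphEquiv (m : ℕ) (hm : m ≠ 0) :
    (MvPolynomial (Fin (m + 2)) ℂ ⧸ Ideal.span {eqBCT m}) ≃ₐ[ℂ] MvPolynomial (Fin (m + 1)) ℂ := by
  let v : Fin (m + 2) → MvPolynomial (Fin (m + 1)) ℂ :=
    Fin.snoc MvPolynomial.X (MvPolynomial.X 0 * MvPolynomial.X 1)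
  have hc (j : Fin (m + 1)) : v j.castSucc = MvPolynomial.X j := Fin.snoc_castSucc _ _ _
  have hl : v (Fin.last (m + 1)) = MvPolynomial.X 0 * MvPolynomial.X 1 := Fin.snoc_last _ _
  have e1 : (1 : Fin (m + 1)).castSucc = 1 := by
    obtain ⟨m, rfl⟩ := Nat.exists_eq_succ_of_ne_zero hm
    exact Fin.castSucc_one
  have h1 (a : MvPolynomial (Fin (m + 2)) ℂ) (ha : a ∈ Ideal.span {eqBCT m}) :
      MvPolynomial.aeval v a = 0 := by
    have hle : Ideal.span {eqBCT m} ≤ RingHom.ker (MvPolynomial.aeval (R := ℂ) v) := by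
      rw [Ideal.span_le, Set.singleton_subset_iff]
      have h0 := hc 0
      have h1 := hc 1
      rw [Fin.castSucc_zero] at h0
      rw [e1] at h1
      simp [RingHom.mem_ker, h0, h1, hl]
    exact hle ha
  let F : (MvPolynomial (Fin (m + 2)) ℂ ⧸ Ideal.span {eqBCT m}) →ₐ[ℂ] MvPolynomial (Fin (m + 1)) ℂ :=
    Ideal.Quotient.liftₐ _ (MvPolynomial.aeval v) h1
  have hF (j) : F (Ideal.Quotient.mk _ (MvPolynomial.X j)) = v j := MvPolynomial.aeval_X v j
  let G : MvPolynomial (Fin (m + 1)) ℂ →ₐ[ℂ] MvPolynomial (Fin (m + 2)) ℂ ⧸ Ideal.span {eqBCT m} :=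
    (Ideal.Quotient.mkₐ ℂ _).comp (MvPolynomial.rename Fin.castSucc)
  have hG (j) : G (MvPolynomial.X j) = Ideal.Quotient.mk _ (MvPolynomial.X j.castSucc) :=
    congrArg (Ideal.Quotient.mk _) (MvPolynomial.rename_X _ _)
  refine AlgEquiv.ofAlgHom F G ?_ ?_
  · refine MvPolynomial.algHom_ext fun j ↦ ?_
    exact (congrArg F (hG j)).trans ((hF _).trans (hc j))
  · refine Ideal.Quotient.algHom_ext _ (MvPolynomial.algHom_ext fun j ↦ ?_)
    refine (congrArg G (hF j)).trans ?_
    induction j using Fin.lastCases with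
    | last =>
      rw [hl, map_mul, hG, hG, e1, ← map_mul]
      exact Ideal.Quotient.eq.2 (Ideal.subset_span rfl)
    | cast j => exact (congrArg G (hc j)).trans (hG j)

lemma constantCoeff_graphEquiv (hm : m ≠ 0) (p : MvPolynomial (Fin (m + 2)) ℂ) :
    MvPolynomial.constantCoeff (graphEquiv m hm (Ideal.Quotient.mk _ p)) =
      MvPolynomial.constantCoeff p := by
  have h1 : ((MvPolynomial.constantCoeff (σ := Fin (m + 1))).comp
      (graphEquiv m hm).toRingEquiv.toRingHom).comp (Ideal.Quotient.mk (Ideal.span {eqBCT m})) =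
      MvPolynomial.constantCoeff := by
    refine MvPolynomial.ringHom_ext (fun a ↦ ?_) fun j ↦ ?_
    · have h2 := (graphEquiv m hm).commutes a
      exact (congrArg MvPolynomial.constantCoeff h2).trans (by simp)
    · have h2 : graphEquiv m hm (Ideal.Quotient.mk _ (MvPolynomial.X j)) =
          (Fin.snoc MvPolynomial.X (MvPolynomial.X 0 * MvPolynomial.X 1) :
            Fin (m + 2) → MvPolynomial (Fin (m + 1)) ℂ) j := MvPolynomial.aeval_X _ j
      refine (congrArg MvPolynomial.constantCoeff h2).trans ?_
      rw [MvPolynomial.constantCoeff_X]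
      induction j using Fin.lastCases with
      | last => simp
      | cast j => simp
  exact DFunLike.congr_fun h1 p

lemma graphEquiv_symm_mul (hm : m ≠ 0) :
    (graphEquiv m hm).symm (MvPolynomial.X 0 * MvPolynomial.X 1) =
      Ideal.Quotient.mk (Ideal.span {eqBCT m}) (MvPolynomial.X (Fin.last (m + 1))) := by
  rw [AlgEquiv.symm_apply_eq]
  have h2 : graphEquiv m hm (Ideal.Quotient.mk _ (MvPolynomial.X (Fin.last (m + 1)))) =
      (Fin.snoc MvPolynomial.X (MvPolynomial.X 0 * MvPolynomial.X 1) :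
        Fin (m + 2) → MvPolynomial (Fin (m + 1)) ℂ) (Fin.last (m + 1)) :=
    MvPolynomial.aeval_X _ _
  rw [h2, Fin.snoc_last]

lemma map_primeCompl_graphEquiv (hm : m ≠ 0) :
    (originIdeal (m + 1)).primeCompl.map (graphEquiv m hm).symm.toRingEquiv.toMonoidHom =
      (originIdeal (m + 2)).primeCompl.map (Ideal.Quotient.mk (Ideal.span {eqBCT m})) := by
  ext a
  constructor
  · rintro ⟨p, hp, rfl⟩
    refine ⟨MvPolynomial.rename Fin.castSucc p, fun h0 ↦ hp ?_, rfl⟩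
    rw [SetLike.mem_coe, RingHom.mem_ker, MvPolynomial.constantCoeff_rename] at h0
    exact h0
  · rintro ⟨p, hp, rfl⟩
    refine ⟨graphEquiv m hm (Ideal.Quotient.mk _ p), fun h0 ↦ hp ?_,
      (graphEquiv m hm).symm_apply_apply _⟩
    rw [SetLike.mem_coe, RingHom.mem_ker, constantCoeff_graphEquiv] at h0
    exact h0

lemma isPolyLoc_versalChart : IsPolyLoc (m + 1) (VersalChart h) := by
  have h1 := IsPolyLoc.of_isLocalization (B := VersalChart h)
    (AlgEquiv.refl (R := ℂ) (A₁ := MvPolynomial (Fin (m + 1)) ℂ)) (versalMonoid h)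
  rwa [Nat.card_eq_fintype_card, Fintype.card_fin] at h1

/-- On polynomials the point is the constant term followed by `ℂ → κ`, which is injective. So the
kernel is the ideal of the origin, without identifying `κ` with `ℂ`. -/
lemma comap_ker_versalChart {κ : Type} [Field κ] [Algebra BaseGerm κ]
    {u : VersalChart h →ₐ[BaseGerm] κ}
    (hu : (versalPoint h).map (u : VersalChart h →+* κ) = axisCoord 0 0) :
    (RingHom.ker (u : VersalChart h →+* κ)).comap
      (algebraMap (MvPolynomial (Fin (m + 1)) ℂ) (VersalChart h)) = originIdeal (m + 1) := by
  have h0 : (axisCoord 0 0 : ChartCoord κ n r) = coordOf h 0 := rfl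
  rw [versalPoint, coordOf_map, coordOf_map, h0] at hu
  have h1 := coordOf_injective h hu
  have h2 : (u : VersalChart h →+* κ).comp
      (algebraMap (MvPolynomial (Fin (m + 1)) ℂ) (VersalChart h)) =
      ((algebraMap BaseGerm κ).comp (algebraMap ℂ BaseGerm)).comp MvPolynomial.constantCoeff := by
    refine MvPolynomial.ringHom_ext (fun a ↦ ?_) (fun j ↦ ?_)
    · have h3 : algebraMap (MvPolynomial (Fin (m + 1)) ℂ) (VersalChart h) (MvPolynomial.C a) =
          algebraMap BaseGerm (VersalChart h) (algebraMap ℂ BaseGerm a) := by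
        rw [← IsScalarTower.algebraMap_apply,
          IsScalarTower.algebraMap_apply ℂ (MvPolynomial (Fin (m + 1)) ℂ) (VersalChart h)]
        rfl
      rw [RingHom.comp_apply, h3, RingHom.comp_apply, MvPolynomial.constantCoeff_C]
      exact u.commutes _
    · rw [RingHom.comp_apply, RingHom.comp_apply, MvPolynomial.constantCoeff_X, map_zero]
      exact congrFun h1 j
  ext a
  have h3 : u (algebraMap (MvPolynomial (Fin (m + 1)) ℂ) (VersalChart h) a) =
      ((algebraMap BaseGerm κ).comp (algebraMap ℂ BaseGerm)) (MvPolynomial.constantCoeff a) :=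
    DFunLike.congr_fun h2 a
  rw [Ideal.mem_comap, RingHom.mem_ker, RingHom.mem_ker, RingHom.coe_coe, h3,
    map_eq_zero_iff _ (RingHom.injective _)]

/-- At the origin of the special fibre the chart is the hypersurface `b c = t`. -/
theorem exists_versal_localization_equiv {κ : Type} [Field κ] [Algebra BaseGerm κ]
    {u : VersalChart h →ₐ[BaseGerm] κ}
    (hu : (versalPoint h).map (u : VersalChart h →+* κ) = axisCoord 0 0)
    (q : Ideal (VersalChart h)) [q.IsPrime] (hq : RingHom.ker (u : VersalChart h →+* κ) = q) :
    ∃ φ : Localization.AtPrime q ≃+* HypersurfaceGerm (m + 2) (eqBCT m),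
      ∀ p : Polynomial ℂ, φ (algebraMap (VersalChart h) _
        (algebraMap BaseGerm _ (algebraMap (Polynomial ℂ) BaseGerm p))) =
          Polynomial.aeval (coord (eqBCT m) (Fin.last (m + 1))) p := by
  have hm : m ≠ 0 := by omega
  subst hq
  have h1 : IsLocalization.AtPrime (Localization.AtPrime (RingHom.ker (u : VersalChart h →+* κ)))
      ((RingHom.ker (u : VersalChart h →+* κ)).comap
        (algebraMap (MvPolynomial (Fin (m + 1)) ℂ) (VersalChart h))) :=
    IsLocalization.isLocalization_isLocalization_atPrime_isLocalization (versalMonoid h) _ _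
  have h2 : IsLocalization (originIdeal (m + 1)).primeCompl
      (Localization.AtPrime (RingHom.ker (u : VersalChart h →+* κ))) := by
    have e : ((RingHom.ker (u : VersalChart h →+* κ)).comap
        (algebraMap (MvPolynomial (Fin (m + 1)) ℂ) (VersalChart h))).primeCompl =
        (originIdeal (m + 1)).primeCompl := by
      ext a
      exact not_congr (SetLike.ext_iff.1 (comap_ker_versalChart h hu) a)
    rw [← e]
    exact h1
  let φ := IsLocalization.ringEquivOfRingEquiv (M := (originIdeal (m + 1)).primeCompl)
    (T := (originIdeal (m + 2)).primeCompl.map (Ideal.Quotient.mk (Ideal.span {eqBCT m})))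
    (Localization.AtPrime (RingHom.ker (u : VersalChart h →+* κ)))
    (HypersurfaceGerm (m + 2) (eqBCT m)) (graphEquiv m hm).symm.toRingEquiv
    (map_primeCompl_graphEquiv hm)
  refine ⟨φ, fun p ↦ ?_⟩
  rw [algebraMap_versalChart]
  have h3 : φ (algebraMap (MvPolynomial (Fin (m + 1)) ℂ) _
      (Polynomial.aeval (MvPolynomial.X 0 * MvPolynomial.X 1) p)) =
      algebraMap _ (HypersurfaceGerm (m + 2) (eqBCT m)) ((graphEquiv m hm).symm
        (Polynomial.aeval (MvPolynomial.X 0 * MvPolynomial.X 1) p)) :=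
    IsLocalization.ringEquivOfRingEquiv_eq _ _
  refine h3.trans ?_
  have h4 := Polynomial.aeval_algHom_apply (graphEquiv m hm).symm.toAlgHom
    (MvPolynomial.X 0 * MvPolynomial.X 1) p
  have h5 : Polynomial.aeval ((graphEquiv m hm).symm (MvPolynomial.X 0 * MvPolynomial.X 1)) p =
      (graphEquiv m hm).symm (Polynomial.aeval (MvPolynomial.X 0 * MvPolynomial.X 1) p) := h4
  rw [← h5, graphEquiv_symm_mul]
  exact (Polynomial.aeval_algebraMap_apply _ _ _).symm

end VersalLocal

end

end NodeHilb


namespace NodeHilb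

noncomputable section

/-! ### The relative Hilbert scheme of the versal family -/

section VersalTotal

/-- The residue field of `ℂ[t]_(t)` is `ℂ`. -/
lemma nonempty_residueField_algHom :
    Nonempty (IsLocalRing.ResidueField BaseGerm →ₐ[ℂ] ℂ) := by
  let f : BaseGerm →+* ℂ := IsLocalization.lift (M := baseIdeal.primeCompl)
    (g := Polynomial.constantCoeff (R := ℂ)) fun p ↦
      isUnit_iff_ne_zero.2 fun h ↦ p.2 (RingHom.mem_ker.2 h)
  have hf (a : ℂ) : f (algebraMap ℂ BaseGerm a) = a := by
    rw [IsScalarTower.algebraMap_apply ℂ (Polynomial ℂ) BaseGerm]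
    exact (IsLocalization.lift_eq _ _).trans (by simp)
  have : IsLocalHom f := IsLocalHom.of_surjective f fun a ↦ ⟨_, hf a⟩
  exact ⟨{ IsLocalRing.ResidueField.lift f with commutes' := hf }⟩

lemma algebraMap_residueField_baseT :
    algebraMap BaseGerm (IsLocalRing.ResidueField BaseGerm) baseT = 0 := by
  refine (IsLocalRing.residue_eq_zero_iff _).2 ?_
  refine (IsLocalization.AtPrime.to_map_mem_maximal_iff BaseGerm baseIdeal Polynomial.X).2 ?_
  simp

variable {m : ℕ}

/-- The relative Hilbert scheme of the versal family with its charts. -/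
abbrev VersalCover (m : ℕ) : Type 1 :=
  ChartCover (k := BaseGerm) (algebraMap _ PlaneGerm (MvPolynomial.X 0 : MvPolynomial (Fin 2) ℂ))
    (algebraMap _ PlaneGerm (MvPolynomial.X 1 : MvPolynomial (Fin 2) ℂ))
    (fun i : Fin m ↦ versalPoint (chart_size i))

variable (K : VersalCover m)

theorem isSmoothTotalSpace : IsSmoothTotalSpace K.H where
  smooth p := by
    obtain ⟨i, q, rfl⟩ := K.cover p
    have hP := isPolyLoc_versalChart (chart_size i)
    refine smoothAt_of_chart (K.ι i) _ ?_ q (hP.isRegularLocalRing _) (hP.formallySmooth _)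
    rw [← Category.assoc, K.ι_str, baseStr, ← Spec.map_comp, ← CommRingCat.ofHom_comp,
      ← IsScalarTower.algebraMap_eq]
  dim p hp := by
    obtain ⟨i, q, rfl⟩ := K.cover p
    obtain ⟨u, hu⟩ := (K.isRationalPoint_iff i q).1 hp
    rw [specHom_closedPoint_eq_iff] at hu
    -- The dimension formula needs a point with values in `ℂ`. Composing with the injective map from
    -- the residue field to `ℂ` leaves the kernel unchanged.
    obtain ⟨ρ⟩ := nonempty_residueField_algHom
    let φ : VersalChart (chart_size i) →ₐ[ℂ] ℂ := ρ.comp (u.restrictScalars ℂ)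
    rw [ringKrullDim_stalk_chart]
    refine (isPolyLoc_versalChart (chart_size i)).ringKrullDim _ φ ?_
    rw [← hu]
    ext a
    exact map_eq_zero_iff (ρ : IsLocalRing.ResidueField BaseGerm →+* ℂ) (RingHom.injective _)
  local_eq i := by
    obtain ⟨u, hu⟩ := (isUniversal_versalPoint (chart_size i)).exists_hom
      (IsLocalRing.ResidueField BaseGerm) _
      (isChartPoint_axisCoord algebraMap_residueField_baseT (zero_mul 0) (fun _ ↦ rfl) fun _ ↦ rfl)
    let q : Spec (CommRingCat.of (VersalChart (chart_size i))) :=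
      specHom u (IsLocalRing.closedPoint (IsLocalRing.ResidueField BaseGerm))
    obtain ⟨φ, hφ⟩ := exists_versal_localization_equiv (chart_size i) hu (specPt q).asIdeal
      (specPt_specHom u).symm
    refine ⟨K.ι i q, (K.isPoint_iff _ i q).2 ⟨u, rfl, ?_⟩, (chartStalk (K.ι i) q).trans φ,
      fun p ↦ ?_⟩
    · rw [hu, familyIdeal_axisCoord_zero (chart_size i)]
    · exact (congrArg φ (chartStalk_stalkHom (K.ι i) K.H.str (K.ι_str i) q _)).trans (hφ p)

end VersalTotal

end

end NodeHilb

theorem proposition1p2 (m : ℕ) (hm : 1 ≤ m) :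
    (∃ (H : NodeHilb.HilbertScheme ℂ NodeHilb.NodeGerm m)
      (D : Fin (m + 1) → H.carrier.IdealSheafData), NodeHilb.IsSmoothChain H D) ∧
    (∃ H : NodeHilb.HilbertScheme NodeHilb.BaseGerm NodeHilb.PlaneGerm m,
      NodeHilb.IsSmoothTotalSpace H) := by
  obtain ⟨K⟩ := NodeHilb.exists_chartCover NodeHilb.isGerm_node
    (fun i : Fin m ↦ NodeHilb.isUniversal_nodePoint (NodeHilb.chart_size i)) hm
  obtain ⟨K'⟩ := NodeHilb.exists_chartCover NodeHilb.isGerm_plane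
    (fun i : Fin m ↦ NodeHilb.isUniversal_versalPoint (NodeHilb.chart_size i)) hm
  exact ⟨⟨K.H, NodeHilb.strata K, NodeHilb.isSmoothChain_strata K hm⟩,
    K'.H, NodeHilb.isSmoothTotalSpace K'⟩
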